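/- Let $\mathbb K\in\{\mathbb R,\mathbb C,\mathbb H\}$ and let $n\ge 0$ be an integer (empty products are $1$). Write $A\gg 0$ if $A=A^*$ and $qAq^*>0$ for every nonzero row $q$, let $[A]_j$ be the left upper $j\times j$ block of $A$, and let $W_n(\mathbb K)$ be the set of dissipative $n\times n$ matrices over $\mathbb K$, i.e. of the matrices $R$ with $R+R^*\gg 0$. Write $R=T+S$ with $T=T^*\gg 0$, $S=-S^*$. Here $dT$ is the product of the Lebesgue measures of the real diagonal entries $t_{kk}$ and of all real coordinates of the entries $t_{km}$, $k<m$; $dS$ is the product of the Lebesgue measures of the real coordinates of the purely imaginary diagonal entries $s_{kk}$ (absent for $\mathbb K=\mathbb R$) and of all real coordinates of the entries $s_{km}$, $k<m$. For a real or complex dissipative matrix $R$ with eigenvalues $r_1,\dots,r_m$ (with algebraic multiplicity; they have positive real part) put $\det R^{\tau}=\exp(\tau\sum_i\ln r_i)$, with the principal branch of $\ln$, and $\det R^{\{\sigma\|\tau\}}=\exp(\sigma\sum_i\ln r_i+\tau\sum_i\overline{\ln r_i})$. For a quaternionic dissipative $m\times m$ matrix $R$ put $\det R^{\tau}=\det R_{\mathbb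 R}^{\tau/4}$, where $R_{\mathbb R}$ is the corresponding operator on $\mathbb H^m=\mathbb R^{4m}$. Let $\lambda_j,\sigma_j,\tau_j\in\mathbb C$ for $1\le j\le n$, and $\lambda_{n+1}=\sigma_{n+1}=\tau_{n+1}=0$. In each of the following three formulas, if the arguments of both Gamma functions in the numerator have positive real part for all $k=1,\dots,n$, then the integral converges absolutely and the formula holds (with $1/\Gamma=0$ at the poles of $\Gamma$). (a) Over $\mathbb R$: $$\int_{T+S\in W_n(\mathbb R)}\prod_{j=1}^n\frac{\det[T]_j^{\lambda_j-\lambda_{j+1}}}{\det[1+T+S]_j^{\sigma_j-\sigma_{j+1}}}\,\det T^{-n}\,dT\,dS=\prod_{k=1}^n\pi^{k-1}\,\frac{\Gamma\bigl(\lambda_k-\tfrac{n+k}2+1\bigr)\,\Gamma\bigl(\sigma_k-\lambda_k-\tfrac{n-k}2\bigr)}{\Gamma(\sigma_k-n+k)}.$$ (b) Over $\mathbb C$: $$\int_{T+S\in W_n(\mathbb C)}\prod_{j=1}^n\frac{\det[T]_j^{\lambda_j-\lambda_{j+1}}}{\det[1+T+S]_j^{\{\sigma_j-\sigma_{j+1}\|\tau_j-\tau_{j+1}\}}}\,\det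 T^{-2n}\,dT\,dS=\prod_{k=1}^n2^{2(n-k+1)-\sigma_k-\tau_k}\,\pi^{2k-1}\,\frac{\Gamma(\lambda_k-n-k+1)\,\Gamma(\sigma_k+\tau_k-\lambda_k-n+k)}{\Gamma(\sigma_k-n+k)\,\Gamma(\tau_k-n+k)}.$$ (c) Over $\mathbb H$: $$\int_{T+S\in W_n(\mathbb H)}\prod_{j=1}^n\frac{\det[T]_j^{\lambda_j-\lambda_{j+1}}}{\det[1+T+S]_j^{\sigma_j-\sigma_{j+1}}}\,\det T^{-4n}\,dT\,dS=\prod_{k=1}^n2^{4(n-k+1)-\sigma_k}\,\pi^{4k-2}\,\frac{\Gamma(\lambda_k-2(n+k)+1)\,\Gamma(\sigma_k-\lambda_k-2(n-k))}{\Gamma\bigl(\tfrac{\sigma_k}2-2(n-k)\bigr)\,\Gamma\bigl(\tfrac{\sigma_k}2-2(n-k)-1\bigr)}.$$ -/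

import Mathlib

open MeasureTheory
open scoped Quaternion

noncomputable section

namespace DissipativeWedge

/-! ### Coordinates on Hermitian and anti-Hermitian matrices -/

/-- The positions strictly above the diagonal of an `n × n` matrix. -/
abbrev OffDiag (n : ℕ) : Type := {p : Fin n × Fin n // p.1 < p.2}

/-- The matrix `T = T*` with real diagonal entries `d` and entries `a` above the diagonal. -/
def hermMatrix {K : Type*} [Ring K] [StarRing K] [Algebra ℝ K] {n : ℕ}
    (d : Fin n → ℝ) (a : OffDiag n → K) : Matrix (Fin n) (Fin n) K :=
  Matrix.of fun i j =>
    if h : i < j then a ⟨(i, j), h⟩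
    else if h : j < i then star (a ⟨(j, i), h⟩)
    else algebraMap ℝ K (d i)

/-- The matrix `S = -S*` with (purely imaginary) diagonal entries `e` and entries `b` above the
diagonal. -/
def skewMatrix {K : Type*} [Ring K] [StarRing K] {n : ℕ}
    (e : Fin n → K) (b : OffDiag n → K) : Matrix (Fin n) (Fin n) K :=
  Matrix.of fun i j =>
    if h : i < j then b ⟨(i, j), h⟩
    else if h : j < i then -star (b ⟨(j, i), h⟩)
    else e i

/-- The left upper `j × j` block `[A]_j` of an `n × n` matrix (for `j ≤ n`). -/
def leadingBlock {K : Type*} {n : ℕ} (A : Matrix (Fin n) (Fin n) K) (j : ℕ) :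
    Matrix {i : Fin n // (i : ℕ) < j} {i : Fin n // (i : ℕ) < j} K :=
  A.toSquareBlockProp fun i => (i : ℕ) < j

/-! ### Powers of determinants of dissipative matrices -/

section DetPow

variable {ι : Type*} [Fintype ι] [DecidableEq ι]

/-- `∑ ln λ_j` over the eigenvalues `λ_j` of `R`, counted with algebraic multiplicity; `ln` is the
principal branch (eigenvalues of dissipative matrices have positive real part). -/
def logDet (R : Matrix ι ι ℂ) : ℂ := (R.charpoly.roots.map Complex.log).sum

/-- `det R ^ τ = exp (τ ∑ ln λ_j)` for a complex matrix. -/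
def complexDetPow (R : Matrix ι ι ℂ) (τ : ℂ) : ℂ := Complex.exp (τ * logDet R)

/-- `det R ^ {σ‖τ} = (det R) ^ σ * (conj (det R)) ^ τ` for a complex matrix. -/
def complexDetPow₂ (R : Matrix ι ι ℂ) (σ τ : ℂ) : ℂ :=
  Complex.exp (σ * logDet R) * Complex.exp (τ * star (logDet R))

/-- `det R ^ τ` for a real matrix. -/
def realDetPow (R : Matrix ι ι ℝ) (τ : ℂ) : ℂ := complexDetPow (R.map Complex.ofReal) τ

/-- The real matrix of the left multiplication `y ↦ q y` on `ℍ = ℝ⁴` in the basis `1, i, j, k`. -/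
def quatLeftMul (q : ℍ[ℝ]) : Matrix (Fin 4) (Fin 4) ℝ :=
  !![q.re, -q.imI, -q.imJ, -q.imK;
     q.imI, q.re, -q.imK, q.imJ;
     q.imJ, q.imK, q.re, -q.imI;
     q.imK, -q.imJ, q.imI, q.re]

/-- The real `4m × 4m` matrix of the operator on `ℍ^m = ℝ^{4m}` given by a quaternionic
`m × m` matrix. -/
def realification (R : Matrix ι ι ℍ[ℝ]) : Matrix (ι × Fin 4) (ι × Fin 4) ℝ :=
  Matrix.comp ι ι (Fin 4) (Fin 4) ℝ (R.map quatLeftMul)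

/-- `det R ^ τ = (det R_ℝ) ^ (τ / 4)` for a quaternionic matrix. -/
def quatDetPow (R : Matrix ι ι ℍ[ℝ]) (τ : ℂ) : ℂ := realDetPow (realification R) (τ / 4)

end DetPow

/-! ### The wedges of dissipative matrices -/

/-- The wedge `W_n(ℝ)`. -/
def realWedge (n : ℕ) : Set (Matrix (Fin n) (Fin n) ℝ) := {R | (R + R.conjTranspose).PosDef}

open scoped ComplexOrder in
/-- The wedge `W_n(ℂ)`. -/
def complexWedge (n : ℕ) : Set (Matrix (Fin n) (Fin n) ℂ) := {R | (R + R.conjTranspose).PosDef}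

/-- `A ≫ 0` for a quaternionic matrix: `A = A*`, and `q A q* > 0` for every nonzero row `q`
(the quaternion `q A q*` is real as soon as `A = A*`). -/
def QuatPosDef {n : ℕ} (A : Matrix (Fin n) (Fin n) ℍ[ℝ]) : Prop :=
  A.IsHermitian ∧ ∀ q : Fin n → ℍ[ℝ], q ≠ 0 → 0 < (q ⬝ᵥ A.mulVec (star q)).re

/-- The wedge `W_n(ℍ)`. -/
def quatWedge (n : ℕ) : Set (Matrix (Fin n) (Fin n) ℍ[ℝ]) := {R | QuatPosDef (R + R.conjTranspose)}

/-! ### The case `ℝ`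

A point `x` of the coordinate space consists of the coordinates of `T` and of those of `S`; the
measure `dT dS` is the product Lebesgue measure `volume`. -/

/-- Coordinates of `T` (diagonal, above the diagonal) and of `S` (above the diagonal). -/
abbrev RealCoords (n : ℕ) : Type :=
  ((Fin n → ℝ) × (OffDiag n → ℝ)) × (OffDiag n → ℝ)

/-- The symmetric part `T`. -/
def realT {n : ℕ} (x : RealCoords n) : Matrix (Fin n) (Fin n) ℝ := hermMatrix x.1.1 x.1.2

/-- The antisymmetric part `S`. -/
def realS {n : ℕ} (x : RealCoords n) : Matrix (Fin n) (Fin n) ℝ := skewMatrix 0 x.2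

/-- The domain of integration `T + S ∈ W_n(ℝ)`. -/
def realDomain (n : ℕ) : Set (RealCoords n) := {x | realT x + realS x ∈ realWedge n}

/-- The integrand over `W_n(ℝ)`. -/
def realIntegrand (n : ℕ) (lam sig : ℕ → ℂ) (x : RealCoords n) : ℂ :=
  (∏ j ∈ Finset.Icc 1 n,
    realDetPow (leadingBlock (realT x) j) (lam j - lam (j + 1)) /
      realDetPow (leadingBlock (1 + realT x + realS x) j) (sig j - sig (j + 1))) *
    realDetPow (realT x) (-(n : ℂ))

/-! ### The case `ℂ`

The measure `volume` on `ℂ` is `dp dq` for `p + i q`. -/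

/-- Coordinates of `T` (diagonal, above the diagonal) and of `S` (imaginary parts of the diagonal,
above the diagonal). -/
abbrev ComplexCoords (n : ℕ) : Type :=
  ((Fin n → ℝ) × (OffDiag n → ℂ)) × ((Fin n → ℝ) × (OffDiag n → ℂ))

/-- The Hermitian part `T`. -/
def complexT {n : ℕ} (x : ComplexCoords n) : Matrix (Fin n) (Fin n) ℂ := hermMatrix x.1.1 x.1.2

/-- The anti-Hermitian part `S`. -/
def complexS {n : ℕ} (x : ComplexCoords n) : Matrix (Fin n) (Fin n) ℂ :=
  skewMatrix (fun i => (x.2.1 i : ℂ) * Complex.I) x.2.2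

/-- The domain of integration `T + S ∈ W_n(ℂ)`. -/
def complexDomain (n : ℕ) : Set (ComplexCoords n) := {x | complexT x + complexS x ∈ complexWedge n}

/-- The integrand over `W_n(ℂ)`. -/
def complexIntegrand (n : ℕ) (lam sig tau : ℕ → ℂ) (x : ComplexCoords n) : ℂ :=
  (∏ j ∈ Finset.Icc 1 n,
    complexDetPow (leadingBlock (complexT x) j) (lam j - lam (j + 1)) /
      complexDetPow₂ (leadingBlock (1 + complexT x + complexS x) j)
        (sig j - sig (j + 1)) (tau j - tau (j + 1))) *
    complexDetPow (complexT x) (-(2 * n : ℂ))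

/-! ### The case `ℍ` -/

/-- The quaternion with real coordinates `v`. -/
def quatOf (v : Fin 4 → ℝ) : ℍ[ℝ] := ⟨v 0, v 1, v 2, v 3⟩

/-- The purely imaginary quaternion with coordinates `v`. -/
def quatImOf (v : Fin 3 → ℝ) : ℍ[ℝ] := ⟨0, v 0, v 1, v 2⟩

/-- Coordinates of `T` (diagonal, above the diagonal) and of `S` (imaginary parts of the diagonal,
above the diagonal). -/
abbrev QuatCoords (n : ℕ) : Type :=
  ((Fin n → ℝ) × (OffDiag n → Fin 4 → ℝ)) × ((Fin n → Fin 3 → ℝ) × (OffDiag n → Fin 4 → ℝ))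

/-- The Hermitian part `T`. -/
def quatT {n : ℕ} (x : QuatCoords n) : Matrix (Fin n) (Fin n) ℍ[ℝ] :=
  hermMatrix x.1.1 fun p => quatOf (x.1.2 p)

/-- The anti-Hermitian part `S`. -/
def quatS {n : ℕ} (x : QuatCoords n) : Matrix (Fin n) (Fin n) ℍ[ℝ] :=
  skewMatrix (fun i => quatImOf (x.2.1 i)) fun p => quatOf (x.2.2 p)

/-- The domain of integration `T + S ∈ W_n(ℍ)`. -/
def quatDomain (n : ℕ) : Set (QuatCoords n) := {x | quatT x + quatS x ∈ quatWedge n}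

/-- The integrand over `W_n(ℍ)`. -/
def quatIntegrand (n : ℕ) (lam sig : ℕ → ℂ) (x : QuatCoords n) : ℂ :=
  (∏ j ∈ Finset.Icc 1 n,
    quatDetPow (leadingBlock (quatT x) j) (lam j - lam (j + 1)) /
      quatDetPow (leadingBlock (1 + quatT x + quatS x) j) (sig j - sig (j + 1))) *
    quatDetPow (quatT x) (-(4 * n : ℂ))

end DissipativeWedge

end

open MeasureTheory
open scoped Quaternion

noncomputable section

namespace DissipativeWedge

/-! ### Real matrices: completing the square and the linear change of variables. -/

section RealMatrices

variable {ι : Type*} [Fintype ι] [DecidableEq ι]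

open Matrix

/-! Let d be the real dimension of 𝕂. The proof is by induction on n, integrating over the last row
and column with the preceding leading blocks A of T and Q of 1 + T + S held fixed. Let a, b be the
last columns of T and S above the diagonal, and t, s their last diagonal entries. The last pivots
(Schur complements) are u = t - a*A⁻¹a, a real number, and q = 1 + t + s - (a - b)*Q⁻¹(a + b), an
element of 𝕂. The wedge is the set where all pivots of T are positive (`mem_domain_succ`). The
logarithm of the determinant of a leading block is the sum of the logarithms of its pivots, so
summation by parts turns the integrand into a product of powers of pivots, the k-th pair carrying
λ_k, σ_k, τ_k alone (`prod_leadingBlock_eq_pivotProd`).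

The decisive identity is Re q = 1 + u + |C₁a|² + |C₂(b + La)|², with C₁, C₂, L depending only on the
fixed blocks (`exists_complete_square`). Taking u, C₁a, C₂(b + La) and Im q as new coordinates, the
factor of the last row and column no longer sees the fixed blocks, and the Jacobian is det Q · √(det
T), with determinants of real matrices. This weight is itself a product of powers of the remaining
pivots, so it merely shifts their exponents (`weight_mul_pivotProd`). Hence the integral is a
product of n independent fibre integrals (`CoordAlgebra.integral_pivotProd`).

A fibre integral is computed by homogeneity in q: integrating over Im q leaves a power of Re q times
the integral over imaginary parts at real part 1, and the rest follows from Laplace transforms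
(`integral_fiberFun`). The integral over imaginary parts is 1 for ℝ, Cauchy's beta integral for ℂ
(`integral_cauchyKernel`), and a three-dimensional integral of a power of 1 + |s|² for ℍ, where the
duplication formula gives the final shape.

Powers are defined by principal logarithms of eigenvalues. Their sum is the continuous branch of log
det along the segment from 1 (`logDet_eq_of_path`). This makes it additive over pivots
(`logDet_bordered`) and real for real matrices (`logDet_map_ofReal`). Over ℝ and ℍ only the real
determinant matters; over ℂ the phase does too. -/

theorem det_ne_zero_of_posDef_add_transpose {M : Matrix ι ι ℝ} (hM : (M + Mᵀ).PosDef) :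
    M.det ≠ 0 := by
  intro h
  obtain ⟨v, hv, hMv⟩ := Matrix.exists_mulVec_eq_zero_iff.2 h
  have h1 := hM.dotProduct_mulVec_pos hv
  rw [add_mulVec, hMv, mulVec_transpose, zero_add, star_trivial, dotProduct_comm,
    ← dotProduct_mulVec, hMv, dotProduct_zero] at h1
  exact lt_irrefl _ h1

open scoped MatrixOrder in
theorem exists_eq_transpose_mul_self {X : Matrix ι ι ℝ} (hX : X.PosDef) :
    ∃ C : Matrix ι ι ℝ, X = Cᵀ * C := by
  obtain ⟨C, hC⟩ := CStarAlgebra.nonneg_iff_eq_star_mul_self.mp hX.posSemidef.nonneg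
  exact ⟨C, by simpa [star_eq_conjTranspose] using hC⟩

omit [DecidableEq ι] in
theorem dotProduct_transpose_mul_self_mulVec (C : Matrix ι ι ℝ) (v : ι → ℝ) :
    v ⬝ᵥ (Cᵀ * C) *ᵥ v = (C *ᵥ v) ⬝ᵥ (C *ᵥ v) := by
  rw [← mulVec_mulVec, dotProduct_mulVec, vecMul_transpose]

/-- Completing the square in the real part of a pivot of `1 + T + S`. -/
theorem exists_complete_square {A S : Matrix ι ι ℝ} (hA : A.PosDef) (hS : Sᵀ = -S) :
    ∃ C₁ C₂ L : Matrix ι ι ℝ,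
      (C₁.det * C₂.det) ^ 2 * ((1 + A + S).det ^ 2 * A.det) = 1 ∧
      ∀ a b : ι → ℝ, a ⬝ᵥ A⁻¹ *ᵥ a - (a - b) ⬝ᵥ (1 + A + S)⁻¹ *ᵥ (a + b) =
        (C₁ *ᵥ a) ⬝ᵥ (C₁ *ᵥ a) + (C₂ *ᵥ (b + L *ᵥ a)) ⬝ᵥ (C₂ *ᵥ (b + L *ᵥ a)) := by
  have hAt : Aᵀ = A := by simpa using hA.isHermitian.eq
  set P : Matrix ι ι ℝ := 1 + A with hP
  have hPt : Pᵀ = P := by simp [hP, hAt]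
  have hPpos : P.PosDef := Matrix.PosDef.one.add hA
  set Q : Matrix ι ι ℝ := P + S with hQ
  have hQt : Qᵀ = P - S := by simp [hQ, hPt, hS, sub_eq_add_neg]
  have hQQ : Q + Qᵀ = P + P := by rw [hQt, hQ]; abel
  have hdQ : Q.det ≠ 0 := det_ne_zero_of_posDef_add_transpose (by rw [hQQ]; exact hPpos.add hPpos)
  have hdA : A.det ≠ 0 := hA.det_pos.ne'
  have hdP : P.det ≠ 0 := hPpos.det_pos.ne'
  have hQu : IsUnit Q.det := hdQ.isUnit
  have hAu : IsUnit A.det := hdA.isUnit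
  have hPu : IsUnit P.det := hdP.isUnit
  have hQtu : IsUnit Qᵀ.det := by rwa [det_transpose]
  set R := Q⁻¹ with hR
  have hQR : Q * R = 1 := mul_nonsing_inv _ hQu
  have hRQ : R * Q = 1 := nonsing_inv_mul _ hQu
  have hQRt : Rᵀ * Qᵀ = 1 := by rw [← transpose_mul, hQR, transpose_one]
  have hRQt : Qᵀ * Rᵀ = 1 := by rw [← transpose_mul, hRQ, transpose_one]
  -- the symmetric part of `R`
  set X := R * P * Rᵀ with hX
  have hXX : X + X = R + Rᵀ := by
    calc X + X = R * (P + P) * Rᵀ := by rw [hX]; noncomm_ring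
      _ = R * (Q + Qᵀ) * Rᵀ := by rw [hQQ]
      _ = (R * Q) * Rᵀ + R * (Qᵀ * Rᵀ) := by noncomm_ring
      _ = R + Rᵀ := by rw [hRQ, hRQt, mul_one, one_mul, add_comm]
  have hRu : IsUnit Rᵀ := ⟨⟨Rᵀ, Qᵀ, hQRt, hRQt⟩, rfl⟩
  have hXpos : X.PosDef := by
    have := hPpos.conjTranspose_mul_mul_same (B := Rᵀ) (mulVec_injective_of_isUnit hRu)
    simpa [hX] using this
  have hXt : Xᵀ = X := by simpa using hXpos.isHermitian.eq
  -- the positive form in `a`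
  set N := A⁻¹ - P⁻¹ with hN
  have hPP : P * P⁻¹ = 1 := mul_nonsing_inv _ hPu
  have hPP' : P⁻¹ * P = 1 := nonsing_inv_mul _ hPu
  have hAA : A * A⁻¹ = 1 := mul_nonsing_inv _ hAu
  have hAA' : A⁻¹ * A = 1 := nonsing_inv_mul _ hAu
  -- The resolvent identity A⁻¹ - P⁻¹ = A⁻¹(P - A)P⁻¹, where P - A = 1.
  have hN1 : N = A⁻¹ * P⁻¹ := by
    calc N = A⁻¹ * (P * P⁻¹) - (A⁻¹ * A) * P⁻¹ := by rw [hPP, hAA', mul_one, one_mul]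
      _ = A⁻¹ * P⁻¹ := by rw [hP]; noncomm_ring
  -- Written as a congruence of the positive matrix 1 + A⁻¹, so that positivity of N is immediate.
  have hN2 : N = (P⁻¹)ᵀ * (1 + A⁻¹) * P⁻¹ := by
    rw [hN1, transpose_nonsing_inv, hPt]
    have : P⁻¹ * (1 + A⁻¹) = P⁻¹ * P * A⁻¹ := by
      rw [hP, mul_add, mul_assoc, add_mul, one_mul, hAA, mul_add, mul_one]
      exact add_comm _ _
    rw [this, hPP', one_mul]
  have hPiu : IsUnit P⁻¹ := ⟨⟨P⁻¹, P, hPP', hPP⟩, rfl⟩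
  have hNpos : N.PosDef := by
    have := (Matrix.PosDef.one.add hA.inv).conjTranspose_mul_mul_same (B := P⁻¹)
      (mulVec_injective_of_isUnit hPiu)
    rw [hN2]; simpa using this
  obtain ⟨C₁, hC₁⟩ := exists_eq_transpose_mul_self hNpos
  obtain ⟨C₂, hC₂⟩ := exists_eq_transpose_mul_self hXpos
  -- `X * L` is the antisymmetric part of `R`
  set L := Qᵀ * P⁻¹ - 1 with hL
  have hXL : X * L = R - X := by
    have : X * L = R * P * (Rᵀ * Qᵀ) * P⁻¹ - X := by rw [hL, hX]; noncomm_ring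
    rw [this, hQRt, mul_one, mul_assoc, hPP, mul_one]
  have hLXL : Lᵀ * (X * L) = P⁻¹ - X := by
    have h1 : Lᵀ = P⁻¹ * Q - 1 := by
      rw [hL]; simp [transpose_mul, transpose_nonsing_inv, hPt]
    have h2 : P⁻¹ * Q * R = P⁻¹ := by rw [mul_assoc, hQR, mul_one]
    have h3 : P⁻¹ * Q * X = Rᵀ := by
      rw [hX, show P⁻¹ * Q * (R * P * Rᵀ) = P⁻¹ * (Q * R) * P * Rᵀ by noncomm_ring, hQR, mul_one,
        hPP', one_mul]
    rw [hXL, h1, sub_mul, mul_sub, h2, h3, one_mul, eq_sub_of_add_eq' hXX.symm]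
    abel
  refine ⟨C₁, C₂, L, ?_, ?_⟩
  · have h1 : C₁.det ^ 2 = (A.det)⁻¹ * (P.det)⁻¹ := by
      have := congrArg Matrix.det hC₁
      rw [hN1, det_mul, det_mul, det_transpose, det_nonsing_inv, det_nonsing_inv,
        Ring.inverse_eq_inv', ] at this
      rw [this, sq]
    have h2 : C₂.det ^ 2 = (Q.det)⁻¹ ^ 2 * P.det := by
      have := congrArg Matrix.det hC₂
      rw [hX, det_mul, det_mul, det_mul, det_transpose, det_transpose, hR, det_nonsing_inv,
        Ring.inverse_eq_inv'] at this
      rw [sq, ← this]; ring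
    rw [mul_pow, h1, h2]
    field_simp
  · intro a b
    rw [← dotProduct_transpose_mul_self_mulVec, ← dotProduct_transpose_mul_self_mulVec, ← hC₁,
      ← hC₂]
    have tr : ∀ (K : Matrix ι ι ℝ) (u v : ι → ℝ), u ⬝ᵥ K *ᵥ v = v ⬝ᵥ Kᵀ *ᵥ u := fun K u v => by
      rw [dotProduct_mulVec, mulVec_transpose, dotProduct_comm]
    have hRt : Rᵀ = X + X - R := by rw [hXX]; abel
    -- Only the symmetric part X of R contributes to a quadratic form. In the mixed terms a·Rb and
    -- b·Ra the antisymmetric part R - X = XL survives, and L absorbs it.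
    have e1 : ∀ v : ι → ℝ, v ⬝ᵥ R *ᵥ v = v ⬝ᵥ X *ᵥ v := fun v => by
      have := tr R v v
      rw [hRt, sub_mulVec, add_mulVec, dotProduct_sub, dotProduct_add] at this
      linarith
    have e2 : a ⬝ᵥ R *ᵥ b = 2 * (b ⬝ᵥ X *ᵥ a) - b ⬝ᵥ R *ᵥ a := by
      rw [tr, hRt, sub_mulVec, add_mulVec, dotProduct_sub, dotProduct_add]
      ring
    have e3 : b ⬝ᵥ X *ᵥ L *ᵥ a = b ⬝ᵥ R *ᵥ a - b ⬝ᵥ X *ᵥ a := by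
      rw [mulVec_mulVec, hXL, sub_mulVec, dotProduct_sub]
    have e4 : (L *ᵥ a) ⬝ᵥ X *ᵥ b = b ⬝ᵥ X *ᵥ L *ᵥ a := by rw [tr, hXt]
    have e5 : (L *ᵥ a) ⬝ᵥ X *ᵥ L *ᵥ a = a ⬝ᵥ P⁻¹ *ᵥ a - a ⬝ᵥ X *ᵥ a := by
      rw [dotProduct_comm, dotProduct_mulVec, ← mulVec_transpose, mulVec_mulVec, mulVec_mulVec,
        mul_assoc, hLXL, sub_mulVec, sub_dotProduct, dotProduct_comm, dotProduct_comm a (X *ᵥ a)]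
    simp only [sub_dotProduct, add_dotProduct, mulVec_add, dotProduct_add, hN, sub_mulVec,
      dotProduct_sub, e1, e2, e4, e5, e3]
    ring

/-- The map is a composition of three: translation of the last two coordinates by functions of (a,
b), the shear b ↦ b + La, and the linear maps C₁, C₂. The first two preserve volume, so only the
determinants of C₁ and C₂ enter, however nonlinear α and β are. -/
theorem map_quadratic_change_of_variables {F : Type*} [AddCommGroup F] [MeasureSpace F]
    [MeasurableAdd₂ F] [MeasurableNeg F]
    [SFinite (volume : Measure F)] [(volume : Measure F).IsAddRightInvariant]
    (C₁ C₂ L : Matrix ι ι ℝ) (hC₁ : C₁.det ≠ 0) (hC₂ : C₂.det ≠ 0)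
    {α : (ι → ℝ) × (ι → ℝ) → ℝ} (hα : Measurable α)
    {β : (ι → ℝ) × (ι → ℝ) → F} (hβ : Measurable β) :
    Measure.map (fun y : ((ι → ℝ) × (ι → ℝ)) × (ℝ × F) =>
        ((C₁ *ᵥ y.1.1, C₂ *ᵥ (y.1.2 + L *ᵥ y.1.1)), (y.2.1 - α y.1, y.2.2 - β y.1))) volume =
      ENNReal.ofReal |(C₁.det * C₂.det)⁻¹| • volume := by
  have hmv : ∀ C : Matrix ι ι ℝ, Measurable fun v : ι → ℝ => C *ᵥ v := fun C =>
    (Continuous.matrix_mulVec continuous_const continuous_id).measurable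
  have h1 : MeasurePreserving (fun y : ((ι → ℝ) × (ι → ℝ)) × (ℝ × F) =>
      (y.1, (y.2.1 - α y.1, y.2.2 - β y.1))) := by
    refine MeasurePreserving.skew_product (g := fun v (z : ℝ × F) => (z.1 - α v, z.2 - β v))
      (MeasurePreserving.id _) ?_ (Filter.Eventually.of_forall fun v => ?_)
    · simp only [Function.uncurry_def, sub_eq_add_neg]
      fun_prop
    · have := (measurePreserving_sub_right (volume : Measure ℝ) (α v)).prod
        (measurePreserving_add_right (volume : Measure F) (-β v))
      simpa [sub_eq_add_neg, Prod.map_def, ← Measure.volume_eq_prod] using this.map_eq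
  have h2 : MeasurePreserving (fun v : (ι → ℝ) × (ι → ℝ) => (v.1, v.2 + L *ᵥ v.1)) := by
    refine MeasurePreserving.skew_product (g := fun a b => b + L *ᵥ a)
      (MeasurePreserving.id _) ?_ (Filter.Eventually.of_forall fun v => ?_)
    · have := hmv L
      simp only [Function.uncurry_def]
      fun_prop
    · exact (measurePreserving_add_right _ _).map_eq
  have h3 : Measure.map (Prod.map (fun v : ι → ℝ => C₁ *ᵥ v) (fun v : ι → ℝ => C₂ *ᵥ v)) volume =
      ENNReal.ofReal |(C₁.det * C₂.det)⁻¹| • volume := by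
    rw [Measure.volume_eq_prod, ← Measure.map_prod_map _ _ (hmv C₁) (hmv C₂)]
    have e := fun (C : Matrix ι ι ℝ) (hC : C.det ≠ 0) => Real.map_matrix_volume_pi_eq_smul_volume_pi hC
    simp only [Matrix.toLin'_apply'] at e
    have e' : ∀ C : Matrix ι ι ℝ, C.det ≠ 0 → Measure.map (fun v => C *ᵥ v) volume = 
      ENNReal.ofReal |C.det⁻¹| • (volume : Measure (ι → ℝ)) := fun C hC => e C hC
    rw [e' C₁ hC₁, e' C₂ hC₂, Measure.prod_smul_left, Measure.prod_smul_right, smul_smul, mul_inv, abs_mul,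
      ENNReal.ofReal_mul (abs_nonneg _)]
  have h4 : (fun y : ((ι → ℝ) × (ι → ℝ)) × (ℝ × F) =>
        ((C₁ *ᵥ y.1.1, C₂ *ᵥ (y.1.2 + L *ᵥ y.1.1)), (y.2.1 - α y.1, y.2.2 - β y.1))) =
      (Prod.map (Prod.map (fun v : ι → ℝ => C₁ *ᵥ v) (fun v : ι → ℝ => C₂ *ᵥ v)) id) ∘
      (Prod.map (fun v : (ι → ℝ) × (ι → ℝ) => (v.1, v.2 + L *ᵥ v.1)) id) ∘
      (fun y : ((ι → ℝ) × (ι → ℝ)) × (ℝ × F) => (y.1, (y.2.1 - α y.1, y.2.2 - β y.1))) := rfl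
  have hm : Measurable (Prod.map (fun v : ι → ℝ => C₁ *ᵥ v) (fun v : ι → ℝ => C₂ *ᵥ v)) :=
    (hmv C₁).prodMap (hmv C₂)
  have h5 := (h2.prod (MeasurePreserving.id (volume : Measure (ℝ × F)))).comp h1
  rw [h4, ← Measure.map_map (hm.prodMap measurable_id) h5.measurable]
  have h6 := h5.map_eq
  rw [← Measure.volume_eq_prod] at h6
  rw [h6, Measure.volume_eq_prod, ← Measure.map_prod_map _ _ hm measurable_id, h3, Measure.map_id,
    Measure.prod_smul_left]

end RealMatrices

/-! ### The sum of the logarithms of eigenvalues as a continuous branch of log det. -/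

section LogDet

open Matrix

variable {ι : Type*} [Fintype ι] [DecidableEq ι]

/-- The segment from `1` to `R`. -/
def segmentToOne (R : Matrix ι ι ℂ) (s : ℝ) : Matrix ι ι ℂ := ((1 - s : ℝ) : ℂ) • 1 + (s : ℂ) • R

/-- The eigenvalues of (1 - s) + sR are 1 - s + sr. For s ≠ 0 this is the characteristic polynomial
evaluated at -(1 - s)/s, after -s is taken out of the determinant. -/
theorem det_segmentToOne (R : Matrix ι ι ℂ) (s : ℝ) :
    (segmentToOne R s).det = (R.charpoly.roots.map fun r => ((1 - s : ℝ) : ℂ) + s * r).prod := by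
  rcases eq_or_ne s 0 with rfl | hs
  · simp [segmentToOne]
  have hs' : (s : ℂ) ≠ 0 := by exact_mod_cast hs
  have hsp : R.charpoly.Splits := IsAlgClosed.splits _
  have hev := R.eval_charpoly (-(((1 - s : ℝ) : ℂ) / s))
  rw [hsp.eq_prod_roots_of_monic R.charpoly_monic, Polynomial.eval_multiset_prod,
    Multiset.map_map] at hev
  have hcard : R.charpoly.roots.card = Fintype.card ι := by
    rw [← hsp.natDegree_eq_card_roots, R.charpoly_natDegree_eq_dim]
  have h1 : segmentToOne R s =
      (-(s : ℂ)) • (scalar ι (-(((1 - s : ℝ) : ℂ) / s)) - R) := by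
    rw [segmentToOne, smul_sub, scalar_apply, ← Matrix.smul_one_eq_diagonal, smul_smul]
    have : -(s : ℂ) * -(((1 - s : ℝ) : ℂ) / s) = ((1 - s : ℝ) : ℂ) := by field_simp
    rw [this, neg_smul, sub_neg_eq_add]
  rw [h1, det_smul, ← hev, ← hcard, ← Multiset.prod_replicate, ← Multiset.map_const',
    ← Multiset.prod_map_mul]
  congr 1
  refine Multiset.map_congr rfl fun r _ => ?_
  simp
  field_simp
  ring

/-- A matrix all whose eigenvalues lie in the right half plane. -/
def HasPosSpectrum (R : Matrix ι ι ℂ) : Prop := ∀ r ∈ R.charpoly.roots, 0 < r.re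

theorem re_segment_pos {r : ℂ} (hr : 0 < r.re) {s : ℝ} (hs : s ∈ Set.Icc (0 : ℝ) 1) :
    0 < (((1 - s : ℝ) : ℂ) + s * r).re := by
  simp only [Complex.add_re, Complex.ofReal_re, Complex.re_ofReal_mul]
  rcases eq_or_lt_of_le hs.1 with h | h
  · simp [← h]
  · have := mul_pos h hr
    linarith [hs.2]

/-- The sum of the logarithms of the eigenvalues along the segment from `1` to `R`. -/
def logPath (R : Matrix ι ι ℂ) (s : ℝ) : ℂ :=
  (R.charpoly.roots.map fun r => Complex.log (((1 - s : ℝ) : ℂ) + s * r)).sum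

theorem logPath_zero (R : Matrix ι ι ℂ) : logPath R 0 = 0 := by simp [logPath]

theorem logPath_one (R : Matrix ι ι ℂ) : logPath R 1 = logDet R := by simp [logPath, logDet]

theorem continuousOn_logPath {R : Matrix ι ι ℂ} (hR : HasPosSpectrum R) :
    ContinuousOn (logPath R) (Set.Icc 0 1) := by
  refine continuousOn_multiset_sum _ fun r hr => ?_
  refine ContinuousOn.clog (by fun_prop) fun s hs => Or.inl (re_segment_pos (hR r hr) hs)

theorem exp_logPath {R : Matrix ι ι ℂ} (hR : HasPosSpectrum R) {s : ℝ}
    (hs : s ∈ Set.Icc (0 : ℝ) 1) : Complex.exp (logPath R s) = (segmentToOne R s).det := by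
  rw [logPath, Complex.exp_multiset_sum, Multiset.map_map, det_segmentToOne]
  congr 1
  refine Multiset.map_congr rfl fun r hr => ?_
  have := re_segment_pos (hR r hr) hs
  exact Complex.exp_log fun h => by rw [h] at this; exact lt_irrefl _ this

/-- `logDet` is the continuous branch of the logarithm of the determinant along the segment from
`1`. -/
theorem logDet_eq_of_path {R : Matrix ι ι ℂ} (hR : HasPosSpectrum R) {g : ℝ → ℂ}
    (hg : ContinuousOn g (Set.Icc 0 1)) (hg0 : g 0 = 0)
    (hexp : ∀ s ∈ Set.Icc (0 : ℝ) 1, Complex.exp (g s) = (segmentToOne R s).det) :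
    logDet R = g 1 := by
  set k : ℝ → ℂ := logPath R with hk
  have hkc : ContinuousOn k (Set.Icc 0 1) := continuousOn_logPath hR
  have hkexp : ∀ s ∈ Set.Icc (0 : ℝ) 1, Complex.exp (k s) = (segmentToOne R s).det :=
    fun s hs => exp_logPath hR hs
  -- Two logarithms of the same nonvanishing function differ by a multiple of 2πi; the integer is
  -- continuous in s, hence constant, and it is 0 at s = 0.
  have hint : ∀ s ∈ Set.Icc (0 : ℝ) 1, ∃ m : ℤ, k s - g s = m * (2 * Real.pi * Complex.I) := by
    intro s hs
    have : Complex.exp (k s - g s) = 1 := by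
      rw [Complex.exp_sub, hkexp s hs, hexp s hs, div_self]
      rw [← hkexp s hs]; exact Complex.exp_ne_zero _
    exact Complex.exp_eq_one_iff.1 this
  set φ : ℝ → ℝ := fun s => (k s - g s).im / (2 * Real.pi) with hφ
  have hφc : ContinuousOn φ (Set.Icc 0 1) :=
    (Complex.continuous_im.comp_continuousOn (hkc.sub hg)).div_const _
  have hφi : Set.MapsTo φ (Set.Icc 0 1) (Set.range ((↑) : ℤ → ℝ)) := by
    intro s hs
    obtain ⟨m, hm⟩ := hint s hs
    refine ⟨m, ?_⟩
    simp only [hφ, hm]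
    have : ((m : ℂ) * (2 * Real.pi * Complex.I)).im = m * (2 * Real.pi) := by
      simp [Complex.mul_im]
    rw [this]
    field_simp
  have hconst : φ 1 = φ 0 := by
    -- A countable subset of ℝ is totally disconnected, so the connected image of the interval under
    -- φ is a point.
    have hd : IsTotallyDisconnected (Set.range ((↑) : ℤ → ℝ)) :=
      (Set.countable_range _).isTotallyDisconnected
    have h1 := (isPreconnected_Icc.image _ hφc)
    exact hd _ hφi.image_subset h1 ⟨1, by simp, rfl⟩ ⟨0, by simp, rfl⟩
  have h0 : φ 0 = 0 := by simp [hφ, hk, hg0, logPath_zero]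
  obtain ⟨m, hm⟩ := hint 1 (by simp)
  have hm0 : m = 0 := by
    have : φ 1 = m := by
      simp only [hφ, hm]
      have : ((m : ℂ) * (2 * Real.pi * Complex.I)).im = m * (2 * Real.pi) := by
        simp [Complex.mul_im]
      rw [this]
      field_simp
    rw [hconst, h0] at this
    exact_mod_cast this.symm
  rw [hm0] at hm
  have : k 1 = logDet R := logPath_one R
  rw [← this, ← sub_eq_zero, hm]
  simp

/-- Complex dissipative matrices. -/
def IsDissipative (R : Matrix ι ι ℂ) : Prop := ∀ v : ι → ℂ, v ≠ 0 → 0 < (star v ⬝ᵥ R *ᵥ v).re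

omit [DecidableEq ι] in
theorem re_star_dotProduct_self_pos {v : ι → ℂ} (hv : v ≠ 0) : 0 < (star v ⬝ᵥ v).re := by
  open scoped ComplexOrder in
  have := dotProduct_star_self_pos_iff.2 hv
  exact (Complex.pos_iff.1 this).1

theorem IsDissipative.segmentToOne {R : Matrix ι ι ℂ} (hR : IsDissipative R) {s : ℝ}
    (hs : s ∈ Set.Icc (0 : ℝ) 1) : IsDissipative (segmentToOne R s) := by
  intro v hv
  have h1 := re_star_dotProduct_self_pos hv
  have h2 := hR v hv
  simp only [DissipativeWedge.segmentToOne, add_mulVec, smul_mulVec, one_mulVec, dotProduct_add,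
    dotProduct_smul, smul_eq_mul, Complex.add_re, Complex.re_ofReal_mul]
  rcases eq_or_lt_of_le hs.1 with h | h
  · simpa [← h] using h1
  · have := mul_pos h h2
    have := mul_nonneg (sub_nonneg.2 hs.2) h1.le
    linarith

theorem IsDissipative.det_ne_zero {R : Matrix ι ι ℂ} (hR : IsDissipative R) : R.det ≠ 0 := by
  intro h
  obtain ⟨v, hv, hMv⟩ := Matrix.exists_mulVec_eq_zero_iff.2 h
  have := hR v hv
  simp [hMv] at this

theorem IsDissipative.hasPosSpectrum {R : Matrix ι ι ℂ} (hR : IsDissipative R) :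
    HasPosSpectrum R := by
  intro r hr
  have h1 := (Polynomial.mem_roots'.1 hr).2
  rw [Polynomial.IsRoot, eval_charpoly] at h1
  obtain ⟨v, hv, hMv⟩ := Matrix.exists_mulVec_eq_zero_iff.2 h1
  rw [sub_mulVec, sub_eq_zero, scalar_apply, ← Matrix.smul_one_eq_diagonal, smul_mulVec, one_mulVec] at hMv
  have h2 := hR v hv
  have h3 := re_star_dotProduct_self_pos hv
  have h4 : (star v ⬝ᵥ v).im = 0 := by
    open scoped ComplexOrder in
    have := dotProduct_star_self_pos_iff.2 hv
    exact (Complex.pos_iff.1 this).2.symm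
  rw [← hMv, dotProduct_smul, smul_eq_mul, Complex.mul_re, h4, mul_zero, sub_zero] at h2
  exact pos_of_mul_pos_left h2 h3.le

omit [DecidableEq ι] in
-- For v = x + iy the cross terms x·My and y·Mx are purely imaginary, so the real part of v*Mv is
-- x·Mx + y·My.
theorem isDissipative_map_ofReal {M : Matrix ι ι ℝ} (hM : (M + Mᵀ).PosDef) :
    IsDissipative (M.map Complex.ofReal) := by
  intro v hv
  have hq : ∀ u : ι → ℝ, u ⬝ᵥ (M + Mᵀ) *ᵥ u = 2 * (u ⬝ᵥ M *ᵥ u) := fun u => by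
    rw [add_mulVec, dotProduct_add, mulVec_transpose, dotProduct_comm u (u ᵥ* M),
      ← dotProduct_mulVec]
    ring
  have hnn : ∀ u : ι → ℝ, 0 ≤ u ⬝ᵥ M *ᵥ u := fun u => by
    have := hM.posSemidef.dotProduct_mulVec_nonneg u
    rw [star_trivial, hq] at this
    linarith
  have hpos : ∀ u : ι → ℝ, u ≠ 0 → 0 < u ⬝ᵥ M *ᵥ u := fun u hu => by
    have := hM.dotProduct_mulVec_pos hu
    rw [star_trivial, hq] at this
    linarith
  set x : ι → ℝ := fun i => (v i).re
  set y : ι → ℝ := fun i => (v i).im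
  have hre : (star v ⬝ᵥ M.map Complex.ofReal *ᵥ v).re = x ⬝ᵥ M *ᵥ x + y ⬝ᵥ M *ᵥ y := by
    simp only [dotProduct, mulVec, Pi.star_apply, map_apply, Complex.re_sum, Complex.mul_re,
      Complex.im_sum, Complex.mul_im, Complex.ofReal_re, Complex.ofReal_im, zero_mul, sub_zero,
      add_zero, ← Finset.sum_add_distrib, Complex.star_def, Complex.conj_re, Complex.conj_im, x, y]
    refine Finset.sum_congr rfl fun i _ => ?_
    ring
  rw [hre]
  by_cases hx : x = 0
  · have hy : y ≠ 0 := fun hy => hv <| funext fun i =>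
      Complex.ext (congrFun hx i) (congrFun hy i)
    linarith [hnn x, hpos y hy]
  · linarith [hpos x hx, hnn y]

omit [Fintype ι] in
theorem segmentToOne_map_ofReal (M : Matrix ι ι ℝ) (s : ℝ) :
    segmentToOne (M.map Complex.ofReal) s = ((1 - s) • 1 + s • M).map Complex.ofReal := by
  ext i j
  by_cases h : i = j <;> simp [segmentToOne, one_apply, h]

theorem det_map_ofReal (M : Matrix ι ι ℝ) : (M.map Complex.ofReal).det = (M.det : ℂ) :=
  (RingHom.map_det Complex.ofRealHom M).symm

/-- The determinant equals 1 at s = 0 and never vanishes on the segment, so it cannot change sign.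
-/
theorem det_segment_pos {M : Matrix ι ι ℝ} (hM : (M + Mᵀ).PosDef) {s : ℝ}
    (hs : s ∈ Set.Icc (0 : ℝ) 1) : 0 < ((1 - s) • 1 + s • M).det := by
  have hne : ∀ s ∈ Set.Icc (0 : ℝ) 1, ((1 - s) • 1 + s • M).det ≠ 0 := fun s hs h => by
    have := ((isDissipative_map_ofReal hM).segmentToOne hs).det_ne_zero
    rw [segmentToOne_map_ofReal, det_map_ofReal, h] at this
    exact this rfl
  have hc : Continuous fun s : ℝ => ((1 - s) • (1 : Matrix ι ι ℝ) + s • M).det := by fun_prop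
  by_contra! hle
  have h01 := intermediate_value_Icc' hs.1 (hc.continuousOn (s := Set.Icc 0 s))
  obtain ⟨t, ht, h0⟩ := h01 ⟨hle, by simp⟩
  exact hne t ⟨ht.1, ht.2.trans hs.2⟩ h0

theorem det_pos_of_posDef_add_transpose {M : Matrix ι ι ℝ} (hM : (M + Mᵀ).PosDef) :
    0 < M.det := by
  simpa using det_segment_pos hM (s := 1) (by simp)

/-- The real logarithm of the positive determinant along the segment is a continuous branch starting
at 0, so it coincides with the sum of principal logarithms of the eigenvalues. -/
theorem logDet_map_ofReal {M : Matrix ι ι ℝ} (hM : (M + Mᵀ).PosDef) :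
    logDet (M.map Complex.ofReal) = Real.log M.det := by
  have h := logDet_eq_of_path (isDissipative_map_ofReal hM).hasPosSpectrum
    (g := fun s => ((Real.log ((1 - s) • 1 + s • M).det : ℝ) : ℂ)) ?_ (by simp) ?_
  · rw [h]
    simp
  · refine Complex.continuous_ofReal.comp_continuousOn (ContinuousOn.log (by fun_prop) ?_)
    exact fun s hs => (det_segment_pos hM hs).ne'
  · intro s hs
    rw [segmentToOne_map_ofReal, det_map_ofReal, ← Complex.ofReal_exp,
      Real.exp_log (det_segment_pos hM hs)]

theorem logDet_reindex {κ : Type*} [Fintype κ] [DecidableEq κ] (e : ι ≃ κ) (R : Matrix ι ι ℂ) :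
    logDet (reindex e e R) = logDet R := by
  rw [logDet, charpoly_reindex, logDet]

/-- The matrix with blocks `A`, `b`, `c`, `d`, the last one of size one. -/
def bordered (A : Matrix ι ι ℂ) (b c : ι → ℂ) (d : ℂ) : Matrix (ι ⊕ Unit) (ι ⊕ Unit) ℂ :=
  fromBlocks A (replicateCol Unit b) (replicateRow Unit c) (of fun _ _ => d)

theorem det_bordered {A : Matrix ι ι ℂ} (hA : A.det ≠ 0) (b c : ι → ℂ) (d : ℂ) :
    (bordered A b c d).det = A.det * (d - c ⬝ᵥ A⁻¹ *ᵥ b) := by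
  have : Invertible A := A.invertibleOfIsUnitDet hA.isUnit
  rw [bordered, det_fromBlocks₁₁, invOf_eq_nonsing_inv, det_unique (n := Unit)]
  congr 1
  rw [Matrix.sub_apply, of_apply, Matrix.mul_assoc]
  rfl

omit [DecidableEq ι] in
theorem bordered_mulVec (A : Matrix ι ι ℂ) (b c : ι → ℂ) (d : ℂ) (v : ι → ℂ) (z : ℂ) :
    bordered A b c d *ᵥ Sum.elim v (fun _ => z) =
      Sum.elim (A *ᵥ v + z • b) (fun _ => c ⬝ᵥ v + d * z) := by
  rw [bordered, fromBlocks_mulVec]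
  ext (i | i) <;> simp [mulVec, dotProduct, mul_comm]

omit [DecidableEq ι] in
theorem IsDissipative.of_bordered {A : Matrix ι ι ℂ} {b c : ι → ℂ} {d : ℂ}
    (h : IsDissipative (bordered A b c d)) : IsDissipative A := by
  intro v hv
  have := h (Sum.elim v fun _ => 0) fun h0 => hv (funext fun i => congrFun h0 (Sum.inl i))
  rw [bordered_mulVec] at this
  simpa [dotProduct] using this

/-- The vector (-A⁻¹b, 1) is sent to (0, d - c·A⁻¹b), so the quadratic form at this vector is the
Schur complement itself. -/
theorem re_schur_pos {A : Matrix ι ι ℂ} {b c : ι → ℂ} {d : ℂ}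
    (h : IsDissipative (bordered A b c d)) : 0 < (d - c ⬝ᵥ A⁻¹ *ᵥ b).re := by
  have hA := h.of_bordered.det_ne_zero
  have := h (Sum.elim (-(A⁻¹ *ᵥ b)) fun _ => 1)
    fun h0 => one_ne_zero (congrFun h0 (Sum.inr ()))
  rw [bordered_mulVec, mulVec_neg, mulVec_mulVec, mul_nonsing_inv _ hA.isUnit, one_mulVec,
    one_smul, neg_add_cancel] at this
  have h2 : star (Sum.elim (-(A⁻¹ *ᵥ b)) fun _ : Unit => (1 : ℂ)) ⬝ᵥ
      Sum.elim 0 (fun _ : Unit => c ⬝ᵥ -(A⁻¹ *ᵥ b) + d * 1) = d - c ⬝ᵥ A⁻¹ *ᵥ b := by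
    rw [dotProduct, Fintype.sum_sum_type]
    simp [dotProduct_neg]
    ring
  rwa [h2] at this

omit [Fintype ι] in
theorem segmentToOne_bordered (A : Matrix ι ι ℂ) (b c : ι → ℂ) (d : ℂ) (s : ℝ) :
    segmentToOne (bordered A b c d) s = bordered (segmentToOne A s) ((s : ℂ) • b) ((s : ℂ) • c)
      (((1 - s : ℝ) : ℂ) + s * d) := by
  ext (i | i) (j | j) <;> simp [segmentToOne, bordered, one_apply]

/-- The segment from 1 to a bordered matrix consists of bordered dissipative matrices. Their Schur
complements stay in the right half plane, where the principal logarithm is continuous, so the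
logarithm for the block plus that of the Schur complement is a continuous logarithm of the
determinant vanishing at 1. -/
theorem logDet_bordered {A : Matrix ι ι ℂ} {b c : ι → ℂ} {d : ℂ}
    (h : IsDissipative (bordered A b c d)) :
    logDet (bordered A b c d) = logDet A + Complex.log (d - c ⬝ᵥ A⁻¹ *ᵥ b) := by
  set q : ℝ → ℂ := fun s => (((1 - s : ℝ) : ℂ) + s * d) -
    ((s : ℂ) • c) ⬝ᵥ (segmentToOne A s)⁻¹ *ᵥ ((s : ℂ) • b) with hq
  have hseg : ∀ s ∈ Set.Icc (0 : ℝ) 1, IsDissipative (bordered (segmentToOne A s) ((s : ℂ) • b)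
      ((s : ℂ) • c) (((1 - s : ℝ) : ℂ) + s * d)) := fun s hs => by
    rw [← segmentToOne_bordered]
    exact h.segmentToOne hs
  have hdet : ∀ s ∈ Set.Icc (0 : ℝ) 1, (segmentToOne A s).det ≠ 0 := fun s hs =>
    (hseg s hs).of_bordered.det_ne_zero
  have hqpos : ∀ s ∈ Set.Icc (0 : ℝ) 1, 0 < (q s).re := fun s hs => re_schur_pos (hseg s hs)
  have hsc : Continuous (segmentToOne A) := by unfold segmentToOne; fun_prop
  have hqc : ContinuousOn q (Set.Icc 0 1) := by
    -- The adjugate form of the inverse shows continuity, the determinant of the block being nonzero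
    -- on the segment.
    have : q = fun s : ℝ => (((1 - s : ℝ) : ℂ) + s * d) - (segmentToOne A s).det⁻¹ *
        (((s : ℂ) • c) ⬝ᵥ (segmentToOne A s).adjugate *ᵥ ((s : ℂ) • b)) := by
      funext s
      rw [hq]
      simp only [inv_def, Ring.inverse_eq_inv', smul_mulVec, dotProduct_smul, smul_eq_mul]
    rw [this]
    refine ContinuousOn.sub (by fun_prop) (ContinuousOn.mul (ContinuousOn.inv₀ ?_ hdet) ?_)
    · exact hsc.matrix_det.continuousOn
    · refine Continuous.continuousOn ?_
      have := hsc.matrix_adjugate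
      fun_prop
  rw [logDet_eq_of_path h.hasPosSpectrum (g := fun s => logPath A s + Complex.log (q s))
    (((continuousOn_logPath h.of_bordered.hasPosSpectrum)).add
      (hqc.clog fun s hs => Or.inl (hqpos s hs)))]
  · simp [logPath_one, hq, segmentToOne]
  · simp [logPath_zero, hq]
  · intro s hs
    rw [Complex.exp_add, exp_logPath h.of_bordered.hasPosSpectrum hs, Complex.exp_log,
      segmentToOne_bordered, det_bordered (hdet s hs)]
    intro h0
    have := hqpos s hs
    rw [h0] at this
    exact lt_irrefl _ this

end LogDet

/-! ### Laplace transforms of powers and Gaussian integrals. -/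

section Integrals

open Complex Set

theorem integrableOn_cpow_mul_exp_neg_mul {a r : ℂ} (ha : 0 < a.re) (hr : 0 < r.re) :
    IntegrableOn (fun x : ℝ => (x : ℂ) ^ (a - 1) * exp (-(r * x))) (Ioi 0) := by
  have h := integrableOn_rpow_mul_exp_neg_mul_rpow (s := a.re - 1) (p := 1) (b := r.re)
    (by linarith) one_pos hr
  refine Integrable.mono' h (Measurable.aestronglyMeasurable (by fun_prop)) ?_
  filter_upwards [ae_restrict_mem measurableSet_Ioi] with x hx
  rw [norm_mul, norm_cpow_eq_rpow_re_of_pos hx, norm_exp]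
  simp

/-- Holomorphy of the Laplace transform in r, needed for analytic continuation from real r. On the
disc of radius Re r / 2 about r the real part stays above Re r / 2, which gives the dominating
function. -/
theorem hasDerivAt_integral_cpow_mul_exp {a r : ℂ} (ha : 0 < a.re) (hr : 0 < r.re) :
    HasDerivAt (fun r : ℂ => ∫ x : ℝ in Ioi 0, (x : ℂ) ^ (a - 1) * exp (-(r * x)))
      (∫ x : ℝ in Ioi 0, -((x : ℂ) ^ (a - 1) * exp (-(r * x)) * x)) r := by
  have hb := integrableOn_rpow_mul_exp_neg_mul_rpow (s := a.re) (p := 1) (b := r.re / 2)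
    (by linarith) one_pos (half_pos hr)
  refine (hasDerivAt_integral_of_dominated_loc_of_deriv_le (μ := volume.restrict (Ioi 0))
    (F := fun (r : ℂ) (x : ℝ) => (x : ℂ) ^ (a - 1) * exp (-(r * x))) (Metric.ball_mem_nhds r (half_pos hr))
    (F' := fun r x => -((x : ℂ) ^ (a - 1) * exp (-(r * x)) * x)) ?_
    (integrableOn_cpow_mul_exp_neg_mul ha hr) ?_ ?_ hb ?_).2
  · exact Filter.Eventually.of_forall fun r => Measurable.aestronglyMeasurable (by fun_prop)
  · exact Measurable.aestronglyMeasurable (by fun_prop)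
  · filter_upwards [ae_restrict_mem measurableSet_Ioi] with x hx z hz
    have hx0 : (0 : ℝ) < x := hx
    rw [norm_neg, norm_mul, norm_mul, norm_cpow_eq_rpow_re_of_pos hx, norm_exp, norm_real,
      Real.norm_of_nonneg hx0.le, mul_right_comm, sub_re, one_re, ← Real.rpow_add_one hx0.ne',
      sub_add_cancel, Real.rpow_one]
    refine mul_le_mul_of_nonneg_left (Real.exp_le_exp.2 ?_) (Real.rpow_nonneg hx0.le _)
    have h1 : |(z - r).re| ≤ ‖z - r‖ := abs_re_le_norm _
    have h2 : ‖z - r‖ < r.re / 2 := by simpa [dist_eq_norm] using hz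
    have h3 : r.re / 2 ≤ z.re := by
      have := (abs_le.1 (h1.trans h2.le)).1
      rw [sub_re] at this
      linarith
    have h4 := mul_le_mul_of_nonneg_right h3 hx0.le
    have h5 : (-(z * x)).re = -(z.re * x) := by simp
    rw [h5]
    linarith
  · refine Filter.Eventually.of_forall fun x z _ => ?_
    have h1 : HasDerivAt (fun z : ℂ => -(z * x)) (-(1 * (x : ℂ))) z :=
      ((hasDerivAt_id z).mul_const _).neg
    refine (h1.cexp.const_mul ((x : ℂ) ^ (a - 1))).congr_deriv ?_
    ring

/-- The Laplace transform of a power, at complex arguments. -/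
theorem integral_cpow_mul_exp_neg_complex_mul {a r : ℂ} (ha : 0 < a.re) (hr : 0 < r.re) :
    ∫ x : ℝ in Ioi 0, (x : ℂ) ^ (a - 1) * exp (-(r * x)) = Gamma a * r ^ (-a) := by
  set U : Set ℂ := {r | 0 < r.re}
  have hU : IsOpen U := isOpen_lt continuous_const continuous_re
  have hUc : IsPreconnected U := (convex_halfSpace_re_gt 0).isPreconnected
  have h1 : AnalyticOnNhd ℂ (fun r : ℂ => ∫ x : ℝ in Ioi 0, (x : ℂ) ^ (a - 1) * exp (-(r * x))) U :=
    DifferentiableOn.analyticOnNhd (fun r hr =>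
      (hasDerivAt_integral_cpow_mul_exp ha hr).differentiableAt.differentiableWithinAt) hU
  have h2 : AnalyticOnNhd ℂ (fun r : ℂ => Gamma a * r ^ (-a)) U :=
    DifferentiableOn.analyticOnNhd (fun r hr => DifferentiableAt.differentiableWithinAt
      (DifferentiableAt.const_mul (differentiableAt_id.cpow_const (Or.inl hr)) _)) hU
  have h3 : ∀ t : ℝ, 0 < t → ∫ x : ℝ in Ioi 0, (x : ℂ) ^ (a - 1) * exp (-((t : ℂ) * x)) =
      Gamma a * (t : ℂ) ^ (-a) := fun t ht => by
    rw [integral_cpow_mul_exp_neg_mul_Ioi ha ht, mul_comm, cpow_neg, one_div, inv_cpow]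
    rw [arg_ofReal_of_nonneg ht.le]
    exact Real.pi_ne_zero.symm
  -- Identity theorem on the right half plane: both sides agree at the points 1 + 1/(n + 1), which
  -- accumulate at 1.
  refine h1.eqOn_of_preconnected_of_frequently_eq h2 hUc (z₀ := 1) (by simp [U]) ?_ hr
  have ht : Filter.Tendsto (fun n : ℕ => (((1 + 1 / ((n : ℝ) + 1) : ℝ)) : ℂ)) Filter.atTop
      (nhdsWithin 1 {1}ᶜ) := by
    refine tendsto_nhdsWithin_iff.2 ⟨?_, Filter.Eventually.of_forall fun n => ?_⟩
    · have := (tendsto_one_div_add_atTop_nhds_zero_nat (𝕜 := ℝ)).const_add 1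
      rw [add_zero] at this
      exact (continuous_ofReal.tendsto _).comp this
    · have : (1 : ℝ) / ((n : ℝ) + 1) ≠ 0 := by positivity
      simp only [mem_compl_iff, mem_singleton_iff]
      intro h
      have h' := ofReal_injective (h.trans ofReal_one.symm)
      exact this (by linarith)
  exact ht.frequently (Filter.Frequently.of_forall fun n => h3 _ (by positivity))

/-- Integrals of powers of `c + φ` from the Laplace transform of a density. -/
theorem integral_mul_add_cpow_of_laplace {Z : Type*} [MeasurableSpace Z] {μ : Measure Z}
    [SFinite μ] {w : Z → ℂ} {φ : Z → ℝ} (hw : Measurable w) (hφ : Measurable φ)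
    (hφ0 : ∀ᵐ z ∂μ, 0 ≤ φ z) {A b : ℂ} {A' : ℝ}
    (hint : ∀ x : ℝ, 0 < x → Integrable (fun z => w z * Real.exp (-(x * φ z))) μ)
    (hval : ∀ x : ℝ, 0 < x → ∫ z, w z * Real.exp (-(x * φ z)) ∂μ = A * (x : ℂ) ^ (-b))
    (hnorm : ∀ x : ℝ, 0 < x → ∫ z, ‖w z‖ * Real.exp (-(x * φ z)) ∂μ = A' * x ^ (-b.re))
    {c : ℝ} (hc : 0 < c) {ρ : ℂ} (hρ : 0 < ρ.re) (hρb : 0 < (ρ - b).re) :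
    Integrable (fun z => w z * ((c + φ z : ℝ) : ℂ) ^ (-ρ)) μ ∧
    ∫ z, w z * ((c + φ z : ℝ) : ℂ) ^ (-ρ) ∂μ =
      A * Gamma (ρ - b) / Gamma ρ * (c : ℂ) ^ (b - ρ) := by
  -- Since Γ(ρ)(c + φ)^(-ρ) is the integral of x^(ρ-1) exp(-x(c + φ)) over x > 0, the claim is
  -- Fubini for f: integrating over Z first gives a Laplace transform in x of the power ρ - b - 1.
  set f : ℝ × Z → ℂ := fun p => (p.1 : ℂ) ^ (ρ - 1) * Real.exp (-(c * p.1)) *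
    (w p.2 * Real.exp (-(p.1 * φ p.2))) with hf
  have hfm : Measurable f := by fun_prop
  have hGρ : Gamma ρ ≠ 0 := Gamma_ne_zero_of_re_pos hρ
  have hfi : Integrable f ((volume.restrict (Ioi 0)).prod μ) := by
    rw [integrable_prod_iff hfm.aestronglyMeasurable]
    constructor
    · filter_upwards [ae_restrict_mem measurableSet_Ioi] with x hx
      exact (hint x hx).const_mul ((x : ℂ) ^ (ρ - 1) * Real.exp (-(c * x)))
    -- The transform of |w| has the exponent -Re b, so the norms again integrate to a convergent
    -- Gamma integral.
    · have h1 := (integrableOn_cpow_mul_exp_neg_mul (a := ρ - b) (r := c) hρb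
        (by simpa using hc)).norm.mul_const A'
      refine h1.congr ?_
      filter_upwards [ae_restrict_mem measurableSet_Ioi] with x hx
      have hx0 : (0 : ℝ) < x := hx
      have h2 : ∀ z, ‖f (x, z)‖ = ‖(x : ℂ) ^ (ρ - 1) * Real.exp (-(c * x))‖ *
          (‖w z‖ * Real.exp (-(x * φ z))) := fun z => by
        simp only [hf, norm_mul, norm_real, Real.norm_of_nonneg (Real.exp_nonneg _)]
      simp_rw [h2]
      rw [integral_const_mul, hnorm x hx, norm_mul, norm_mul, norm_cpow_eq_rpow_re_of_pos hx0,
        norm_cpow_eq_rpow_re_of_pos hx0, norm_exp, norm_real,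
        Real.norm_of_nonneg (Real.exp_nonneg _)]
      have h3 : (ρ - b - 1).re = (ρ - 1).re + -b.re := by simp; ring
      rw [h3, Real.rpow_add hx0]
      simp
      ring
  have hinner : ∀ᵐ z ∂μ, ∫ x : ℝ in Ioi 0, f (x, z) =
      Gamma ρ * (w z * ((c + φ z : ℝ) : ℂ) ^ (-ρ)) := by
    filter_upwards [hφ0] with z hz
    have hpos : 0 < c + φ z := by linarith
    have h1 := integral_cpow_mul_exp_neg_complex_mul (a := ρ) (r := ((c + φ z : ℝ) : ℂ)) hρ
      (by simpa using hpos)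
    rw [mul_left_comm, ← h1, ← integral_const_mul]
    refine integral_congr_ae (Filter.Eventually.of_forall fun x => ?_)
    simp only [hf, ofReal_exp]
    rw [show -(((c + φ z : ℝ) : ℂ) * x) = ((-(c * x) : ℝ) : ℂ) + ((-(x * φ z) : ℝ) : ℂ) by
      push_cast; ring, exp_add]
    ring
  have hI := hfi.integral_prod_right
  constructor
  · refine (hI.const_mul (Gamma ρ)⁻¹).congr ?_
    filter_upwards [hinner] with z hz
    rw [hz, inv_mul_cancel_left₀ hGρ]
  · have h1 : ∫ z, (∫ x : ℝ in Ioi 0, f (x, z)) ∂μ =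
        Gamma ρ * ∫ z, w z * ((c + φ z : ℝ) : ℂ) ^ (-ρ) ∂μ := by
      rw [integral_congr_ae hinner, integral_const_mul]
    have h2 : ∫ x : ℝ in Ioi 0, ∫ z, f (x, z) ∂μ = A * (Gamma (ρ - b) * (c : ℂ) ^ (-(ρ - b))) := by
      rw [← integral_cpow_mul_exp_neg_complex_mul (a := ρ - b) (r := c) hρb (by simpa using hc),
        ← integral_const_mul]
      refine setIntegral_congr_fun measurableSet_Ioi fun x hx => ?_
      have hx0 : (x : ℂ) ≠ 0 := by exact_mod_cast (ne_of_gt hx)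
      simp only [hf]
      rw [integral_const_mul, hval x hx, show ρ - b - 1 = (ρ - 1) + -b by ring, cpow_add _ _ hx0]
      push_cast
      ring
    have h3 : ∫ z, (∫ x : ℝ in Ioi 0, f (x, z)) ∂μ = ∫ x : ℝ in Ioi 0, ∫ z, f (x, z) ∂μ :=
      (integral_integral_swap (f := fun x z => f (x, z)) hfi).symm
    rw [h1, h2] at h3
    field_simp
    rw [mul_comm, h3, show b - ρ = -(ρ - b) by ring]
    ring

theorem integrable_exp_neg_mul_dotProduct_self {ι : Type*} [Fintype ι] {x : ℝ} (hx : 0 < x) :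
    Integrable (fun v : ι → ℝ => Real.exp (-(x * (v ⬝ᵥ v)))) := by
  have h := Integrable.fintype_prod (f := fun (_ : ι) (t : ℝ) => Real.exp (-x * t ^ 2))
    (μ := fun _ => volume) (fun _ => integrable_exp_neg_mul_sq hx)
  refine h.congr (Filter.Eventually.of_forall fun v => ?_)
  simp only [← Real.exp_sum]
  congr 1
  simp [dotProduct, Finset.mul_sum, sq]

theorem integral_exp_neg_mul_dotProduct_self {ι : Type*} [Fintype ι] {x : ℝ} (hx : 0 < x) :
    ∫ v : ι → ℝ, Real.exp (-(x * (v ⬝ᵥ v))) = (Real.pi / x) ^ (Fintype.card ι / 2 : ℝ) := by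
  have h := integral_fintype_prod_volume_eq_pow (ι := ι) (fun t : ℝ => Real.exp (-x * t ^ 2))
  rw [integral_gaussian, Real.sqrt_eq_rpow, ← Real.rpow_mul_natCast (by positivity)] at h
  rw [show (Fintype.card ι / 2 : ℝ) = 1 / 2 * Fintype.card ι by ring, ← h]
  congr 1
  funext v
  rw [← Real.exp_sum]
  congr 1
  simp [dotProduct, Finset.mul_sum, sq]

end Integrals

/-! ### Cauchy's beta integral by Fourier analysis and a recurrence. -/

section CauchyBeta

open Complex Set
open scoped FourierTransform

theorem one_add_mul_I_mem_slitPlane (s : ℝ) : 1 + s * I ∈ slitPlane := Or.inl (by simp)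

theorem one_sub_mul_I_mem_slitPlane (s : ℝ) : 1 - s * I ∈ slitPlane := Or.inl (by simp)

theorem norm_one_add_mul_I (s : ℝ) : ‖(1 + s * I : ℂ)‖ = (1 + ‖s‖ ^ 2) ^ (1 / 2 : ℝ) := by
  rw [← Real.sqrt_eq_rpow, norm_def, normSq_apply]
  simp [sq]

theorem norm_one_sub_mul_I (s : ℝ) : ‖(1 - s * I : ℂ)‖ = (1 + ‖s‖ ^ 2) ^ (1 / 2 : ℝ) := by
  rw [← Real.sqrt_eq_rpow, norm_def, normSq_apply]
  simp [sq]

/-- The integrand of Cauchy's beta integral. -/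
def cauchyKernel (σ τ : ℂ) (s : ℝ) : ℂ := (1 + s * I) ^ (-σ) * (1 - s * I) ^ (-τ)

theorem continuous_cauchyKernel (σ τ : ℂ) : Continuous (cauchyKernel σ τ) :=
  (Continuous.cpow (by fun_prop) continuous_const one_add_mul_I_mem_slitPlane).mul
    (Continuous.cpow (by fun_prop) continuous_const one_sub_mul_I_mem_slitPlane)

theorem norm_cpow_le_mul_exp (z w : ℂ) : ‖z ^ w‖ ≤ Real.exp (Real.pi * |w.im|) * ‖z‖ ^ w.re := by
  refine (norm_cpow_le z w).trans ?_
  rw [div_eq_mul_inv, ← Real.exp_neg, mul_comm]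
  refine mul_le_mul_of_nonneg_right (Real.exp_le_exp.2 ?_) (by positivity)
  calc -(arg z * w.im) ≤ |arg z * w.im| := neg_le_abs _
    _ = |arg z| * |w.im| := abs_mul _ _
    _ ≤ Real.pi * |w.im| := mul_le_mul_of_nonneg_right (abs_arg_le_pi z) (abs_nonneg _)

theorem norm_cauchyKernel_le (σ τ : ℂ) (s : ℝ) : ‖cauchyKernel σ τ s‖ ≤
    Real.exp (Real.pi * |σ.im|) * Real.exp (Real.pi * |τ.im|) *
      (1 + ‖s‖ ^ 2) ^ (-(σ + τ).re / 2) := by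
  have h1 := norm_cpow_le_mul_exp (1 + s * I) (-σ)
  have h2 := norm_cpow_le_mul_exp (1 - s * I) (-τ)
  have hpos : 0 < 1 + ‖s‖ ^ 2 := by positivity
  rw [neg_im, abs_neg, neg_re, norm_one_add_mul_I, ← Real.rpow_mul hpos.le] at h1
  rw [neg_im, abs_neg, neg_re, norm_one_sub_mul_I, ← Real.rpow_mul hpos.le] at h2
  rw [cauchyKernel, norm_mul]
  refine (mul_le_mul h1 h2 (norm_nonneg _) (by positivity)).trans_eq ?_
  rw [mul_mul_mul_comm, ← Real.rpow_add hpos, add_re]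
  ring_nf

theorem integrable_cauchyKernel {σ τ : ℂ} (h : 1 < (σ + τ).re) :
    Integrable (cauchyKernel σ τ) := by
  have h1 := integrable_rpow_neg_one_add_norm_sq (E := ℝ) (μ := volume) (r := (σ + τ).re)
    (by simpa using h)
  exact (h1.const_mul _).mono' (continuous_cauchyKernel σ τ).aestronglyMeasurable
    (Filter.Eventually.of_forall fun s => norm_cauchyKernel_le σ τ s)

theorem tendsto_cauchyKernel {σ τ : ℂ} (h : 0 < (σ + τ).re) {l : Filter ℝ}
    (hl : Filter.Tendsto (fun s : ℝ => ‖s‖) l Filter.atTop) :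
    Filter.Tendsto (cauchyKernel σ τ) l (nhds 0) := by
  refine squeeze_zero_norm (norm_cauchyKernel_le σ τ) ?_
  have h1 : Filter.Tendsto (fun s : ℝ => 1 + ‖s‖ ^ 2) l Filter.atTop :=
    Filter.tendsto_atTop_add_const_left _ _ ((Filter.tendsto_pow_atTop two_ne_zero).comp hl)
  have h2 := (tendsto_rpow_neg_atTop (half_pos h)).comp h1
  have h3 := h2.const_mul (Real.exp (Real.pi * |σ.im|) * Real.exp (Real.pi * |τ.im|))
  rw [mul_zero] at h3
  refine h3.congr fun s => ?_
  simp only [Function.comp_apply, neg_div]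

theorem hasDerivAt_cauchyKernel (σ τ : ℂ) (s : ℝ) :
    HasDerivAt (cauchyKernel σ τ)
      (-σ * I * cauchyKernel (σ + 1) τ s + τ * I * cauchyKernel σ (τ + 1) s) s := by
  have h1 : HasDerivAt (fun z : ℂ => 1 + z * I) I s := by
    simpa using ((hasDerivAt_id (s : ℂ)).mul_const I).const_add 1
  have h2 : HasDerivAt (fun z : ℂ => 1 - z * I) (-I) s := by
    simpa using ((hasDerivAt_id (s : ℂ)).mul_const I).const_sub 1
  have h3 := ((h1.cpow_const (c := -σ) (one_add_mul_I_mem_slitPlane s)).mul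
    (h2.cpow_const (c := -τ) (one_sub_mul_I_mem_slitPlane s))).comp_ofReal
  refine h3.congr_deriv ?_
  simp only [cauchyKernel, neg_add, ← sub_eq_add_neg]
  ring

/-- Integrating the derivative of the kernel with parameters (σ, τ - 1), which vanishes at ±∞,
relates the parameters (σ + 1, τ - 1) and (σ, τ). The identity (1 + is) + (1 - is) = 2 supplies the
second linear relation. -/
theorem integral_cauchyKernel_succ {σ τ : ℂ} (h : 1 < (σ + τ).re) :
    2 * σ * ∫ s, cauchyKernel (σ + 1) τ s = (σ + τ - 1) * ∫ s, cauchyKernel σ τ s := by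
  have i1 : Integrable (cauchyKernel (σ + 1) (τ - 1)) := integrable_cauchyKernel (by
    rw [show σ + 1 + (τ - 1) = σ + τ by ring]; exact h)
  have i2 : Integrable (cauchyKernel σ τ) := integrable_cauchyKernel h
  have hd : ∀ s, HasDerivAt (cauchyKernel σ (τ - 1))
      (-σ * I * cauchyKernel (σ + 1) (τ - 1) s + (τ - 1) * I * cauchyKernel σ τ s) s := fun s => by
    have := hasDerivAt_cauchyKernel σ (τ - 1) s
    rwa [sub_add_cancel] at this
  have hre : 0 < (σ + (τ - 1)).re := by
    simp only [add_re, sub_re, one_re] at h ⊢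
    linarith
  have h0 := integral_of_hasDerivAt_of_tendsto hd
    ((i1.const_mul _).add (i2.const_mul _))
    (tendsto_cauchyKernel hre Filter.tendsto_abs_atBot_atTop)
    (tendsto_cauchyKernel hre Filter.tendsto_abs_atTop_atTop)
  rw [integral_add (i1.const_mul _) (i2.const_mul _), integral_const_mul, integral_const_mul,
    sub_zero] at h0
  have h1 : ∀ s, 2 * cauchyKernel (σ + 1) τ s =
      cauchyKernel (σ + 1) (τ - 1) s + cauchyKernel σ τ s := fun s => by
    have e1 : (1 - s * I : ℂ) ^ (-(τ - 1)) = (1 - s * I) ^ (-τ) * (1 - s * I) := by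
      rw [show -(τ - 1) = -τ + 1 by ring, cpow_add _ _ (slitPlane_ne_zero
        (one_sub_mul_I_mem_slitPlane s)), cpow_one]
    have e2 : (1 + s * I : ℂ) ^ (-σ) = (1 + s * I) ^ (-(σ + 1)) * (1 + s * I) := by
      rw [show -σ = -(σ + 1) + 1 by ring, cpow_add _ _ (slitPlane_ne_zero
        (one_add_mul_I_mem_slitPlane s)), cpow_one]
    simp only [cauchyKernel]
    rw [e1, e2]
    ring
  have h2 : 2 * ∫ s, cauchyKernel (σ + 1) τ s =
      (∫ s, cauchyKernel (σ + 1) (τ - 1) s) + ∫ s, cauchyKernel σ τ s := by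
    rw [← integral_add i1 i2, ← integral_const_mul]
    simp_rw [h1]
  have h3 : σ * ∫ s, cauchyKernel (σ + 1) (τ - 1) s = (τ - 1) * ∫ s, cauchyKernel σ τ s := by
    have : I * (σ * ∫ s, cauchyKernel (σ + 1) (τ - 1) s) =
        I * ((τ - 1) * ∫ s, cauchyKernel σ τ s) := by linear_combination -h0
    exact mul_left_cancel₀ I_ne_zero this
  linear_combination σ * h2 + h3

theorem integral_cauchyKernel_comm (σ τ : ℂ) :
    ∫ s, cauchyKernel σ τ s = ∫ s, cauchyKernel τ σ s := by
  rw [← integral_neg_eq_self]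
  congr 1
  funext s
  simp only [cauchyKernel, ofReal_neg]
  rw [mul_comm]
  ring_nf

/-- The density of the Gamma distribution, without normalization. -/
def gammaDensity (σ : ℂ) (x : ℝ) : ℂ := ((max x 0 : ℝ) : ℂ) ^ (σ - 1) * exp (-x)

/-- For x ≤ 0 the truncated base is 0, and 0 to the power σ - 1 is 0 only because σ ≠ 1; this is
where Re σ > 1 enters. -/
theorem gammaDensity_eq_indicator {σ : ℂ} (hσ : 1 < σ.re) :
    gammaDensity σ = (Ioi 0).indicator fun x : ℝ => (x : ℂ) ^ (σ - 1) * exp (-(1 * x)) := by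
  funext x
  by_cases hx : 0 < x
  · rw [indicator_of_mem (show x ∈ Ioi 0 from hx), gammaDensity, max_eq_left hx.le, one_mul]
  · rw [indicator_of_notMem (show x ∉ Ioi 0 from hx), gammaDensity, max_eq_right (not_lt.1 hx),
      ofReal_zero, zero_cpow, zero_mul]
    intro h
    rw [sub_eq_zero] at h
    simp [h] at hσ

theorem continuous_gammaDensity {σ : ℂ} (hσ : 1 < σ.re) : Continuous (gammaDensity σ) := by
  have h1 : Continuous fun x : ℝ => (x : ℂ) ^ (σ - 1) :=
    continuous_ofReal_cpow_const (by simpa using hσ)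
  exact (h1.comp (continuous_id.max continuous_const)).mul (by fun_prop)

theorem integrable_gammaDensity {σ : ℂ} (hσ : 1 < σ.re) : Integrable (gammaDensity σ) := by
  rw [gammaDensity_eq_indicator hσ, integrable_indicator_iff measurableSet_Ioi]
  exact integrableOn_cpow_mul_exp_neg_mul (by linarith) (by simp)

theorem fourier_gammaDensity {σ : ℂ} (hσ : 1 < σ.re) (w : ℝ) :
    𝓕 (gammaDensity σ) w = Gamma σ * (1 + (2 * Real.pi * w : ℝ) * I) ^ (-σ) := by
  rw [Real.fourier_real_eq_integral_exp_smul, gammaDensity_eq_indicator hσ,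
    ← integral_cpow_mul_exp_neg_complex_mul (by linarith) (by simp), ← integral_indicator
    measurableSet_Ioi]
  congr 1
  funext x
  by_cases hx : x ∈ Ioi (0 : ℝ)
  · rw [indicator_of_mem hx, indicator_of_mem hx, smul_eq_mul, mul_left_comm, ← exp_add]
    congr 2
    push_cast
    ring
  · rw [indicator_of_notMem hx, indicator_of_notMem hx, smul_zero]

/-- Up to Gamma factors, (1 + is)^(-σ) is the Fourier transform of a Gamma density and (1 - is)^(-τ)
an inverse transform. Moving the transform from one factor to the other reduces the integral to that
of x^(σ+τ-2) exp(-2x). Real parts above 1 make the densities continuous with integrable transforms,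
so that Fourier inversion applies. -/
theorem integral_cauchyKernel_of_one_lt {σ τ : ℂ} (hσ : 1 < σ.re) (hτ : 1 < τ.re) :
    ∫ s, cauchyKernel σ τ s =
      2 * Real.pi * 2 ^ (1 - σ - τ) * Gamma (σ + τ - 1) / (Gamma σ * Gamma τ) := by
  have hk : ∀ {σ : ℂ}, 1 < σ.re → Integrable (𝓕 (gammaDensity σ)) := fun {σ} hσ => by
    have h1 := (integrable_cauchyKernel (σ := σ) (τ := 0) (by simpa using hσ)).comp_mul_left'
      (R := 2 * Real.pi) (by positivity)
    refine (h1.const_mul (Gamma σ)).congr (Filter.Eventually.of_forall fun w => ?_)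
    rw [fourier_gammaDensity hσ]
    simp [cauchyKernel]
  have hinv : 𝓕 (𝓕⁻ (gammaDensity τ)) = gammaDensity τ :=
    (continuous_gammaDensity hτ).fourier_fourierInv_eq (integrable_gammaDensity hτ) (hk hτ)
  have hg : ∀ w, 𝓕⁻ (gammaDensity τ) w =
      Gamma τ * (1 - (2 * Real.pi * w : ℝ) * I) ^ (-τ) := fun w => by
    rw [Real.fourierInv_eq_fourier_neg, fourier_gammaDensity hτ]
    push_cast
    ring_nf
  have hgi : Integrable (𝓕⁻ (gammaDensity τ)) := by
    have := (hk hτ).comp_neg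
    refine this.congr (Filter.Eventually.of_forall fun w => ?_)
    rw [Real.fourierInv_eq_fourier_neg]
  have hpl : ∫ w, 𝓕 (gammaDensity σ) w • 𝓕⁻ (gammaDensity τ) w =
      ∫ x, gammaDensity σ x • 𝓕 (𝓕⁻ (gammaDensity τ)) x := by
    simpa using! VectorFourier.integral_fourierIntegral_smul_eq_flip (L := innerₗ ℝ)
      (μ := volume) (ν := volume)
      Real.continuous_fourierChar continuous_inner (integrable_gammaDensity hσ) hgi
  rw [hinv] at hpl
  have hL : ∫ w, 𝓕 (gammaDensity σ) w • 𝓕⁻ (gammaDensity τ) w =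
      Gamma σ * Gamma τ * ((2 * Real.pi : ℝ)⁻¹ * ∫ s, cauchyKernel σ τ s) := by
    have h1 := Measure.integral_comp_mul_left (cauchyKernel σ τ) (2 * Real.pi)
    rw [abs_of_pos (by positivity), real_smul] at h1
    push_cast at h1 ⊢
    rw [← h1, ← integral_const_mul]
    congr 1
    funext w
    rw [fourier_gammaDensity hσ, hg, cauchyKernel, smul_eq_mul]
    push_cast
    ring
  have hR : ∫ x, gammaDensity σ x • gammaDensity τ x =
      Gamma (σ + τ - 1) * 2 ^ (1 - σ - τ) := by
    rw [show 1 - σ - τ = -(σ + τ - 1) by ring,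
      ← integral_cpow_mul_exp_neg_complex_mul (by simp; linarith) (by simp),
      ← integral_indicator measurableSet_Ioi]
    congr 1
    funext x
    rw [gammaDensity_eq_indicator hσ, gammaDensity_eq_indicator hτ]
    by_cases hx : x ∈ Ioi (0 : ℝ)
    · have hx0 : (x : ℂ) ≠ 0 := by exact_mod_cast (ne_of_gt hx)
      rw [indicator_of_mem hx, indicator_of_mem hx, indicator_of_mem hx, smul_eq_mul,
        mul_mul_mul_comm, ← exp_add, ← cpow_add _ _ hx0]
      ring_nf
    · rw [indicator_of_notMem hx, indicator_of_notMem hx, indicator_of_notMem hx, smul_zero]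
  rw [hL, hR] at hpl
  have h1 : Gamma σ ≠ 0 := Gamma_ne_zero_of_re_pos (by linarith)
  have h2 : Gamma τ ≠ 0 := Gamma_ne_zero_of_re_pos (by linarith)
  have h3 : (Real.pi : ℂ) ≠ 0 := by exact_mod_cast Real.pi_ne_zero
  push_cast at hpl
  field_simp at hpl ⊢
  linear_combination hpl

/-- Cauchy's beta integral. -/
theorem integral_cauchyKernel {σ τ : ℂ} (h : 1 < (σ + τ).re) :
    ∫ s, cauchyKernel σ τ s =
      2 * Real.pi * 2 ^ (1 - σ - τ) * Gamma (σ + τ - 1) / (Gamma σ * Gamma τ) := by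
  -- Descent from σ + 1 to σ: the factor σ + τ - 1 in the recurrence is nonzero because its real
  -- part is positive.
  have step : ∀ {σ τ : ℂ}, 1 < (σ + τ).re →
      ∫ s, cauchyKernel (σ + 1) τ s = 2 * Real.pi * 2 ^ (1 - (σ + 1) - τ) *
        Gamma (σ + 1 + τ - 1) / (Gamma (σ + 1) * Gamma τ) →
      ∫ s, cauchyKernel σ τ s =
        2 * Real.pi * 2 ^ (1 - σ - τ) * Gamma (σ + τ - 1) / (Gamma σ * Gamma τ) := by
    intro σ τ h h1
    have h2 := integral_cauchyKernel_succ h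
    have hne : σ + τ - 1 ≠ 0 := fun h0 => by
      have := congrArg re h0
      simp at this h
      linarith
    have e1 : Gamma (σ + 1 + τ - 1) = (σ + τ - 1) * Gamma (σ + τ - 1) := by
      rw [← Gamma_add_one _ hne]; ring_nf
    have e2 : (2 : ℂ) ^ (1 - σ - τ) = 2 * 2 ^ (1 - (σ + 1) - τ) := by
      rw [show 1 - σ - τ = (1 - (σ + 1) - τ) + 1 by ring, cpow_add _ _ two_ne_zero, cpow_one,
        mul_comm]
    -- The recurrence for 1/Γ also holds at the poles of Γ, so σ may be a nonpositive integer.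
    have e3 := one_div_Gamma_eq_self_mul_one_div_Gamma_add_one σ
    refine mul_left_cancel₀ hne ?_
    rw [← h2, h1, e1, e2, div_mul_eq_div_div, div_mul_eq_div_div, div_eq_mul_inv _ (Gamma σ), e3,
      div_eq_mul_inv _ (Gamma (σ + 1))]
    ring
  have steps : ∀ (n : ℕ) {σ τ : ℂ}, 1 < (σ + τ).re →
      ∫ s, cauchyKernel (σ + n) τ s = 2 * Real.pi * 2 ^ (1 - (σ + n) - τ) *
        Gamma (σ + n + τ - 1) / (Gamma (σ + n) * Gamma τ) →
      ∫ s, cauchyKernel σ τ s =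
        2 * Real.pi * 2 ^ (1 - σ - τ) * Gamma (σ + τ - 1) / (Gamma σ * Gamma τ) := by
    intro n
    induction n with
    | zero => intro σ τ _ h; simpa using h
    | succ n ih =>
      intro σ τ h h1
      refine step h (ih (σ := σ + 1) ?_ ?_)
      · simp at h ⊢; linarith
      · rw [show σ + 1 + (n : ℂ) = σ + ((n + 1 : ℕ) : ℂ) by push_cast; ring]
        exact h1
  -- Both parameters are shifted by integers into the range of the Fourier argument, the second by
  -- means of the symmetry s ↦ -s.
  obtain ⟨n, hn⟩ := exists_nat_gt (1 - σ.re)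
  obtain ⟨m, hm⟩ := exists_nat_gt (1 - τ.re)
  refine steps n h ?_
  rw [integral_cauchyKernel_comm, show 1 - (σ + (n : ℂ)) - τ = 1 - τ - (σ + n) by ring,
    show σ + (n : ℂ) + τ - 1 = τ + (σ + n) - 1 by ring, mul_comm (Gamma (σ + n))]
  refine steps m ?_ ?_
  · have : (0 : ℝ) ≤ n := n.cast_nonneg
    simp at h ⊢
    linarith
  · exact integral_cauchyKernel_of_one_lt (by simp; linarith) (by simp; linarith)

end CauchyBeta

/-! ### The integral over one row and column in the new coordinates. -/

section FiberIntegral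

open Complex Set

variable {ι : Type*} [Fintype ι]

theorem pi_div_rpow_eq {x : ℝ} (hx : 0 < x) (r : ℝ) :
    (((Real.pi / x) ^ r : ℝ) : ℂ) = (Real.pi : ℂ) ^ (r : ℂ) * (x : ℂ) ^ (-r : ℂ) := by
  rw [Real.div_rpow Real.pi_pos.le hx.le, ofReal_div, ofReal_cpow Real.pi_pos.le,
    ofReal_cpow hx.le, cpow_neg, div_eq_mul_inv]

/-- The integral of `(c + |v|²) ^ (-ρ)` over a Euclidean space. -/
theorem integral_add_dotProduct_self_cpow {c : ℝ} (hc : 0 < c) {ρ : ℂ}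
    (hρ : 0 < (ρ - (Fintype.card ι : ℂ) / 2).re) :
    Integrable (fun v : ι → ℝ => ((c + v ⬝ᵥ v : ℝ) : ℂ) ^ (-ρ)) ∧
    ∫ v : ι → ℝ, ((c + v ⬝ᵥ v : ℝ) : ℂ) ^ (-ρ) =
      (Real.pi : ℂ) ^ ((Fintype.card ι : ℂ) / 2) * Gamma (ρ - (Fintype.card ι : ℂ) / 2) / Gamma ρ *
        (c : ℂ) ^ ((Fintype.card ι : ℂ) / 2 - ρ) := by
  have hcast : ((Fintype.card ι : ℂ) / 2) = (((Fintype.card ι : ℝ) / 2 : ℝ) : ℂ) := by push_cast; rfl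
  have hρ0 : 0 < ρ.re := by
    rw [hcast, sub_re, ofReal_re] at hρ
    have : (0 : ℝ) ≤ (Fintype.card ι : ℝ) / 2 := by positivity
    linarith
  have h := integral_mul_add_cpow_of_laplace (Z := ι → ℝ) (μ := volume) (w := fun _ => 1)
    (φ := fun v => v ⬝ᵥ v) measurable_const (by unfold dotProduct; fun_prop)
    (Filter.Eventually.of_forall fun v => by
      simpa using dotProduct_star_self_nonneg v)
    (A := (Real.pi : ℂ) ^ ((Fintype.card ι : ℂ) / 2)) (b := (Fintype.card ι : ℂ) / 2)
    (A' := Real.pi ^ ((Fintype.card ι : ℝ) / 2)) ?_ ?_ ?_ hc hρ0 hρ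
  · simpa using h
  · intro x hx
    simpa using (integrable_exp_neg_mul_dotProduct_self hx).ofReal (𝕜 := ℂ)
  · intro x hx
    simp_rw [one_mul]
    rw [integral_complex_ofReal, integral_exp_neg_mul_dotProduct_self hx, pi_div_rpow_eq hx]
    push_cast
    rfl
  · intro x hx
    simp_rw [norm_one, one_mul]
    rw [integral_exp_neg_mul_dotProduct_self hx, hcast, ofReal_re,
      Real.div_rpow Real.pi_pos.le hx.le, Real.rpow_neg hx.le, div_eq_mul_inv]

/-- The integral of `u ^ l * (c + u + |a|² + |b|²) ^ (-ρ)` over `u > 0` and vectors `a`, `b`. -/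
theorem integral_cpow_mul_add_dotProduct_self_cpow {l ρ : ℂ} {c : ℝ} (hc : 0 < c)
    (hl : 0 < (l + 1).re) (hρ : 0 < (ρ - (l + 1 + Fintype.card ι)).re) :
    Integrable (fun z : ((ι → ℝ) × (ι → ℝ)) × ℝ => (z.2 : ℂ) ^ l *
        ((c + (z.2 + z.1.1 ⬝ᵥ z.1.1 + z.1.2 ⬝ᵥ z.1.2) : ℝ) : ℂ) ^ (-ρ))
      (volume.prod (volume.restrict (Ioi 0))) ∧
    ∫ z : ((ι → ℝ) × (ι → ℝ)) × ℝ, (z.2 : ℂ) ^ l *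
        ((c + (z.2 + z.1.1 ⬝ᵥ z.1.1 + z.1.2 ⬝ᵥ z.1.2) : ℝ) : ℂ) ^ (-ρ)
        ∂(volume.prod (volume.restrict (Ioi 0))) =
      Gamma (l + 1) * (Real.pi : ℂ) ^ (Fintype.card ι) * Gamma (ρ - (l + 1 + Fintype.card ι)) /
        Gamma ρ * (c : ℂ) ^ (l + 1 + Fintype.card ι - ρ) := by
  have hρ0 : 0 < ρ.re := by
    have : (0 : ℝ) ≤ Fintype.card ι := by positivity
    simp only [sub_re, add_re, natCast_re] at hρ hl
    linarith
  have key : ∀ x : ℝ, ∀ z : ((ι → ℝ) × (ι → ℝ)) × ℝ,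
      (z.2 : ℂ) ^ l * Real.exp (-(x * (z.2 + z.1.1 ⬝ᵥ z.1.1 + z.1.2 ⬝ᵥ z.1.2))) =
      ((Real.exp (-(x * (z.1.1 ⬝ᵥ z.1.1))) : ℂ) * (Real.exp (-(x * (z.1.2 ⬝ᵥ z.1.2))) : ℂ)) *
        ((z.2 : ℂ) ^ (l + 1 - 1) * exp (-(x * z.2))) := fun x z => by
    rw [show -(x * (z.2 + z.1.1 ⬝ᵥ z.1.1 + z.1.2 ⬝ᵥ z.1.2)) = -(x * (z.1.1 ⬝ᵥ z.1.1)) +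
      -(x * (z.1.2 ⬝ᵥ z.1.2)) + -(x * z.2) by ring, Real.exp_add, Real.exp_add, add_sub_cancel_right]
    push_cast
    ring
  have keyn : ∀ x : ℝ, ∀ z : ((ι → ℝ) × (ι → ℝ)) × ℝ, 0 < z.2 →
      ‖(z.2 : ℂ) ^ l‖ * Real.exp (-(x * (z.2 + z.1.1 ⬝ᵥ z.1.1 + z.1.2 ⬝ᵥ z.1.2))) =
      (Real.exp (-(x * (z.1.1 ⬝ᵥ z.1.1))) * Real.exp (-(x * (z.1.2 ⬝ᵥ z.1.2)))) *
        (z.2 ^ ((l + 1).re - 1) * Real.exp (-(x * z.2))) := fun x z hz => by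
    rw [show -(x * (z.2 + z.1.1 ⬝ᵥ z.1.1 + z.1.2 ⬝ᵥ z.1.2)) = -(x * (z.1.1 ⬝ᵥ z.1.1)) +
      -(x * (z.1.2 ⬝ᵥ z.1.2)) + -(x * z.2) by ring, Real.exp_add, Real.exp_add,
      norm_cpow_eq_rpow_re_of_pos hz, add_re, one_re, add_sub_cancel_right]
    ring
  have hpos : ∀ᵐ z : ((ι → ℝ) × (ι → ℝ)) × ℝ ∂(volume.prod (volume.restrict (Ioi 0))), 0 < z.2 := by
    have : ∀ᵐ u : ℝ ∂(volume.restrict (Ioi 0)), 0 < u := ae_restrict_mem measurableSet_Ioi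
    exact (Measure.quasiMeasurePreserving_snd (μ := (volume : Measure ((ι → ℝ) × (ι → ℝ))))).ae this
  have hφm : Measurable fun z : ((ι → ℝ) × (ι → ℝ)) × ℝ =>
      z.2 + z.1.1 ⬝ᵥ z.1.1 + z.1.2 ⬝ᵥ z.1.2 := by
    unfold dotProduct; fun_prop
  -- The Laplace transform factors into a Gamma integral in u and two Gaussians, hence is a multiple
  -- of x^(-(l + 1 + |ι|)); each Gaussian contributes (π/x)^(|ι|/2).
  have h := integral_mul_add_cpow_of_laplace (Z := ((ι → ℝ) × (ι → ℝ)) × ℝ)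
    (μ := volume.prod (volume.restrict (Ioi 0))) (w := fun z => (z.2 : ℂ) ^ l)
    (φ := fun z => z.2 + z.1.1 ⬝ᵥ z.1.1 + z.1.2 ⬝ᵥ z.1.2) (by fun_prop) hφm ?_
    (A := Gamma (l + 1) * (Real.pi : ℂ) ^ (Fintype.card ι)) (b := l + 1 + Fintype.card ι)
    (A' := Real.Gamma ((l + 1).re) * Real.pi ^ (Fintype.card ι)) ?_ ?_ ?_ hc hρ0 hρ
  · exact h
  · filter_upwards [hpos] with z hz
    have h1 : 0 ≤ z.1.1 ⬝ᵥ z.1.1 := by simpa using dotProduct_star_self_nonneg z.1.1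
    have h2 : 0 ≤ z.1.2 ⬝ᵥ z.1.2 := by simpa using dotProduct_star_self_nonneg z.1.2
    linarith
  · intro x hx
    simp_rw [key]
    have h1 := (integrable_exp_neg_mul_dotProduct_self (ι := ι) hx).ofReal (𝕜 := ℂ)
    exact (h1.mul_prod h1).mul_prod (integrableOn_cpow_mul_exp_neg_mul hl (by simpa using hx))
  · intro x hx
    have hx0 : (x : ℂ) ≠ 0 := by exact_mod_cast hx.ne'
    simp_rw [key]
    rw [integral_prod_mul (f := fun v : (ι → ℝ) × (ι → ℝ) =>
        (Real.exp (-(x * (v.1 ⬝ᵥ v.1))) : ℂ) * (Real.exp (-(x * (v.2 ⬝ᵥ v.2))) : ℂ))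
        (g := fun u : ℝ => (u : ℂ) ^ (l + 1 - 1) * exp (-(x * u))), Measure.volume_eq_prod,
      integral_prod_mul (f := fun v : ι → ℝ => (Real.exp (-(x * (v ⬝ᵥ v))) : ℂ))
        (g := fun v : ι → ℝ => (Real.exp (-(x * (v ⬝ᵥ v))) : ℂ)),
      integral_cpow_mul_exp_neg_complex_mul hl (by simpa using hx), integral_complex_ofReal,
      integral_exp_neg_mul_dotProduct_self hx, ← ofReal_mul, ← Real.rpow_add (by positivity),
      add_halves, pi_div_rpow_eq hx, ofReal_natCast, cpow_natCast, neg_add (l + 1), cpow_add _ _ hx0]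
    ring
  · intro x hx
    rw [integral_congr_ae (hpos.mono fun z hz => keyn x z hz),
      integral_prod_mul (f := fun v : (ι → ℝ) × (ι → ℝ) =>
        Real.exp (-(x * (v.1 ⬝ᵥ v.1))) * Real.exp (-(x * (v.2 ⬝ᵥ v.2))))
        (g := fun u : ℝ => u ^ ((l + 1).re - 1) * Real.exp (-(x * u))), Measure.volume_eq_prod,
      integral_prod_mul (f := fun v : ι → ℝ => Real.exp (-(x * (v ⬝ᵥ v))))
        (g := fun v : ι → ℝ => Real.exp (-(x * (v ⬝ᵥ v)))),
      Real.integral_rpow_mul_exp_neg_mul_Ioi hl hx,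
      integral_exp_neg_mul_dotProduct_self hx, ← Real.rpow_add (by positivity),
      add_halves, Real.rpow_natCast, div_pow, Real.div_rpow zero_le_one hx.le, Real.one_rpow,
      show -(l + 1 + (Fintype.card ι : ℂ)).re = -(l + 1).re + -(Fintype.card ι : ℝ) by
        simp; ring, Real.rpow_add hx, Real.rpow_neg hx.le, Real.rpow_neg hx.le, Real.rpow_natCast]
    field_simp

variable {F : Type*} [NormedAddCommGroup F] [NormedSpace ℝ F] [FiniteDimensional ℝ F]
  [MeasureSpace F] [BorelSpace F] [(volume : Measure F).IsAddHaarMeasure]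

/-- Homogeneity of degree `-ρ` of a function on the half space `r > 0`. -/
def IsHomogeneous (ψ : ℝ × F → ℂ) (ρ : ℂ) : Prop :=
  ∀ c : ℝ, 0 < c → ∀ r : ℝ, 0 < r → ∀ s : F, ψ (c * r, c • s) = (c : ℂ) ^ (-ρ) * ψ (r, s)

-- Rescaling s by c produces the Jacobian c^(dim F) on top of the homogeneity factor c^(-ρ). The
-- norm version is what absolute convergence needs.
open Module in
theorem IsHomogeneous.integral {ψ : ℝ × F → ℂ} {ρ : ℂ} (hψ : IsHomogeneous ψ ρ) {c : ℝ}
    (hc : 0 < c) :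
    (Integrable (fun s => ψ (1, s)) → Integrable fun s => ψ (c, s)) ∧
    ∫ s, ψ (c, s) = (c : ℂ) ^ (finrank ℝ F - ρ) * ∫ s, ψ (1, s) ∧
    ∫ s, ‖ψ (c, s)‖ = ‖(c : ℂ) ^ (finrank ℝ F - ρ)‖ * ∫ s, ‖ψ (1, s)‖ := by
  have hc0 : (c : ℂ) ≠ 0 := by exact_mod_cast hc.ne'
  have h : ∀ s, ψ (c, s) = (c : ℂ) ^ (-ρ) * ψ (1, c⁻¹ • s) := fun s => by
    rw [← hψ c hc 1 one_pos, mul_one, smul_inv_smul₀ hc.ne']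
  have e : (c : ℂ) ^ (finrank ℝ F - ρ) = (c : ℂ) ^ (-ρ) * (c : ℂ) ^ (finrank ℝ F) := by
    rw [sub_eq_neg_add, cpow_add _ _ hc0, cpow_natCast]
  simp_rw [h]
  refine ⟨fun hi => ?_, ?_, ?_⟩
  · exact (hi.comp_smul (inv_ne_zero hc.ne')).const_mul _
  · rw [integral_const_mul, Measure.integral_comp_inv_smul_of_nonneg volume (fun s => ψ (1, s)) hc.le,
      e, real_smul]
    push_cast
    ring
  · simp_rw [norm_mul]
    rw [integral_const_mul, Measure.integral_comp_inv_smul_of_nonneg volume (fun s => ‖ψ (1, s)‖) hc.le,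
      e, norm_mul, norm_pow, norm_real, Real.norm_of_nonneg hc.le, smul_eq_mul]
    ring

/-- The integrand over one row and column after the change of variables. -/
def fiberFun (l : ℂ) (ψ : ℝ × F → ℂ) (y : ((ι → ℝ) × (ι → ℝ)) × (ℝ × F)) : ℂ :=
  if 0 < y.2.1 then (y.2.1 : ℂ) ^ l *
    ψ (1 + (y.2.1 + y.1.1 ⬝ᵥ y.1.1 + y.1.2 ⬝ᵥ y.1.2), y.2.2) else 0

-- Integrating over the imaginary coordinate first, homogeneity leaves the real part to the power
-- dim F - ρ times the integral of ψ over the imaginary parts at real part 1. What remains is the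
-- preceding integral with c = 1.
open Module in
theorem integral_fiberFun {l ρ : ℂ} {ψ : ℝ × F → ℂ} (hψm : Measurable ψ)
    (hψ : IsHomogeneous ψ ρ) (hψi : Integrable fun s => ψ (1, s)) (hl : 0 < (l + 1).re)
    (hρ : 0 < (ρ - finrank ℝ F - (l + 1 + Fintype.card ι)).re) :
    Integrable (fiberFun (ι := ι) l ψ) ∧
    ∫ y, fiberFun (ι := ι) l ψ y = (∫ s, ψ (1, s)) *
      (Gamma (l + 1) * (Real.pi : ℂ) ^ (Fintype.card ι) *
        Gamma (ρ - finrank ℝ F - (l + 1 + Fintype.card ι)) / Gamma (ρ - finrank ℝ F)) := by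
  obtain ⟨hi, hv⟩ := integral_cpow_mul_add_dotProduct_self_cpow (ι := ι) one_pos hl hρ
  set μ : Measure (((ι → ℝ) × (ι → ℝ)) × ℝ) := volume.prod (volume.restrict (Ioi 0)) with hμ
  set g : (((ι → ℝ) × (ι → ℝ)) × ℝ) × F → ℂ := fun z => (z.1.2 : ℂ) ^ l *
    ψ (1 + (z.1.2 + z.1.1.1 ⬝ᵥ z.1.1.1 + z.1.1.2 ⬝ᵥ z.1.1.2), z.2) with hg
  have hgm : Measurable g := by
    have h1 : Measurable fun z : (((ι → ℝ) × (ι → ℝ)) × ℝ) × F =>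
        (1 + (z.1.2 + z.1.1.1 ⬝ᵥ z.1.1.1 + z.1.1.2 ⬝ᵥ z.1.1.2), z.2) := by
      unfold dotProduct; fun_prop
    exact Measurable.mul (by fun_prop) (hψm.comp h1)
  have hpos : ∀ᵐ z : ((ι → ℝ) × (ι → ℝ)) × ℝ ∂μ, 0 < 1 + (z.2 + z.1.1 ⬝ᵥ z.1.1 + z.1.2 ⬝ᵥ z.1.2) := by
    have : ∀ᵐ u : ℝ ∂(volume.restrict (Ioi 0)), 0 < u := ae_restrict_mem measurableSet_Ioi
    filter_upwards [(Measure.quasiMeasurePreserving_snd (μ := (volume : Measure ((ι → ℝ) × (ι → ℝ))))).ae this] with z hz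
    have h1 : 0 ≤ z.1.1 ⬝ᵥ z.1.1 := by simpa using dotProduct_star_self_nonneg z.1.1
    have h2 : 0 ≤ z.1.2 ⬝ᵥ z.1.2 := by simpa using dotProduct_star_self_nonneg z.1.2
    linarith
  have hgi : Integrable g (μ.prod volume) := by
    rw [integrable_prod_iff hgm.aestronglyMeasurable]
    constructor
    · filter_upwards [hpos] with z hz
      exact ((hψ.integral hz).1 hψi).const_mul ((z.2 : ℂ) ^ l)
    · refine (hi.norm.mul_const (∫ s, ‖ψ (1, s)‖)).congr ?_
      filter_upwards [hpos] with z hz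
      simp only [hg, norm_mul]
      rw [integral_const_mul, (hψ.integral hz).2.2, neg_sub]
      ring
  have hgv : ∫ z, g z ∂(μ.prod volume) = (∫ s, ψ (1, s)) *
      (Gamma (l + 1) * (Real.pi : ℂ) ^ (Fintype.card ι) *
        Gamma (ρ - finrank ℝ F - (l + 1 + Fintype.card ι)) / Gamma (ρ - finrank ℝ F)) := by
    rw [integral_prod _ hgi]
    rw [ofReal_one, one_cpow, mul_one] at hv
    rw [← hv, mul_comm, ← integral_mul_const]
    refine integral_congr_ae (hpos.mono fun z hz => ?_)
    simp only [hg]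
    rw [integral_const_mul, (hψ.integral hz).2.1, neg_sub]
    ring
  have hmp : MeasurePreserving (MeasurableEquiv.prodAssoc : (((ι → ℝ) × (ι → ℝ)) × ℝ) × F ≃ᵐ ((ι → ℝ) × (ι → ℝ)) × (ℝ × F)) :=
    volume_preserving_prodAssoc
  have hset : (μ.prod (volume : Measure F)) = (volume : Measure ((((ι → ℝ) × (ι → ℝ)) × ℝ) × F)).restrict
      ((univ ×ˢ Ioi (0 : ℝ)) ×ˢ univ) := by
    rw [Measure.volume_eq_prod, ← Measure.prod_restrict, Measure.restrict_univ,
      Measure.volume_eq_prod ((ι → ℝ) × (ι → ℝ)) ℝ, ← Measure.prod_restrict, Measure.restrict_univ]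
  have hms : MeasurableSet ((univ ×ˢ Ioi (0 : ℝ)) ×ˢ univ : Set ((((ι → ℝ) × (ι → ℝ)) × ℝ) × F)) :=
    (MeasurableSet.univ.prod measurableSet_Ioi).prod MeasurableSet.univ
  have hcomp : fiberFun (ι := ι) l ψ ∘ (MeasurableEquiv.prodAssoc : (((ι → ℝ) × (ι → ℝ)) × ℝ) × F ≃ᵐ ((ι → ℝ) × (ι → ℝ)) × (ℝ × F)) =
      ((univ ×ˢ Ioi (0 : ℝ)) ×ˢ univ).indicator g := by
    funext z
    by_cases hz : 0 < z.1.2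
    · rw [indicator_of_mem (by simpa using hz)]
      exact if_pos hz
    · rw [indicator_of_notMem (by simpa using hz)]
      exact if_neg hz
  constructor
  · rw [← hmp.integrable_comp_emb (MeasurableEquiv.measurableEmbedding _), hcomp,
      integrable_indicator_iff hms, IntegrableOn, ← hset]
    exact hgi
  · rw [← hmp.integral_comp' (fiberFun (ι := ι) l ψ), ← hgv, hset, ← integral_indicator hms, ← hcomp]
    rfl

end FiberIntegral

/-! ### Real coordinates and measures -/

section Coordinates

/-- The positions above the diagonal of the left upper `n × n` block. -/
def castOff {n : ℕ} (p : OffDiag n) : OffDiag (n + 1) :=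
  ⟨(p.1.1.castSucc, p.1.2.castSucc), Fin.castSucc_lt_castSucc_iff.2 p.2⟩

/-- The positions above the diagonal of the last column. -/
def lastOff {n : ℕ} (i : Fin n) : OffDiag (n + 1) :=
  ⟨(i.castSucc, Fin.last n), Fin.castSucc_lt_last i⟩

theorem bijective_sumElim_castOff_lastOff (n : ℕ) :
    Function.Bijective (Sum.elim (castOff (n := n)) lastOff) := by
  constructor
  · rintro (⟨⟨i, j⟩, h⟩ | i) (⟨⟨i', j'⟩, h'⟩ | i') hij
    · simp_all [castOff]
    · simp only [Sum.elim_inl, Sum.elim_inr, castOff, lastOff, Subtype.mk.injEq,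
        Prod.mk.injEq] at hij
      exact absurd hij.2 (Fin.castSucc_lt_last j).ne
    · simp only [Sum.elim_inl, Sum.elim_inr, castOff, lastOff, Subtype.mk.injEq,
        Prod.mk.injEq] at hij
      exact absurd hij.2.symm (Fin.castSucc_lt_last j').ne
    · simp_all [lastOff]
  · rintro ⟨⟨i, j⟩, h⟩
    have hi : i ≠ Fin.last n := fun hi => by
      subst hi
      exact absurd h (Fin.le_last j).not_gt
    obtain ⟨i, rfl⟩ := Fin.exists_castSucc_eq.2 hi
    by_cases hj : j = Fin.last n
    · subst hj
      exact ⟨Sum.inr i, rfl⟩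
    · obtain ⟨j, rfl⟩ := Fin.exists_castSucc_eq.2 hj
      exact ⟨Sum.inl ⟨(i, j), by simpa using h⟩, rfl⟩

theorem measurePreserving_uncurry {ι κ : Type*} [Fintype ι] [Fintype κ] :
    MeasurePreserving (fun (f : ι → κ → ℝ) (p : ι × κ) => f p.1 p.2) := by
  refine ⟨by fun_prop, (Measure.pi_eq fun s hs => ?_).symm⟩
  rw [Measure.map_apply (by fun_prop) (MeasurableSet.univ_pi hs)]
  have : (fun (f : ι → κ → ℝ) (p : ι × κ) => f p.1 p.2) ⁻¹' Set.univ.pi s =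
      Set.univ.pi fun i => Set.univ.pi fun k => s (i, k) := by
    ext f
    simp [Set.mem_pi]
  rw [this, volume_pi_pi]
  simp_rw [volume_pi_pi]
  rw [Fintype.prod_prod_type]

theorem measurePreserving_prodProdProdComm {α β γ δ : Type*} [MeasureSpace α] [MeasureSpace β]
    [MeasureSpace γ] [MeasureSpace δ] [SFinite (volume : Measure α)] [SFinite (volume : Measure β)]
    [SFinite (volume : Measure γ)] [SFinite (volume : Measure δ)] :
    MeasurePreserving fun z : (α × β) × (γ × δ) => ((z.1.1, z.2.1), (z.1.2, z.2.2)) := by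
  have h1 : MeasurePreserving (MeasurableEquiv.prodAssoc : (α × β) × (γ × δ) ≃ᵐ α × β × γ × δ) :=
    volume_preserving_prodAssoc
  have h2 : MeasurePreserving (MeasurableEquiv.prodAssoc : (β × γ) × δ ≃ᵐ β × γ × δ).symm :=
    volume_preserving_prodAssoc.symm
  have h3 : MeasurePreserving (Prod.swap : β × γ → γ × β) := Measure.measurePreserving_swap
  have h4 : MeasurePreserving (MeasurableEquiv.prodAssoc : (γ × β) × δ ≃ᵐ γ × β × δ) :=
    volume_preserving_prodAssoc
  have h5 : MeasurePreserving (MeasurableEquiv.prodAssoc : (α × γ) × (β × δ) ≃ᵐ α × γ × β × δ).symm :=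
    volume_preserving_prodAssoc.symm
  exact h5.comp (((MeasurePreserving.id volume).prod
    ((h4.comp (h3.prod (MeasurePreserving.id volume))).comp h2)).comp h1)

variable (κ F : Type*)

/-- The coordinates of a pair `(T, S)`. -/
abbrev Coords (n : ℕ) : Type _ :=
  ((Fin n → ℝ) × (OffDiag n → κ → ℝ)) × ((Fin n → F) × (OffDiag n → κ → ℝ))

/-- The coordinates of the last columns of `T` and `S`. -/
abbrev LastCoords (n : ℕ) : Type _ := ((Fin n × κ → ℝ) × (Fin n × κ → ℝ)) × (ℝ × F)

variable {κ F}

/-- Splitting off the last rows and columns of `T` and `S`. -/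
def splitLast {n : ℕ} (x : Coords κ F (n + 1)) : Coords κ F n × LastCoords κ F n :=
  (((fun i => x.1.1 i.castSucc, fun p => x.1.2 (castOff p)),
    (fun i => x.2.1 i.castSucc, fun p => x.2.2 (castOff p))),
   ((fun p => x.1.2 (lastOff p.1) p.2, fun p => x.2.2 (lastOff p.1) p.2),
    (x.1.1 (Fin.last n), x.2.1 (Fin.last n))))

theorem measurePreserving_init_last (n : ℕ) (E : Type*) [MeasureSpace E]
    [SigmaFinite (volume : Measure E)] :
    MeasurePreserving fun f : Fin (n + 1) → E => (fun i : Fin n => f i.castSucc, f (Fin.last n)) := by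
  have h := volume_preserving_piFinSuccAbove (fun _ : Fin (n + 1) => E) (Fin.last n)
  have h2 : MeasurePreserving (Prod.swap : E × (Fin n → E) → _) := Measure.measurePreserving_swap
  have := h2.comp h
  convert this using 1
  funext f
  refine Prod.ext (funext fun i => ?_) rfl
  simp [MeasurableEquiv.piFinSuccAbove, Fin.init]

theorem measurePreserving_castOff_lastOff (n : ℕ) (κ : Type*) [Fintype κ] :
    MeasurePreserving fun f : OffDiag (n + 1) → κ → ℝ =>
      (fun p : OffDiag n => f (castOff p), fun p : Fin n × κ => f (lastOff p.1) p.2) := by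
  set e := Equiv.ofBijective _ (bijective_sumElim_castOff_lastOff n)
  have h1 := (volume_measurePreserving_piCongrLeft (fun _ : OffDiag (n + 1) => κ → ℝ) e).symm
  have h2 := volume_measurePreserving_sumPiEquivProdPi (fun _ : OffDiag n ⊕ Fin n => κ → ℝ)
  have h3 := ((MeasurePreserving.id volume).prod (measurePreserving_uncurry (ι := Fin n) (κ := κ))).comp
    (h2.comp h1)
  exact h3

/-- A regrouping of coordinates, which permits Fubini over the last row and column. -/
theorem measurePreserving_splitLast (n : ℕ) [Fintype κ] [MeasureSpace F]
    [SigmaFinite (volume : Measure F)] :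
    MeasurePreserving (splitLast : Coords κ F (n + 1) → Coords κ F n × LastCoords κ F n) := by
  have h1 := ((measurePreserving_init_last n ℝ).prod (measurePreserving_castOff_lastOff n κ)).prod
    ((measurePreserving_init_last n F).prod (measurePreserving_castOff_lastOff n κ))
  have h2 := (measurePreserving_prodProdProdComm (α := Fin n → ℝ) (β := ℝ)
    (γ := OffDiag n → κ → ℝ) (δ := Fin n × κ → ℝ)).prod
    (measurePreserving_prodProdProdComm (α := Fin n → F) (β := F)
    (γ := OffDiag n → κ → ℝ) (δ := Fin n × κ → ℝ))
  have h3 := measurePreserving_prodProdProdComm (α := (Fin n → ℝ) × (OffDiag n → κ → ℝ))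
    (β := ℝ × (Fin n × κ → ℝ)) (γ := (Fin n → F) × (OffDiag n → κ → ℝ)) (δ := F × (Fin n × κ → ℝ))
  have h4 := measurePreserving_prodProdProdComm (α := ℝ) (β := Fin n × κ → ℝ) (γ := F)
    (δ := Fin n × κ → ℝ)
  have h5 : MeasurePreserving (Prod.swap : (ℝ × F) × ((Fin n × κ → ℝ) × (Fin n × κ → ℝ)) → _) :=
    Measure.measurePreserving_swap
  exact ((MeasurePreserving.id volume).prod (h5.comp h4)).comp (h3.comp (h2.comp h1))

end Coordinates

section

/-! ### Matrices over an algebra with conjugation -/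

open Matrix

/-- Real coordinates on an algebra with conjugation (`ℝ`, `ℂ` or `ℍ`): an orthonormal basis, left
multiplications as real matrices, real and imaginary parts. -/
structure CoordAlgebra (K κ F : Type*) [Ring K] [StarRing K] [Algebra ℝ K] [Fintype κ]
    [DecidableEq κ] [AddCommGroup F] [Module ℝ F] where
  coord : (κ → ℝ) →ₗ[ℝ] K
  lmul : K →ₐ[ℝ] Matrix κ κ ℝ
  coord_lmul : ∀ x v, coord (lmul x *ᵥ v) = x * coord v
  lmul_star : ∀ x, lmul (star x) = (lmul x)ᵀ
  re : K →ₗ[ℝ] ℝ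
  im : K →ₗ[ℝ] F
  ofIm : F →ₗ[ℝ] K
  re_star_mul : ∀ v w, re (star (coord v) * coord w) = v ⬝ᵥ w
  re_add_im : ∀ x, algebraMap ℝ K (re x) + ofIm (im x) = x
  im_ofIm : ∀ s, im (ofIm s) = s
  star_algebraMap : ∀ r, star (algebraMap ℝ K r) = algebraMap ℝ K r
  star_ofIm : ∀ s, star (ofIm s) = -ofIm s

namespace CoordAlgebra

variable {K κ F : Type*} [Ring K] [StarRing K] [Algebra ℝ K] [Fintype κ] [DecidableEq κ]
  [AddCommGroup F] [Module ℝ F] (D : CoordAlgebra K κ F)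

/-- The imaginary part of a self-adjoint element equals its own negative. This makes the pivots of T
real numbers. -/
theorem eq_algebraMap_of_star_eq {x : K} (hx : star x = x) : x = algebraMap ℝ K (D.re x) := by
  have h1 := D.re_add_im x
  have h2 := congrArg star h1
  rw [star_add, D.star_algebraMap, D.star_ofIm, hx] at h2
  have h3 : D.ofIm (D.im x) = 0 := by
    have h4 : D.ofIm (D.im x) + D.ofIm (D.im x) = 0 := by
      have := h1.trans h2.symm
      rw [add_left_cancel_iff] at this
      nth_rewrite 1 [this]
      exact neg_add_cancel _
    have h5 := congrArg D.im h4
    rw [map_add, D.im_ofIm, map_zero, ← two_smul ℝ, smul_eq_zero] at h5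
    rw [h5.resolve_left two_ne_zero, map_zero]
  rw [h3, add_zero] at h1
  exact h1.symm

/-- The element with given real and imaginary parts. -/
def ofReIm (q : ℝ × F) : K := algebraMap ℝ K q.1 + D.ofIm q.2

section Matrices

variable {ι : Type*}

/-- The real matrix of a matrix over `K`. -/
def realify (A : Matrix ι ι K) : Matrix (ι × κ) (ι × κ) ℝ :=
  Matrix.comp ι ι κ κ ℝ (A.map D.lmul)

/-- The vector over `K` with given real coordinates. -/
def ofCoords (v : ι × κ → ℝ) : ι → K := fun i => D.coord fun k => v (i, k)

theorem mulVec_ofCoords [Fintype ι] (A : Matrix ι ι K) (v : ι × κ → ℝ) :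
    A *ᵥ D.ofCoords v = D.ofCoords (D.realify A *ᵥ v) := by
  funext i
  have h : (fun k => (D.realify A *ᵥ v) (i, k)) =
      ∑ j, D.lmul (A i j) *ᵥ fun k => v (j, k) := by
    funext k
    rw [Finset.sum_apply]
    simp only [mulVec, dotProduct, Fintype.sum_prod_type]
    rfl
  simp only [ofCoords]
  rw [h, map_sum]
  simp only [D.coord_lmul]
  rfl

theorem re_star_ofCoords_dotProduct [Fintype ι] (v w : ι × κ → ℝ) :
    D.re (star (D.ofCoords v) ⬝ᵥ D.ofCoords w) = v ⬝ᵥ w := by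
  simp only [dotProduct, map_sum, Fintype.sum_prod_type]
  exact Finset.sum_congr rfl fun i _ => D.re_star_mul _ _

theorem realify_conjTranspose (A : Matrix ι ι K) : D.realify Aᴴ = (D.realify A)ᵀ := by
  ext ⟨i, k⟩ ⟨j, l⟩
  exact congrFun (congrFun (D.lmul_star (A j i)) k) l

theorem realify_add (A B : Matrix ι ι K) : D.realify (A + B) = D.realify A + D.realify B := by
  ext ⟨i, k⟩ ⟨j, l⟩
  exact congrFun (congrFun (map_add D.lmul (A i j) (B i j)) k) l

theorem realify_neg (A : Matrix ι ι K) : D.realify (-A) = -D.realify A := by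
  ext ⟨i, k⟩ ⟨j, l⟩
  exact congrFun (congrFun (map_neg D.lmul (A i j)) k) l

theorem realify_one [DecidableEq ι] : D.realify (1 : Matrix ι ι K) = 1 := by
  rw [realify, Matrix.map_one _ (map_zero _) (map_one _), Matrix.comp_one]

theorem ofCoords_add (v w : ι × κ → ℝ) : D.ofCoords (v + w) = D.ofCoords v + D.ofCoords w :=
  funext fun _ => map_add D.coord _ _

theorem ofCoords_sub (v w : ι × κ → ℝ) : D.ofCoords (v - w) = D.ofCoords v - D.ofCoords w :=
  funext fun _ => map_sub D.coord _ _

end Matrices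

/-! ### Blocks -/

theorem bijective_blockMap (n : ℕ) (κ : Type*) : Function.Bijective
    (Sum.elim (fun p : Fin n × κ => ((p.1.castSucc, p.2) : Fin (n + 1) × κ))
      fun k => (Fin.last n, k)) := by
  constructor
  · rintro (⟨i, k⟩ | k) (⟨i', k'⟩ | k') h
    · simp_all
    · simp only [Sum.elim_inl, Sum.elim_inr, Prod.mk.injEq] at h
      exact absurd h.1 (Fin.castSucc_lt_last i).ne
    · simp only [Sum.elim_inl, Sum.elim_inr, Prod.mk.injEq] at h
      exact absurd h.1.symm (Fin.castSucc_lt_last i').ne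
    · simp_all
  · rintro ⟨i, k⟩
    by_cases hi : i = Fin.last n
    · subst hi
      exact ⟨Sum.inr k, rfl⟩
    · obtain ⟨i, rfl⟩ := Fin.exists_castSucc_eq.2 hi
      exact ⟨Sum.inl (i, k), rfl⟩

/-- The last row and column of a block matrix as the second block. -/
def blockEquiv (n : ℕ) (κ : Type*) : (Fin n × κ) ⊕ κ ≃ Fin (n + 1) × κ :=
  Equiv.ofBijective _ (bijective_blockMap n κ)

variable {n : ℕ}

/-- The left upper `n × n` block. -/
def initBlock {K : Type*} (A : Matrix (Fin (n + 1)) (Fin (n + 1)) K) : Matrix (Fin n) (Fin n) K :=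
  A.submatrix Fin.castSucc Fin.castSucc

/-- The real matrix of a column. -/
def realifyCol (b : Fin n → K) : Matrix (Fin n × κ) κ ℝ := of fun p k => D.lmul (b p.1) p.2 k

/-- The real matrix of a row. -/
def realifyRow (c : Fin n → K) : Matrix κ (Fin n × κ) ℝ := of fun k p => D.lmul (c p.1) k p.2

theorem realify_submatrix_blockEquiv (A : Matrix (Fin (n + 1)) (Fin (n + 1)) K) :
    (D.realify A).submatrix (blockEquiv n κ) (blockEquiv n κ) =
      fromBlocks (D.realify (initBlock A)) (D.realifyCol fun i => A i.castSucc (Fin.last n))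
        (D.realifyRow fun j => A (Fin.last n) j.castSucc)
        (D.lmul (A (Fin.last n) (Fin.last n))) := by
  ext (⟨i, k⟩ | k) (⟨j, l⟩ | l) <;> rfl

theorem realify_mul_realifyCol (A : Matrix (Fin n) (Fin n) K) (w : Fin n → K) :
    D.realify A * D.realifyCol w = D.realifyCol (A *ᵥ w) := by
  ext ⟨i, k⟩ l
  have h : D.lmul ((A *ᵥ w) i) = ∑ j, D.lmul (A i j) * D.lmul (w j) := by
    simp only [mulVec, dotProduct, map_sum, map_mul]
  simp only [realifyCol, of_apply]
  rw [h, Matrix.sum_apply]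
  simp only [mul_apply, Fintype.sum_prod_type, of_apply]
  rfl

theorem realifyRow_mul_realifyCol (c w : Fin n → K) :
    D.realifyRow c * D.realifyCol w = D.lmul (c ⬝ᵥ w) := by
  ext k l
  have h : D.lmul (c ⬝ᵥ w) = ∑ j, D.lmul (c j) * D.lmul (w j) := by
    simp only [dotProduct, map_sum, map_mul]
  rw [h, Matrix.sum_apply]
  simp only [mul_apply, Fintype.sum_prod_type, realifyCol, realifyRow, of_apply]

/-- Working with a solution w of Aw = b avoids inverting matrices over the possibly noncommutative
K, and shows that the Schur complement of the real blocks is again left multiplication by an element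
of K. -/
theorem realifyRow_mul_inv_mul_realifyCol {A : Matrix (Fin n) (Fin n) K}
    (hA : (D.realify A).det ≠ 0) {b c w : Fin n → K} (hw : A *ᵥ w = b) :
    D.realifyRow c * (D.realify A)⁻¹ * D.realifyCol b = D.lmul (c ⬝ᵥ w) := by
  rw [← hw, ← D.realify_mul_realifyCol, Matrix.mul_assoc, ← Matrix.mul_assoc _ (D.realify A),
    nonsing_inv_mul _ hA.isUnit, Matrix.one_mul, D.realifyRow_mul_realifyCol]

theorem det_realify_succ {A : Matrix (Fin (n + 1)) (Fin (n + 1)) K}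
    (hA : (D.realify (initBlock A)).det ≠ 0) {w : Fin n → K}
    (hw : initBlock A *ᵥ w = fun i => A i.castSucc (Fin.last n)) :
    (D.realify A).det = (D.realify (initBlock A)).det *
      (D.lmul (A (Fin.last n) (Fin.last n) - (fun j => A (Fin.last n) j.castSucc) ⬝ᵥ w)).det := by
  have : Invertible (D.realify (initBlock A)) := Matrix.invertibleOfIsUnitDet _ hA.isUnit
  rw [← det_submatrix_equiv_self (blockEquiv n κ), realify_submatrix_blockEquiv, det_fromBlocks₁₁,
    invOf_eq_nonsing_inv, D.realifyRow_mul_inv_mul_realifyCol hA hw, map_sub]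

/-- The solution of `A w = b` in real coordinates. -/
theorem mulVec_ofCoords_inv_mulVec {A : Matrix (Fin n) (Fin n) K}
    (hA : (D.realify A).det ≠ 0) (v : Fin n × κ → ℝ) :
    A *ᵥ D.ofCoords ((D.realify A)⁻¹ *ᵥ v) = D.ofCoords v := by
  rw [D.mulVec_ofCoords, mulVec_mulVec, mul_nonsing_inv _ hA.isUnit, one_mulVec]

/-! ### Pivots -/

/-- The matrix `T`. -/
def herm (x : Coords κ F n) : Matrix (Fin n) (Fin n) K :=
  hermMatrix x.1.1 fun p => D.coord (x.1.2 p)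

/-- The matrix `S`. -/
def skew (x : Coords κ F n) : Matrix (Fin n) (Fin n) K :=
  skewMatrix (fun i => D.ofIm (x.2.1 i)) fun p => D.coord (x.2.2 p)

theorem initBlock_herm (x : Coords κ F (n + 1)) :
    initBlock (D.herm x) = D.herm (splitLast x).1 := by
  ext i j
  simp only [initBlock, herm, hermMatrix, submatrix_apply, of_apply, Fin.castSucc_lt_castSucc_iff]
  rfl

theorem initBlock_skew (x : Coords κ F (n + 1)) :
    initBlock (D.skew x) = D.skew (splitLast x).1 := by
  ext i j
  simp only [initBlock, skew, skewMatrix, submatrix_apply, of_apply, Fin.castSucc_lt_castSucc_iff]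
  rfl

theorem initBlock_one_add (x : Coords κ F (n + 1)) :
    initBlock (1 + D.herm x + D.skew x) =
      1 + D.herm (splitLast x).1 + D.skew (splitLast x).1 := by
  rw [← initBlock_herm, ← initBlock_skew]
  ext i j
  simp [initBlock, one_apply]

theorem herm_castSucc_last (x : Coords κ F (n + 1)) (i : Fin n) :
    D.herm x i.castSucc (Fin.last n) = D.ofCoords (splitLast x).2.1.1 i := by
  simp only [herm, hermMatrix, of_apply, dif_pos (Fin.castSucc_lt_last i)]
  rfl

theorem herm_last_castSucc (x : Coords κ F (n + 1)) (i : Fin n) :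
    D.herm x (Fin.last n) i.castSucc = star (D.ofCoords (splitLast x).2.1.1 i) := by
  simp only [herm, hermMatrix, of_apply, dif_pos (Fin.castSucc_lt_last i),
    dif_neg (Fin.castSucc_lt_last i).not_gt]
  rfl

theorem herm_last_last (x : Coords κ F (n + 1)) :
    D.herm x (Fin.last n) (Fin.last n) = algebraMap ℝ K (splitLast x).2.2.1 := by
  simp only [herm, hermMatrix, of_apply, lt_irrefl, dif_neg, not_false_eq_true]
  rfl

theorem skew_castSucc_last (x : Coords κ F (n + 1)) (i : Fin n) :
    D.skew x i.castSucc (Fin.last n) = D.ofCoords (splitLast x).2.1.2 i := by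
  simp only [skew, skewMatrix, of_apply, dif_pos (Fin.castSucc_lt_last i)]
  rfl

theorem skew_last_castSucc (x : Coords κ F (n + 1)) (i : Fin n) :
    D.skew x (Fin.last n) i.castSucc = -star (D.ofCoords (splitLast x).2.1.2 i) := by
  simp only [skew, skewMatrix, of_apply, dif_pos (Fin.castSucc_lt_last i),
    dif_neg (Fin.castSucc_lt_last i).not_gt]
  rfl

theorem skew_last_last (x : Coords κ F (n + 1)) :
    D.skew x (Fin.last n) (Fin.last n) = D.ofIm (splitLast x).2.2.2 := by
  simp only [skew, skewMatrix, of_apply, lt_irrefl, dif_neg, not_false_eq_true]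
  rfl

theorem herm_conjTranspose (x : Coords κ F n) : (D.herm x)ᴴ = D.herm x := by
  ext i j
  simp only [herm, hermMatrix, conjTranspose_apply, of_apply]
  rcases lt_trichotomy i j with h | rfl | h
  · simp [h, h.not_gt]
  · simp [D.star_algebraMap]
  · simp [h, h.not_gt]

theorem skew_conjTranspose (x : Coords κ F n) : (D.skew x)ᴴ = -D.skew x := by
  ext i j
  simp only [skew, skewMatrix, conjTranspose_apply, of_apply]
  rcases lt_trichotomy i j with h | rfl | h
  · simp [h, h.not_gt]
  · simp [D.star_ofIm]
  · simp [h, h.not_gt]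

/-- The real matrix of `T`. -/
def realT (x : Coords κ F n) : Matrix (Fin n × κ) (Fin n × κ) ℝ := D.realify (D.herm x)

/-- The real matrix of `1 + T + S`. -/
def realQ (x : Coords κ F n) : Matrix (Fin n × κ) (Fin n × κ) ℝ :=
  D.realify (1 + D.herm x + D.skew x)

theorem realQ_eq (x : Coords κ F n) : D.realQ x = 1 + D.realT x + D.realify (D.skew x) := by
  rw [realQ, realify_add, realify_add, realify_one, realT]

theorem realify_skew_transpose (x : Coords κ F n) :
    (D.realify (D.skew x))ᵀ = -D.realify (D.skew x) := by
  rw [← realify_conjTranspose, skew_conjTranspose, realify_neg]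

theorem realT_transpose (x : Coords κ F n) : (D.realT x)ᵀ = D.realT x := by
  rw [realT, ← realify_conjTranspose, herm_conjTranspose]

variable (n) in
/-- The coordinates of the wedge. -/
def domain : Set (Coords κ F n) := {x | (D.realT x).PosDef}

theorem posDef_realQ_add_transpose {x : Coords κ F n} (hx : x ∈ D.domain n) :
    (D.realQ x + (D.realQ x)ᵀ).PosDef := by
  have h : D.realQ x + (D.realQ x)ᵀ = (1 + D.realT x) + (1 + D.realT x) := by
    rw [realQ_eq, transpose_add, transpose_add, transpose_one, realify_skew_transpose,
      realT_transpose]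
    abel
  rw [h]
  have h1 : (1 + D.realT x).PosDef := Matrix.PosDef.one.add hx
  exact h1.add h1

theorem det_realQ_pos {x : Coords κ F n} (hx : x ∈ D.domain n) : 0 < (D.realQ x).det :=
  det_pos_of_posDef_add_transpose (D.posDef_realQ_add_transpose hx)

/-- The last pivot of `T`. -/
def pivotT (x : Coords κ F n) (y : LastCoords κ F n) : ℝ :=
  y.2.1 - y.1.1 ⬝ᵥ (D.realT x)⁻¹ *ᵥ y.1.1

/-- The real and imaginary part of the last pivot of `1 + T + S`. -/
def pivotQ (x : Coords κ F n) (y : LastCoords κ F n) : ℝ × F :=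
  (1 + y.2.1 - (y.1.1 - y.1.2) ⬝ᵥ (D.realQ x)⁻¹ *ᵥ (y.1.1 + y.1.2),
   y.2.2 - D.im (star (D.ofCoords (y.1.1 - y.1.2)) ⬝ᵥ
    D.ofCoords ((D.realQ x)⁻¹ *ᵥ (y.1.1 + y.1.2))))

/-- The scalar a*A⁻¹a is self-adjoint because A is, hence real, and its real part is the Euclidean
form in real coordinates. -/
theorem schur_herm {x : Coords κ F (n + 1)} (hx : (splitLast x).1 ∈ D.domain n) :
    D.herm x (Fin.last n) (Fin.last n) - (fun j => D.herm x (Fin.last n) j.castSucc) ⬝ᵥ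
      D.ofCoords ((D.realT (splitLast x).1)⁻¹ *ᵥ (splitLast x).2.1.1) =
    algebraMap ℝ K (D.pivotT (splitLast x).1 (splitLast x).2) := by
  set x' := (splitLast x).1
  set a := (splitLast x).2.1.1 with ha
  set w := D.ofCoords ((D.realT x')⁻¹ *ᵥ a) with hw
  have hAw : D.herm x' *ᵥ w = D.ofCoords a :=
    D.mulVec_ofCoords_inv_mulVec (A := D.herm x') hx.det_pos.ne' a
  have hc : (fun j => D.herm x (Fin.last n) j.castSucc) = star (D.ofCoords a) :=
    funext fun j => D.herm_last_castSucc x j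
  have hstar : star (star (D.ofCoords a) ⬝ᵥ w) = star (D.ofCoords a) ⬝ᵥ w := by
    rw [← star_dotProduct_star, star_star, ← hAw, star_mulVec, D.herm_conjTranspose,
      dotProduct_mulVec]
  rw [hc, D.eq_algebraMap_of_star_eq hstar, D.re_star_ofCoords_dotProduct, D.herm_last_last,
    ← map_sub]
  rfl

/-- Outside the diagonal entry, the last row of 1 + T + S is (a - b)* while its last column is a +
b; the difference of signs comes from S = -S*. -/
theorem schur_one_add {x : Coords κ F (n + 1)} :
    (1 + D.herm x + D.skew x) (Fin.last n) (Fin.last n) -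
      (fun j => (1 + D.herm x + D.skew x) (Fin.last n) (Fin.castSucc j)) ⬝ᵥ
      D.ofCoords ((D.realQ (splitLast x).1)⁻¹ *ᵥ
        ((splitLast x).2.1.1 + (splitLast x).2.1.2)) =
    D.ofReIm (D.pivotQ (splitLast x).1 (splitLast x).2) := by
  set x' := (splitLast x).1
  set y := (splitLast x).2 with hy
  set w := D.ofCoords ((D.realQ x')⁻¹ *ᵥ (y.1.1 + y.1.2)) with hw
  have hc : (fun j : Fin n => (1 + D.herm x + D.skew x) (Fin.last n) j.castSucc) =
      star (D.ofCoords (y.1.1 - y.1.2)) := by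
    funext j
    rw [Matrix.add_apply, Matrix.add_apply, D.herm_last_castSucc, D.skew_last_castSucc, ofCoords_sub,
      one_apply_ne (Fin.castSucc_lt_last j).ne', zero_add, Pi.star_apply, Pi.sub_apply, star_sub,
      sub_eq_add_neg]
  rw [hc, Matrix.add_apply, Matrix.add_apply, one_apply_eq, D.herm_last_last, D.skew_last_last,
    ← D.re_add_im (star (D.ofCoords (y.1.1 - y.1.2)) ⬝ᵥ w), D.re_star_ofCoords_dotProduct, ofReIm,
    pivotQ, map_sub, map_sub, map_add, map_one]
  abel

theorem initBlock_one_add_mulVec {x : Coords κ F (n + 1)} (hx : (splitLast x).1 ∈ D.domain n) :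
    initBlock (1 + D.herm x + D.skew x) *ᵥ D.ofCoords ((D.realQ (splitLast x).1)⁻¹ *ᵥ
        ((splitLast x).2.1.1 + (splitLast x).2.1.2)) =
      fun i => (1 + D.herm x + D.skew x) i.castSucc (Fin.last n) := by
  rw [initBlock_one_add]
  refine (D.mulVec_ofCoords_inv_mulVec (D.det_realQ_pos hx).ne' _).trans ?_
  funext i
  rw [Matrix.add_apply, Matrix.add_apply, D.herm_castSucc_last, D.skew_castSucc_last, ofCoords_add,
    one_apply_ne (Fin.castSucc_lt_last i).ne, zero_add, Pi.add_apply]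

theorem initBlock_herm_mulVec {x : Coords κ F (n + 1)} (hx : (splitLast x).1 ∈ D.domain n) :
    initBlock (D.herm x) *ᵥ
        D.ofCoords ((D.realT (splitLast x).1)⁻¹ *ᵥ (splitLast x).2.1.1) =
      fun i => D.herm x i.castSucc (Fin.last n) := by
  rw [initBlock_herm]
  refine (D.mulVec_ofCoords_inv_mulVec (A := D.herm (splitLast x).1) hx.det_pos.ne' _).trans ?_
  exact funext fun i => (D.herm_castSucc_last x i).symm

/-- The pivot is a real scalar, so its left multiplication is a scalar matrix of size |κ|. -/
theorem det_realT_succ {x : Coords κ F (n + 1)} (hx : (splitLast x).1 ∈ D.domain n) :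
    (D.realT x).det = (D.realT (splitLast x).1).det *
      D.pivotT (splitLast x).1 (splitLast x).2 ^ Fintype.card κ := by
  have h := D.det_realify_succ (A := D.herm x)
    (w := D.ofCoords ((D.realT (splitLast x).1)⁻¹ *ᵥ (splitLast x).2.1.1))
    (by rw [initBlock_herm]; exact hx.det_pos.ne') (D.initBlock_herm_mulVec hx)
  rw [D.schur_herm hx, AlgHom.commutes, algebraMap_eq_diagonal, initBlock_herm] at h
  rw [realT, h, det_diagonal]
  simp [realT]

theorem det_realQ_succ {x : Coords κ F (n + 1)} (hx : (splitLast x).1 ∈ D.domain n) :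
    (D.realQ x).det = (D.realQ (splitLast x).1).det *
      (D.lmul (D.ofReIm (D.pivotQ (splitLast x).1 (splitLast x).2))).det := by
  have hdet : (D.realify (1 + D.herm (splitLast x).1 + D.skew (splitLast x).1)).det ≠ 0 :=
    (D.det_realQ_pos hx).ne'
  have h := D.det_realify_succ (A := 1 + D.herm x + D.skew x)
    (w := D.ofCoords ((D.realQ (splitLast x).1)⁻¹ *ᵥ
        ((splitLast x).2.1.1 + (splitLast x).2.1.2)))
    (by rw [initBlock_one_add]; exact hdet) (D.initBlock_one_add_mulVec hx)
  rw [D.schur_one_add, initBlock_one_add] at h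
  exact h

/-- The Schur complement criterion characterises semidefiniteness by the sign of the pivot.
Definiteness follows since the determinant is the product of the determinant of the leading block
and a power of the pivot. -/
theorem mem_domain_succ [Nonempty κ] {x : Coords κ F (n + 1)} :
    x ∈ D.domain (n + 1) ↔
      (splitLast x).1 ∈ D.domain n ∧ 0 < D.pivotT (splitLast x).1 (splitLast x).2 := by
  have hsub : (D.realT x).PosDef ↔ ((D.realT x).submatrix (blockEquiv n κ) (blockEquiv n κ)).PosDef :=
    ⟨fun h => h.submatrix (blockEquiv n κ).injective, fun h => by
      have := h.submatrix (blockEquiv n κ).symm.injective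
      simpa using this⟩
  have hblock : (D.realT x).submatrix (blockEquiv n κ) (blockEquiv n κ) =
      fromBlocks (D.realT (splitLast x).1) (D.realifyCol (D.ofCoords (splitLast x).2.1.1))
        (D.realifyCol (D.ofCoords (splitLast x).2.1.1))ᴴ
        (D.lmul (D.herm x (Fin.last n) (Fin.last n))) := by
    rw [realT, realify_submatrix_blockEquiv, initBlock_herm]
    congr 1
    · congr 1
      exact funext fun i => D.herm_castSucc_last x i
    · ext k ⟨i, l⟩
      simp only [realifyRow, realifyCol, of_apply, conjTranspose_apply, star_trivial]
      rw [D.herm_last_castSucc, D.lmul_star, transpose_apply]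
  have hfst : x ∈ D.domain (n + 1) → (splitLast x).1 ∈ D.domain n := fun h => by
    have h1 := (hsub.1 h).submatrix Sum.inl_injective
    rw [hblock] at h1
    exact h1
  have key : (splitLast x).1 ∈ D.domain n → ((D.realT x).PosSemidef ↔
      0 ≤ D.pivotT (splitLast x).1 (splitLast x).2) := fun hx => by
    have : Invertible (D.realT (splitLast x).1) :=
      Matrix.invertibleOfIsUnitDet _ hx.det_pos.ne'.isUnit
    rw [← posSemidef_submatrix_equiv (blockEquiv n κ), hblock, PosDef.fromBlocks₁₁ _ _ hx]
    have hrow : (D.realifyCol (D.ofCoords (splitLast x).2.1.1))ᴴ =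
        D.realifyRow fun j => D.herm x (Fin.last n) j.castSucc := by
      ext k ⟨i, l⟩
      simp only [realifyRow, realifyCol, of_apply, conjTranspose_apply, star_trivial]
      rw [D.herm_last_castSucc, D.lmul_star, transpose_apply]
    rw [hrow, realT, D.realifyRow_mul_inv_mul_realifyCol hx.det_pos.ne'
      (D.mulVec_ofCoords_inv_mulVec hx.det_pos.ne' _), ← map_sub]
    have hs := D.schur_herm hx
    rw [realT] at hs
    rw [hs, AlgHom.commutes, algebraMap_eq_diagonal, posSemidef_diagonal_iff]
    simp
  constructor
  · intro h
    have hx := hfst h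
    refine ⟨hx, lt_of_le_of_ne ((key hx).1 h.posSemidef) fun h0 => ?_⟩
    have h1 : 0 < (D.realT x).det := h.det_pos
    rw [D.det_realT_succ hx, ← h0, zero_pow Fintype.card_ne_zero, mul_zero] at h1
    exact lt_irrefl _ h1
  · rintro ⟨hx, hp⟩
    refine ((key hx).2 hp.le).posDef_iff_det_ne_zero.2 ?_
    rw [D.det_realT_succ hx]
    exact mul_ne_zero hx.det_pos.ne' (pow_ne_zero _ hp.ne')

end CoordAlgebra

end

section

/-! ### Integration over the last row and column -/

open Matrix

theorem posDef_of_isEmpty {ι : Type*} [IsEmpty ι] (A : Matrix ι ι ℝ) : A.PosDef :=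
  ⟨ext fun i => isEmptyElim i, fun _ hx => (hx (Subsingleton.elim _ _)).elim⟩

theorem measurable_inv_apply {α ι : Type*} [MeasurableSpace α] [Fintype ι] [DecidableEq ι]
    {A : α → Matrix ι ι ℝ} (hA : ∀ i j, Measurable fun x => A x i j) (i j : ι) :
    Measurable fun x => (A x)⁻¹ i j := by
  have hA' : Measurable fun x i j => A x i j :=
    measurable_pi_lambda _ fun i => measurable_pi_lambda _ fun j => hA i j
  have h1 : Continuous fun f : ι → ι → ℝ => (of f).det := by fun_prop
  have h2 : Continuous fun f : ι → ι → ℝ => (of f).adjugate i j :=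
    by fun_prop
  have h3 : (fun x => (A x)⁻¹ i j) = fun x => ((A x).det)⁻¹ * (A x).adjugate i j := by
    funext x
    rw [inv_def, Ring.inverse_eq_inv', Matrix.smul_apply, smul_eq_mul]
  rw [h3]
  exact (h1.measurable.comp hA').inv.mul (h2.measurable.comp hA')

namespace CoordAlgebra

/-! ### The square completed for pivots, the Jacobian weight, and measurability. -/

section Measurability

variable {K κ F : Type*} [Ring K] [StarRing K] [Algebra ℝ K] [Fintype κ] [DecidableEq κ]
  [NormedAddCommGroup F] [NormedSpace ℝ F] (D : CoordAlgebra K κ F)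

theorem star_smul_eq (D : CoordAlgebra K κ F) (r : ℝ) (x : K) : star (r • x) = r • star x := by
  rw [Algebra.smul_def, star_mul, D.star_algebraMap, ← Algebra.commutes, ← Algebra.smul_def]

theorem coord_eq_sum (v : κ → ℝ) : D.coord v = ∑ k, v k • D.coord (Pi.single k 1) := by
  conv_lhs => rw [pi_eq_sum_univ' v]
  rw [map_sum]
  refine Finset.sum_congr rfl fun k _ => ?_
  rw [map_smul]

/-- A bilinear expansion in real coordinates, from which measurability can be read off. -/
theorem im_star_ofCoords_dotProduct {ι : Type*} [Fintype ι] (v w : ι × κ → ℝ) :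
    D.im (star (D.ofCoords v) ⬝ᵥ D.ofCoords w) = ∑ i, ∑ k, ∑ m,
      (v (i, k) * w (i, m)) • D.im (star (D.coord (Pi.single k 1)) * D.coord (Pi.single m 1)) := by
  simp only [dotProduct, map_sum]
  refine Finset.sum_congr rfl fun i _ => ?_
  rw [Pi.star_apply, ofCoords, ofCoords, D.coord_eq_sum, D.coord_eq_sum, star_sum,
    Finset.sum_mul_sum, map_sum]
  refine Finset.sum_congr rfl fun k _ => ?_
  rw [map_sum]
  refine Finset.sum_congr rfl fun m _ => ?_
  rw [D.star_smul_eq, smul_mul_smul_comm, map_smul]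

theorem measurable_lmul_coord (k l : κ) : Measurable fun v => D.lmul (D.coord v) k l :=
  (LinearMap.continuous_of_finiteDimensional
    ((Matrix.entryLinearMap ℝ ℝ k l) ∘ₗ D.lmul.toLinearMap ∘ₗ D.coord)).measurable

theorem measurable_lmul_algebraMap (k l : κ) :
    Measurable fun r => D.lmul (algebraMap ℝ K r) k l :=
  (LinearMap.continuous_of_finiteDimensional
    ((Matrix.entryLinearMap ℝ ℝ k l) ∘ₗ D.lmul.toLinearMap ∘ₗ Algebra.linearMap ℝ K)).measurable

/-- The absolute value of the determinant of a left multiplication. -/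
def absDet (q : ℝ × F) : ℝ := |(D.lmul (D.ofReIm q)).det|

variable {n : ℕ}

theorem exists_pivotQ_fst_eq {x : Coords κ F n} (hx : x ∈ D.domain n) :
    ∃ C₁ C₂ L : Matrix (Fin n × κ) (Fin n × κ) ℝ,
      (C₁.det * C₂.det) ^ 2 * ((D.realQ x).det ^ 2 * (D.realT x).det) = 1 ∧
      ∀ y : LastCoords κ F n, (D.pivotQ x y).1 = 1 + (D.pivotT x y +
        (C₁ *ᵥ y.1.1) ⬝ᵥ (C₁ *ᵥ y.1.1) +
        (C₂ *ᵥ (y.1.2 + L *ᵥ y.1.1)) ⬝ᵥ (C₂ *ᵥ (y.1.2 + L *ᵥ y.1.1))) := by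
  obtain ⟨C₁, C₂, L, hdet, h⟩ := exists_complete_square hx (D.realify_skew_transpose x)
  rw [← realQ_eq] at hdet h
  refine ⟨C₁, C₂, L, hdet, fun y => ?_⟩
  have := h y.1.1 y.1.2
  simp only [pivotQ, pivotT]
  linarith

/-- The integrand over the last row and column. -/
def lastFactor (l : ℂ) (ψ : ℝ × F → ℂ) (x : Coords κ F n) (y : LastCoords κ F n) : ℂ :=
  if 0 < D.pivotT x y then (D.pivotT x y : ℂ) ^ l * ψ (D.pivotQ x y) else 0

/-- The Jacobian of the substitution in the last row and column. -/
def weight (x : Coords κ F n) : ℝ := (D.realQ x).det * Real.sqrt (D.realT x).det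

theorem weight_nonneg {x : Coords κ F n} (hx : x ∈ D.domain n) : 0 ≤ D.weight x :=
  mul_nonneg (D.det_realQ_pos hx).le (Real.sqrt_nonneg _)

/-- The product of functions of the pivots. -/
def pivotProd : (n : ℕ) → (ℕ → ℂ) → (ℕ → ℝ × F → ℂ) → Coords κ F n → ℂ
  | 0, _, _, _ => 1
  | n + 1, l, ψ, x => pivotProd n l ψ (splitLast x).1 *
      ((D.pivotT (splitLast x).1 (splitLast x).2 : ℂ) ^ l n *
        ψ n (D.pivotQ (splitLast x).1 (splitLast x).2))

/-- This closes the recursion: det Q and det T are products over pivots. The square root of det T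
adds |κ|/2 to each exponent of a pivot of T, and det Q multiplies each function of a pivot of Q by
`absDet`. -/
theorem weight_mul_pivotProd [Nonempty κ] (l : ℕ → ℂ) (ψ : ℕ → ℝ × F → ℂ) :
    ∀ {n : ℕ} {x : Coords κ F n}, x ∈ D.domain n → (D.weight x : ℂ) * D.pivotProd n l ψ x =
      D.pivotProd n (fun k => l k + Fintype.card κ / 2) (fun k q => D.absDet q * ψ k q) x
  | 0, x, _ => by simp [weight, pivotProd]
  | n + 1, x, hx => by
    obtain ⟨hx', hp⟩ := D.mem_domain_succ.1 hx
    have ih := weight_mul_pivotProd l ψ hx'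
    set x' := (splitLast x).1
    set y := (splitLast x).2
    have hq : (D.realQ x).det = (D.realQ x').det * D.absDet (D.pivotQ x' y) := by
      have h := D.det_realQ_succ hx'
      have h1 := D.det_realQ_pos hx
      rw [h] at h1 ⊢
      rw [absDet, abs_of_pos (pos_of_mul_pos_right h1 (D.det_realQ_pos hx').le)]
    have ht : (Real.sqrt (D.realT x).det : ℂ) = Real.sqrt (D.realT x').det *
        (D.pivotT x' y : ℂ) ^ ((Fintype.card κ : ℂ) / 2) := by
      have h2 : (D.pivotT x' y : ℂ) ^ ((Fintype.card κ : ℂ) / 2) =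
          (Real.sqrt (D.pivotT x' y ^ Fintype.card κ) : ℂ) := by
        rw [Real.sqrt_eq_rpow, ← Real.rpow_natCast, ← Real.rpow_mul hp.le,
          Complex.ofReal_cpow hp.le]
        congr 1
        push_cast
        ring
      rw [h2, D.det_realT_succ hx', Real.sqrt_mul' _ (pow_nonneg hp.le _), Complex.ofReal_mul]
    rw [weight, hq]
    simp only [pivotProd]
    rw [← ih, weight, Complex.cpow_add _ _ (Complex.ofReal_ne_zero.2 hp.ne')]
    push_cast
    rw [ht]
    ring

variable [FiniteDimensional ℝ F] [MeasurableSpace F] [BorelSpace F]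

theorem measurable_im_star_ofCoords {α ι : Type*} [MeasurableSpace α] [Fintype ι]
    {v w : α → ι × κ → ℝ} (hv : Measurable v) (hw : Measurable w) :
    Measurable fun x => D.im (star (D.ofCoords (v x)) ⬝ᵥ D.ofCoords (w x)) := by
  simp only [im_star_ofCoords_dotProduct]
  refine Finset.measurable_sum _ fun i _ => Finset.measurable_sum _ fun k _ =>
    Finset.measurable_sum _ fun m _ => Measurable.smul_const ?_ _
  exact (measurable_pi_iff.1 hv _).mul (measurable_pi_iff.1 hw _)

theorem measurable_lmul_ofIm (k l : κ) : Measurable fun s => D.lmul (D.ofIm s) k l :=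
  (LinearMap.continuous_of_finiteDimensional
    ((Matrix.entryLinearMap ℝ ℝ k l) ∘ₗ D.lmul.toLinearMap ∘ₗ D.ofIm)).measurable

omit [FiniteDimensional ℝ F] [BorelSpace F] in
theorem measurable_realT (p q : Fin n × κ) : Measurable fun x : Coords κ F n => D.realT x p q := by
  obtain ⟨i, k⟩ := p
  obtain ⟨j, l⟩ := q
  change Measurable fun x : Coords κ F n => D.lmul (D.herm x i j) k l
  simp only [herm, hermMatrix, of_apply]
  rcases lt_trichotomy i j with h | rfl | h
  · simp only [h, dif_pos]
    exact (D.measurable_lmul_coord k l).comp (by fun_prop)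
  · simp only [lt_irrefl, dif_neg, not_false_eq_true]
    exact (D.measurable_lmul_algebraMap k l).comp (by fun_prop)
  · simp only [h, h.not_gt, dif_pos, dif_neg, not_false_eq_true, D.lmul_star, transpose_apply]
    exact (D.measurable_lmul_coord l k).comp (by fun_prop)

theorem measurable_realify_skew (p q : Fin n × κ) :
    Measurable fun x : Coords κ F n => D.realify (D.skew x) p q := by
  obtain ⟨i, k⟩ := p
  obtain ⟨j, l⟩ := q
  change Measurable fun x : Coords κ F n => D.lmul (D.skew x i j) k l
  simp only [skew, skewMatrix, of_apply]
  rcases lt_trichotomy i j with h | rfl | h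
  · simp only [h, dif_pos]
    exact (D.measurable_lmul_coord k l).comp (by fun_prop)
  · simp only [lt_irrefl, dif_neg, not_false_eq_true]
    exact (D.measurable_lmul_ofIm k l).comp (by fun_prop)
  · simp only [h, h.not_gt, dif_pos, dif_neg, not_false_eq_true, map_neg, D.lmul_star, Matrix.neg_apply,
      transpose_apply]
    exact ((D.measurable_lmul_coord l k).comp (by fun_prop)).neg

theorem measurable_realQ (p q : Fin n × κ) : Measurable fun x : Coords κ F n => D.realQ x p q := by
  simp only [realQ_eq, Matrix.add_apply]
  exact ((measurable_const).add (D.measurable_realT p q)).add (D.measurable_realify_skew p q)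

omit [FiniteDimensional ℝ F] [BorelSpace F] in
theorem measurable_pivotT :
    Measurable fun z : Coords κ F n × LastCoords κ F n => D.pivotT z.1 z.2 := by
  have h := fun p q => (measurable_inv_apply (D.measurable_realT (n := n)) p q).comp
    (measurable_fst : Measurable (Prod.fst : Coords κ F n × LastCoords κ F n → _))
  simp only [pivotT, dotProduct, mulVec]
  refine Measurable.sub (by fun_prop) (Finset.measurable_sum _ fun p _ => Measurable.mul
    (by fun_prop) (Finset.measurable_sum _ fun q _ => (h p q).mul (by fun_prop)))

theorem measurable_realQ_inv_mulVec :
    Measurable fun z : Coords κ F n × LastCoords κ F n =>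
      (D.realQ z.1)⁻¹ *ᵥ (z.2.1.1 + z.2.1.2) := by
  have h := fun p q => (measurable_inv_apply (D.measurable_realQ (n := n)) p q).comp
    (measurable_fst : Measurable (Prod.fst : Coords κ F n × LastCoords κ F n → _))
  refine measurable_pi_lambda _ fun p => ?_
  simp only [dotProduct, mulVec]
  exact Finset.measurable_sum _ fun q _ => (h p q).mul (by simp only [Pi.add_apply]; fun_prop)

theorem measurable_pivotQ :
    Measurable fun z : Coords κ F n × LastCoords κ F n => D.pivotQ z.1 z.2 := by
  have h := D.measurable_realQ_inv_mulVec (n := n)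
  refine Measurable.prodMk ?_ ?_
  · have h1 := fun p => measurable_pi_iff.1 h p
    refine Measurable.sub (by fun_prop) (Finset.measurable_sum _ fun p _ => Measurable.mul
      (by simp only [Pi.sub_apply]; fun_prop) (h1 p))
  · exact Measurable.sub (by fun_prop) (D.measurable_im_star_ofCoords (by fun_prop) h)

theorem measurable_absDet : Measurable D.absDet := by
  have h : Measurable fun (q : ℝ × F) k l => D.lmul (D.ofReIm q) k l :=
    measurable_pi_lambda _ fun k => measurable_pi_lambda _ fun l => by
      simp only [ofReIm, map_add, Matrix.add_apply]
      exact ((D.measurable_lmul_algebraMap k l).comp measurable_fst).add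
        ((D.measurable_lmul_ofIm k l).comp measurable_snd)
  have h1 : Continuous fun f : κ → κ → ℝ => |(of f).det| := by fun_prop
  exact h1.measurable.comp h

end Measurability

variable {K κ F : Type*} [Ring K] [StarRing K] [Algebra ℝ K] [Fintype κ] [DecidableEq κ]
  [NormedAddCommGroup F] [NormedSpace ℝ F] [FiniteDimensional ℝ F] [MeasureSpace F] [BorelSpace F]
  [Measure.IsAddHaarMeasure (volume : Measure F)] (D : CoordAlgebra K κ F) {n : ℕ}

omit [Measure.IsAddHaarMeasure (volume : Measure F)] in
theorem measurable_lastFactor (l : ℂ) {ψ : ℝ × F → ℂ} (hψ : Measurable ψ) :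
    Measurable fun z : Coords κ F n × LastCoords κ F n => D.lastFactor l ψ z.1 z.2 :=
  Measurable.ite (measurableSet_lt measurable_const D.measurable_pivotT)
    (((Complex.measurable_ofReal.comp D.measurable_pivotT).pow_const l).mul
      (hψ.comp D.measurable_pivotQ)) measurable_const

/-- In the coordinates u, C₁a, C₂(b + La), Im q, the last factor becomes a function independent of
x; all dependence on x sits in the scalar by which Ψ multiplies volume. -/
theorem exists_substitution {x : Coords κ F n} (hx : x ∈ D.domain n) :
    ∃ Ψ : LastCoords κ F n → LastCoords κ F n, Measurable Ψ ∧
      Measure.map Ψ volume = ENNReal.ofReal (D.weight x) • volume ∧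
      ∀ l ψ, D.lastFactor l ψ x = fun y => fiberFun l ψ (Ψ y) := by
  obtain ⟨C₁, C₂, L, hdet, hq⟩ := D.exists_pivotQ_fst_eq hx
  set k := C₁.det * C₂.det with hk
  have hk0 : k ≠ 0 := by
    intro h
    rw [h] at hdet
    norm_num at hdet
  -- Completing the square determines k only through k²; positivity of det Q lets the square root be
  -- taken without a sign ambiguity.
  have hw : |k⁻¹| = D.weight x := by
    have h1 : (D.realQ x).det ^ 2 * (D.realT x).det = (k⁻¹) ^ 2 := by
      field_simp
      linarith
    rw [← Real.sqrt_sq_eq_abs, ← h1, Real.sqrt_mul (sq_nonneg _),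
      Real.sqrt_sq (D.det_realQ_pos hx).le, weight]
  let α : (Fin n × κ → ℝ) × (Fin n × κ → ℝ) → ℝ := fun y => y.1 ⬝ᵥ (D.realT x)⁻¹ *ᵥ y.1
  let β : (Fin n × κ → ℝ) × (Fin n × κ → ℝ) → F := fun y =>
    D.im (star (D.ofCoords (y.1 - y.2)) ⬝ᵥ D.ofCoords ((D.realQ x)⁻¹ *ᵥ (y.1 + y.2)))
  have hα : Measurable α :=
    (by fun_prop : Continuous α).measurable
  have hβ : Measurable β := D.measurable_im_star_ofCoords (by fun_prop)
    (by fun_prop : Continuous fun y : (Fin n × κ → ℝ) × (Fin n × κ → ℝ) =>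
      (D.realQ x)⁻¹ *ᵥ (y.1 + y.2)).measurable
  have hmap := map_quadratic_change_of_variables (F := F) C₁ C₂ L
    (left_ne_zero_of_mul hk0) (right_ne_zero_of_mul hk0) hα hβ
  refine ⟨_, ?_, hw ▸ hmap, fun l ψ => ?_⟩
  · refine Measurable.prodMk (Measurable.prodMk ?_ ?_) (Measurable.prodMk ?_ ?_)
    · exact (by fun_prop : Continuous fun y : LastCoords κ F n => C₁ *ᵥ y.1.1).measurable
    · have h : Continuous fun y : (Fin n × κ → ℝ) × (Fin n × κ → ℝ) => C₂ *ᵥ (y.2 + L *ᵥ y.1) := by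
        fun_prop
      exact h.measurable.comp measurable_fst
    · exact (by fun_prop : Measurable fun y : LastCoords κ F n => y.2.1).sub
        (hα.comp measurable_fst)
    · exact (by fun_prop : Measurable fun y : LastCoords κ F n => y.2.2).sub
        (hβ.comp measurable_fst)
  · funext y
    have hq' : D.pivotQ x y = (1 + (D.pivotT x y + (C₁ *ᵥ y.1.1) ⬝ᵥ (C₁ *ᵥ y.1.1) +
        (C₂ *ᵥ (y.1.2 + L *ᵥ y.1.1)) ⬝ᵥ (C₂ *ᵥ (y.1.2 + L *ᵥ y.1.1))), y.2.2 - β y.1) :=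
      Prod.ext (hq y) rfl
    rw [lastFactor, hq']
    rfl

theorem integral_lastFactor {x : Coords κ F n} (hx : x ∈ D.domain n) {l : ℂ} {ψ : ℝ × F → ℂ}
    (hi : Integrable (fiberFun (ι := Fin n × κ) l ψ)) :
    Integrable (D.lastFactor l ψ x) ∧
      (∫ y, D.lastFactor l ψ x y = D.weight x * ∫ y, fiberFun (ι := Fin n × κ) l ψ y) ∧
      ∫ y, ‖D.lastFactor l ψ x y‖ = D.weight x * ∫ y, ‖fiberFun (ι := Fin n × κ) l ψ y‖ := by
  obtain ⟨Ψ, hΨ, hmap, h⟩ := D.exists_substitution hx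
  have hi' : Integrable (fiberFun (ι := Fin n × κ) l ψ) (Measure.map Ψ volume) := by
    rw [hmap]
    exact hi.smul_measure ENNReal.ofReal_ne_top
  rw [h]
  refine ⟨(integrable_map_measure hi'.1 hΨ.aemeasurable).1 hi', ?_, ?_⟩
  · rw [← integral_map hΨ.aemeasurable hi'.1, hmap, integral_smul_measure,
      ENNReal.toReal_ofReal (D.weight_nonneg hx), Complex.real_smul]
  · rw [← integral_map hΨ.aemeasurable hi'.1.norm, hmap, integral_smul_measure,
      ENNReal.toReal_ofReal (D.weight_nonneg hx), smul_eq_mul]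

/-! ### The recursion -/

theorem measurable_pivotProd (l : ℕ → ℂ) {ψ : ℕ → ℝ × F → ℂ} (hψ : ∀ k, Measurable (ψ k)) :
    ∀ n, Measurable (D.pivotProd n l ψ)
  | 0 => measurable_const
  | n + 1 => by
    have h : Measurable fun z : Coords κ F n × LastCoords κ F n =>
        D.pivotProd n l ψ z.1 * ((D.pivotT z.1 z.2 : ℂ) ^ l n * ψ n (D.pivotQ z.1 z.2)) :=
      ((measurable_pivotProd l hψ n).comp measurable_fst).mul
        (((Complex.measurable_ofReal.comp D.measurable_pivotT).pow_const _).mul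
          ((hψ n).comp D.measurable_pivotQ))
    exact h.comp (measurePreserving_splitLast n).measurable

omit [BorelSpace F] in
theorem measurableSet_domain [Nonempty κ] : ∀ n, MeasurableSet (D.domain (F := F) n)
  | 0 => by
    convert MeasurableSet.univ
    exact Set.eq_univ_of_forall fun x => posDef_of_isEmpty _
  | n + 1 => by
    have h : MeasurableSet {z : Coords κ F n × LastCoords κ F n |
        z.1 ∈ D.domain n ∧ 0 < D.pivotT z.1 z.2} :=
      (measurable_fst (measurableSet_domain n)).inter
        (measurableSet_lt measurable_const D.measurable_pivotT)
    convert (measurePreserving_splitLast n).measurable h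
    ext x
    exact D.mem_domain_succ

/-- By Fubini the integral over the last row and column is the weight times a constant, and the
weight is absorbed into the remaining pivots. The pivot with index k, counted from 0, is therefore
shifted once for each later row, n - 1 - k times in all. -/
theorem integral_pivotProd [Nonempty κ] : ∀ (n : ℕ) (l : ℕ → ℂ) (ψ : ℕ → ℝ × F → ℂ),
    (∀ k, Measurable (ψ k)) →
    (∀ k < n, Integrable (fiberFun (ι := Fin k × κ) (l k + (n - 1 - k : ℕ) * (Fintype.card κ / 2))
      fun q => D.absDet q ^ (n - 1 - k) * ψ k q)) →
    IntegrableOn (D.pivotProd n l ψ) (D.domain n) ∧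
    ∫ x in D.domain n, D.pivotProd n l ψ x = ∏ k ∈ Finset.range n, ∫ y,
      fiberFun (ι := Fin k × κ) (l k + (n - 1 - k : ℕ) * (Fintype.card κ / 2))
        (fun q => D.absDet q ^ (n - 1 - k) * ψ k q) y
  | 0, l, ψ, _, _ => by
    have h : D.domain (F := F) 0 = Set.univ :=
      Set.eq_univ_of_forall fun x => posDef_of_isEmpty _
    have hvol : (volume : Measure (Coords κ F 0)) Set.univ = 1 := by
      simp [Measure.volume_eq_prod, volume_pi, ← Set.univ_prod_univ]
    have : IsFiniteMeasure (volume : Measure (Coords κ F 0)) := ⟨by rw [hvol]; simp⟩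
    rw [h, IntegrableOn, Measure.restrict_univ]
    refine ⟨integrable_const (1 : ℂ), ?_⟩
    simp [pivotProd, Measure.real, hvol]
  | n + 1, l, ψ, hψ, hi => by
    set l' : ℕ → ℂ := fun k => l k + Fintype.card κ / 2 with hl'
    set ψ' : ℕ → ℝ × F → ℂ := fun k q => D.absDet q * ψ k q with hψ'
    have hψm' : ∀ k, Measurable (ψ' k) := fun k =>
      (Complex.measurable_ofReal.comp D.measurable_absDet).mul (hψ k)
    have hl : ∀ k < n, l k + ((n + 1 - 1 - k : ℕ) : ℂ) * (Fintype.card κ / 2) =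
        l' k + ((n - 1 - k : ℕ) : ℂ) * (Fintype.card κ / 2) := fun k hk => by
      have : n + 1 - 1 - k = (n - 1 - k) + 1 := by omega
      rw [this, hl']
      push_cast
      ring
    have hf : ∀ k < n, (fun q : ℝ × F => (D.absDet q : ℂ) ^ (n + 1 - 1 - k) * ψ k q) =
        fun q => (D.absDet q : ℂ) ^ (n - 1 - k) * ψ' k q := fun k hk => by
      have : n + 1 - 1 - k = (n - 1 - k) + 1 := by omega
      funext q
      rw [this, hψ', pow_succ, mul_assoc]
    obtain ⟨ih1, ih2⟩ := integral_pivotProd n l' ψ' hψm' fun k hk => by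
      rw [← hl k hk, ← hf k hk]
      exact hi k (by omega)
    have hin : Integrable (fiberFun (ι := Fin n × κ) (l n) (ψ n)) := by
      simpa using hi n (by omega)
    rw [Finset.prod_range_succ]
    have hprod : ∏ k ∈ Finset.range n, ∫ y, fiberFun (ι := Fin k × κ)
        (l k + (n + 1 - 1 - k : ℕ) * (Fintype.card κ / 2))
        (fun q => D.absDet q ^ (n + 1 - 1 - k) * ψ k q) y =
        ∫ x in D.domain n, D.pivotProd n l' ψ' x := by
      rw [ih2]
      refine Finset.prod_congr rfl fun k hk => ?_
      rw [hl k (Finset.mem_range.1 hk), hf k (Finset.mem_range.1 hk)]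
    have hlast : ∫ y, fiberFun (ι := Fin n × κ)
        (l n + (n + 1 - 1 - n : ℕ) * (Fintype.card κ / 2))
        (fun q => D.absDet q ^ (n + 1 - 1 - n) * ψ n q) y =
        ∫ y, fiberFun (ι := Fin n × κ) (l n) (ψ n) y := by
      simp
    rw [hprod, hlast]
    have hmp := measurePreserving_splitLast (κ := κ) (F := F) n
    have hdom := D.measurableSet_domain (F := F)
    -- The indicator of the wedge splits: the condition on the leading block is kept as an
    -- indicator, and positivity of the last pivot is built into `lastFactor`.
    let g : Coords κ F n × LastCoords κ F n → ℂ := fun z =>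
      (D.domain n).indicator (D.pivotProd n l ψ) z.1 * D.lastFactor (l n) (ψ n) z.1 z.2
    have hgm : Measurable g :=
      (((D.measurable_pivotProd l hψ n).indicator (hdom n)).comp measurable_fst).mul
        (D.measurable_lastFactor (l n) (hψ n))
    have hgeq : (D.domain (n + 1)).indicator (D.pivotProd (n + 1) l ψ) =
        fun x => g (splitLast x) := by
      funext x
      by_cases hx : (splitLast x).1 ∈ D.domain n
      · by_cases hp : 0 < D.pivotT (splitLast x).1 (splitLast x).2
        · rw [Set.indicator_of_mem (D.mem_domain_succ.2 ⟨hx, hp⟩)]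
          simp only [g, Set.indicator_of_mem hx, lastFactor, if_pos hp]
          rfl
        · rw [Set.indicator_of_notMem fun h => hp (D.mem_domain_succ.1 h).2]
          simp only [g, lastFactor, if_neg hp, mul_zero]
      · rw [Set.indicator_of_notMem fun h => hx (D.mem_domain_succ.1 h).1]
        simp only [g, Set.indicator_of_notMem hx, zero_mul]
    have hint : ∀ x, ∫ y, g (x, y) = (D.domain n).indicator (D.pivotProd n l' ψ') x *
        ∫ y, fiberFun (ι := Fin n × κ) (l n) (ψ n) y := fun x => by
      by_cases hx : x ∈ D.domain n
      · simp only [g, Set.indicator_of_mem hx]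
        rw [integral_const_mul, (D.integral_lastFactor hx hin).2.1,
          ← D.weight_mul_pivotProd l ψ hx]
        ring
      · simp [g, Set.indicator_of_notMem hx]
    have hnorm : ∀ x, ∫ y, ‖g (x, y)‖ = ‖(D.domain n).indicator (D.pivotProd n l' ψ') x‖ *
        ∫ y, ‖fiberFun (ι := Fin n × κ) (l n) (ψ n) y‖ := fun x => by
      by_cases hx : x ∈ D.domain n
      · simp only [g, Set.indicator_of_mem hx, norm_mul]
        rw [integral_const_mul, (D.integral_lastFactor hx hin).2.2,
          ← D.weight_mul_pivotProd l ψ hx, norm_mul, Complex.norm_real, Real.norm_eq_abs,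
          abs_of_nonneg (D.weight_nonneg hx)]
        ring
      · simp [g, Set.indicator_of_notMem hx]
    have i1 : SigmaFinite (volume : Measure F) := inferInstance
    have i2 : SigmaFinite (volume : Measure (Fin n → F)) := inferInstance
    have i3 : SigmaFinite (volume : Measure (OffDiag n → κ → ℝ)) := inferInstance
    have i4 : SigmaFinite (volume : Measure ((Fin n → ℝ) × (OffDiag n → κ → ℝ))) := inferInstance
    have i5 : SigmaFinite (volume : Measure ((Fin n → F) × (OffDiag n → κ → ℝ))) := inferInstance
    have i6 : SFinite (volume : Measure (Coords κ F n)) := inferInstance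
    have hgi : Integrable g (volume.prod volume) := by
      rw [integrable_prod_iff hgm.aestronglyMeasurable]
      refine ⟨Filter.Eventually.of_forall fun x => ?_, ?_⟩
      · by_cases hx : x ∈ D.domain n
        · simp only [g]
          exact (D.integral_lastFactor hx hin).1.const_mul _
        · simp [g, Set.indicator_of_notMem hx]
      · simp only [hnorm]
        exact ((integrable_indicator_iff (hdom n)).2 ih1).norm.mul_const _
    constructor
    · rw [← integrable_indicator_iff (hdom (n + 1)), hgeq]
      exact (hmp.integrable_comp hgm.aestronglyMeasurable).2 hgi
    · rw [← integral_indicator (hdom (n + 1)), hgeq,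
        ← integral_map hmp.measurable.aemeasurable (hgm.aestronglyMeasurable), hmp.map_eq,
        Measure.volume_eq_prod (Coords κ F n) (LastCoords κ F n), integral_prod g hgi]
      simp only [hint]
      rw [integral_mul_const, integral_indicator (hdom n)]

end CoordAlgebra

end

section

/-! ### Leading blocks and pivots -/

open Matrix

/-- The index set of a leading block of a left upper block. -/
def leadingEquiv {n j : ℕ} (hj : j ≤ n) :
    {i : Fin n // (i : ℕ) < j} ≃ {i : Fin (n + 1) // (i : ℕ) < j} where
  toFun i := ⟨i.1.castSucc, i.2⟩
  invFun i := ⟨⟨i.1, i.2.trans_le hj⟩, i.2⟩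
  left_inv _ := rfl
  right_inv _ := rfl

theorem leadingBlock_eq_reindex {K : Type*} {n j : ℕ} (hj : j ≤ n)
    (A : Matrix (Fin (n + 1)) (Fin (n + 1)) K) :
    leadingBlock A j =
      reindex (leadingEquiv hj) (leadingEquiv hj)
        (leadingBlock (CoordAlgebra.initBlock A) j) := rfl

theorem eq_reindex_leadingBlock {K : Type*} {n : ℕ} (A : Matrix (Fin n) (Fin n) K) :
    A = reindex (Equiv.subtypeUnivEquiv fun i : Fin n => i.2)
      (Equiv.subtypeUnivEquiv fun i : Fin n => i.2) (leadingBlock A n) := rfl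

/-- Where the fibre function is not set to zero, the real part at which ψ is evaluated is 1 plus
nonnegative terms, so values of ψ at r ≤ 0 are irrelevant. -/
theorem fiberFun_congr {ι F : Type*} [Fintype ι] (l : ℂ) {ψ ψ' : ℝ × F → ℂ}
    (h : ∀ r, 0 < r → ∀ s, ψ (r, s) = ψ' (r, s)) :
    fiberFun (ι := ι) l ψ = fiberFun l ψ' := by
  funext y
  have h1 : 0 ≤ y.1.1 ⬝ᵥ y.1.1 := by simpa using dotProduct_star_self_nonneg y.1.1
  have h2 : 0 ≤ y.1.2 ⬝ᵥ y.1.2 := by simpa using dotProduct_star_self_nonneg y.1.2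
  by_cases hy : 0 < y.2.1
  · rw [fiberFun, fiberFun, if_pos hy, if_pos hy, h _ (by linarith)]
  · rw [fiberFun, fiberFun, if_neg hy, if_neg hy]

variable {K κ F : Type*} [Ring K] [StarRing K] [Algebra ℝ K] [Fintype κ] [DecidableEq κ]
  [NormedAddCommGroup F] [NormedSpace ℝ F]

/-- A logarithm of the determinant over `K` and its increments along the leading blocks. -/
structure LogPivot [MeasurableSpace F] (D : CoordAlgebra K κ F) where
  logDet : ∀ {ι : Type} [Fintype ι] [DecidableEq ι], Matrix ι ι K → ℂ
  logDet_reindex : ∀ {ι ι' : Type} [Fintype ι] [DecidableEq ι] [Fintype ι'] [DecidableEq ι']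
    (e : ι ≃ ι') (R : Matrix ι ι K), logDet (reindex e e R) = logDet R
  logDet_zero : ∀ R : Matrix (Fin 0) (Fin 0) K, logDet R = 0
  log : ℝ × F → ℂ
  measurable_log : Measurable log
  log_smul : ∀ c : ℝ, 0 < c → ∀ r : ℝ, 0 < r → ∀ s,
    log (c * r, c • s) = Real.log c + log (r, s)
  absDet_eq : ∀ r : ℝ, 0 < r → ∀ s,
    D.absDet (r, s) = Real.exp (Fintype.card κ * (log (r, s)).re)
  logDet_herm : ∀ {n : ℕ} {x : Coords κ F (n + 1)}, x ∈ D.domain (n + 1) →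
    logDet (D.herm x) = logDet (D.herm (splitLast x).1) +
      Real.log (D.pivotT (splitLast x).1 (splitLast x).2)
  logDet_one_add : ∀ {n : ℕ} {x : Coords κ F (n + 1)}, x ∈ D.domain (n + 1) →
    logDet (1 + D.herm x + D.skew x) =
      logDet (1 + D.herm (splitLast x).1 + D.skew (splitLast x).1) +
        log (D.pivotQ (splitLast x).1 (splitLast x).2)

/-! ### Powers of pivots and telescoping of the integrand. -/

namespace LogPivot

/-- The function `q^{-σ} (conj q)^{-τ}`. -/
def pivotPow [MeasurableSpace F] {D : CoordAlgebra K κ F} (P : LogPivot D) (σ τ : ℂ)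
    (q : ℝ × F) : ℂ :=
  Complex.exp (-σ * P.log q) * Complex.exp (-τ * star (P.log q))

section

variable [MeasurableSpace F] {D : CoordAlgebra K κ F} (P : LogPivot D)

theorem measurable_pivotPow (σ τ : ℂ) : Measurable (P.pivotPow σ τ) := by
  have h := P.measurable_log
  have h2 : Measurable fun q => star (P.log q) := Complex.continuous_conj.measurable.comp h
  exact (Complex.measurable_exp.comp (measurable_const.mul h)).mul
    (Complex.measurable_exp.comp (measurable_const.mul h2))

theorem isHomogeneous_pivotPow (σ τ : ℂ) : IsHomogeneous (P.pivotPow σ τ) (σ + τ) := by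
  intro c hc r hr s
  rw [pivotPow, P.log_smul c hc r hr, pivotPow, Complex.cpow_def_of_ne_zero
    (Complex.ofReal_ne_zero.2 hc.ne'), ← Complex.ofReal_log hc.le, star_add, ← Complex.exp_add,
    ← Complex.exp_add, ← Complex.exp_add]
  congr 1
  simp only [RCLike.star_def, Complex.conj_ofReal]
  ring

/-- With d = |κ|, `absDet` is exp(d · Re log q), that is, the product of the d/2-th powers of q and
of its conjugate; a power of it lowers both exponents equally. -/
theorem absDet_pow_mul_pivotPow (j : ℕ) (σ τ : ℂ) {r : ℝ} (hr : 0 < r) (s : F) :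
    (D.absDet (r, s) : ℂ) ^ j * P.pivotPow σ τ (r, s) =
      P.pivotPow (σ - j * (Fintype.card κ / 2)) (τ - j * (Fintype.card κ / 2)) (r, s) := by
  have h : ((P.log (r, s)).re : ℂ) = (P.log (r, s) + star (P.log (r, s))) / 2 := by
    rw [RCLike.star_def, Complex.add_conj]
    push_cast
    ring
  rw [P.absDet_eq r hr, Complex.ofReal_exp, ← Complex.exp_nat_mul, pivotPow, pivotPow,
    ← Complex.exp_add, ← Complex.exp_add, ← Complex.exp_add]
  push_cast
  rw [h]
  congr 1
  ring

/-- Abel summation: the logarithm for the j-th leading block is the sum over the first j pivots, so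
the differences λ_j - λ_{j+1} telescope. The boundary factor with index n + 1 is needed because
those parameters need not vanish at intermediate stages of the induction; μ carries the extra power
of det T. -/
theorem prod_leadingBlock_eq_pivotProd [Nonempty κ] (μ : ℂ) (lam sig tau : ℕ → ℂ) :
    ∀ {n : ℕ} {x : Coords κ F n}, x ∈ D.domain n →
    (∏ j ∈ Finset.Icc 1 n,
      Complex.exp ((lam j - lam (j + 1)) * P.logDet (leadingBlock (D.herm x) j)) /
        (Complex.exp ((sig j - sig (j + 1)) *
            P.logDet (leadingBlock (1 + D.herm x + D.skew x) j)) *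
          Complex.exp ((tau j - tau (j + 1)) *
            star (P.logDet (leadingBlock (1 + D.herm x + D.skew x) j))))) *
      (Complex.exp ((lam (n + 1) + μ) * P.logDet (D.herm x)) /
        (Complex.exp (sig (n + 1) * P.logDet (1 + D.herm x + D.skew x)) *
          Complex.exp (tau (n + 1) * star (P.logDet (1 + D.herm x + D.skew x))))) =
    D.pivotProd n (fun k => lam (k + 1) + μ)
      (fun k => P.pivotPow (sig (k + 1)) (tau (k + 1))) x
  | 0, x, _ => by simp [P.logDet_zero, CoordAlgebra.pivotProd]
  | n + 1, x, hx => by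
    obtain ⟨hx', hp⟩ := D.mem_domain_succ.1 hx
    have ih := prod_leadingBlock_eq_pivotProd μ lam sig tau hx'
    have hT := P.logDet_herm hx
    have hQ := P.logDet_one_add hx
    have hlead : ∀ (A : Matrix (Fin (n + 1)) (Fin (n + 1)) K) (j : ℕ), j ≤ n →
        P.logDet (leadingBlock A j) = P.logDet (leadingBlock (CoordAlgebra.initBlock A) j) :=
      fun A j hj => by rw [leadingBlock_eq_reindex hj, P.logDet_reindex]
    have hfull : ∀ A : Matrix (Fin (n + 1)) (Fin (n + 1)) K,
        P.logDet (leadingBlock A (n + 1)) = P.logDet A := fun A => by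
      conv_rhs => rw [eq_reindex_leadingBlock A, P.logDet_reindex]
    rw [CoordAlgebra.pivotProd, ← ih, Finset.prod_Icc_succ_top (by omega), hfull, hfull]
    have hprod : ∀ j ∈ Finset.Icc 1 n,
        Complex.exp ((lam j - lam (j + 1)) * P.logDet (leadingBlock (D.herm x) j)) /
        (Complex.exp ((sig j - sig (j + 1)) *
            P.logDet (leadingBlock (1 + D.herm x + D.skew x) j)) *
          Complex.exp ((tau j - tau (j + 1)) *
            star (P.logDet (leadingBlock (1 + D.herm x + D.skew x) j)))) =
        Complex.exp ((lam j - lam (j + 1)) *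
          P.logDet (leadingBlock (D.herm (splitLast x).1) j)) /
        (Complex.exp ((sig j - sig (j + 1)) *
            P.logDet (leadingBlock (1 + D.herm (splitLast x).1 + D.skew (splitLast x).1) j)) *
          Complex.exp ((tau j - tau (j + 1)) *
            star (P.logDet
              (leadingBlock (1 + D.herm (splitLast x).1 + D.skew (splitLast x).1) j)))) :=
      fun j hj => by
        have hj' := (Finset.mem_Icc.1 hj).2
        rw [hlead _ j hj', hlead _ j hj', D.initBlock_herm, D.initBlock_one_add]
    rw [Finset.prod_congr rfl hprod, mul_assoc, mul_assoc]
    congr 1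
    rw [hT, hQ, pivotPow, Complex.cpow_def_of_ne_zero (Complex.ofReal_ne_zero.2 hp.ne'),
      ← Complex.ofReal_log hp.le]
    simp only [← Complex.exp_add, ← Complex.exp_sub]
    congr 1
    rw [star_add]
    ring

end

variable [FiniteDimensional ℝ F] [MeasureSpace F] [BorelSpace F]
  [Measure.IsAddHaarMeasure (volume : Measure F)] {D : CoordAlgebra K κ F} (P : LogPivot D)

-- The recursion combined with the fibre integral. After the shifts, the k-th power of the pivot is
-- homogeneous of degree -(σ_k + τ_k - (n - 1 - k)|κ|).
open Module in
theorem integral_pivotProd [Nonempty κ] (n : ℕ) (l sig tau : ℕ → ℂ)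
    (hl : ∀ k < n, 0 < (l k + (n - 1 - k : ℕ) * (Fintype.card κ / 2) + 1).re)
    (hs : ∀ k < n, 0 < (sig k + tau k - (n - 1 - k : ℕ) * Fintype.card κ - finrank ℝ F -
      (l k + (n - 1 - k : ℕ) * (Fintype.card κ / 2) + 1 + k * Fintype.card κ)).re)
    (hi : ∀ k < n, Integrable fun s => P.pivotPow
      (sig k - (n - 1 - k : ℕ) * (Fintype.card κ / 2))
      (tau k - (n - 1 - k : ℕ) * (Fintype.card κ / 2)) (1, s)) :
    IntegrableOn (D.pivotProd n l fun k => P.pivotPow (sig k) (tau k)) (D.domain n) ∧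
    ∫ x in D.domain n, D.pivotProd n l (fun k => P.pivotPow (sig k) (tau k)) x =
      ∏ k ∈ Finset.range n,
        (∫ s, P.pivotPow (sig k - (n - 1 - k : ℕ) * (Fintype.card κ / 2))
          (tau k - (n - 1 - k : ℕ) * (Fintype.card κ / 2)) (1, s)) *
        (Complex.Gamma (l k + (n - 1 - k : ℕ) * (Fintype.card κ / 2) + 1) *
          (Real.pi : ℂ) ^ (k * Fintype.card κ) *
          Complex.Gamma (sig k + tau k - (n - 1 - k : ℕ) * Fintype.card κ - finrank ℝ F -
            (l k + (n - 1 - k : ℕ) * (Fintype.card κ / 2) + 1 + k * Fintype.card κ)) /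
          Complex.Gamma (sig k + tau k - (n - 1 - k : ℕ) * Fintype.card κ - finrank ℝ F)) := by
  have hcongr : ∀ k, fiberFun (ι := Fin k × κ) (l k + (n - 1 - k : ℕ) * (Fintype.card κ / 2))
      (fun q => D.absDet q ^ (n - 1 - k) * P.pivotPow (sig k) (tau k) q) =
      fiberFun (l k + (n - 1 - k : ℕ) * (Fintype.card κ / 2)) (P.pivotPow
        (sig k - (n - 1 - k : ℕ) * (Fintype.card κ / 2))
        (tau k - (n - 1 - k : ℕ) * (Fintype.card κ / 2))) := fun k =>
    fiberFun_congr _ fun r hr s => P.absDet_pow_mul_pivotPow _ _ _ hr s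
  have hdeg : ∀ k, sig k - (n - 1 - k : ℕ) * ((Fintype.card κ : ℂ) / 2) +
      (tau k - (n - 1 - k : ℕ) * (Fintype.card κ / 2)) =
      sig k + tau k - (n - 1 - k : ℕ) * Fintype.card κ := fun k => by ring
  have hcard : ∀ k, ((Fintype.card (Fin k × κ) : ℕ) : ℂ) = k * Fintype.card κ := fun k => by
    simp
  have hfib := fun k (hk : k < n) => integral_fiberFun (ι := Fin k × κ)
    (l := l k + (n - 1 - k : ℕ) * (Fintype.card κ / 2)) (P.measurable_pivotPow
        (sig k - (n - 1 - k : ℕ) * (Fintype.card κ / 2))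
        (tau k - (n - 1 - k : ℕ) * (Fintype.card κ / 2))) (P.isHomogeneous_pivotPow _ _) (hi k hk)
      (hl k hk) (by rw [hdeg, hcard]; exact hs k hk)
  have hmain := D.integral_pivotProd n l (fun k => P.pivotPow (sig k) (tau k))
    (fun k => P.measurable_pivotPow _ _) fun k hk => by
      rw [hcongr]
      exact (hfib k hk).1
  refine ⟨hmain.1, hmain.2.trans (Finset.prod_congr rfl fun k hk => ?_)⟩
  rw [hcongr, (hfib k (Finset.mem_range.1 hk)).2, hdeg, hcard, Fintype.card_prod, Fintype.card_fin]

omit [BorelSpace F] in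
theorem integral_comp [Nonempty κ] {X : Type*} [MeasureSpace X] {n : ℕ} {g : X → Coords κ F n}
    (hg : MeasurePreserving g) {s : Set X} (hs : ∀ x, x ∈ s ↔ g x ∈ D.domain n) {f : X → ℂ}
    {h : Coords κ F n → ℂ} (hf : ∀ x ∈ s, f x = h (g x)) (hi : IntegrableOn h (D.domain n)) :
    IntegrableOn f s ∧ ∫ x in s, f x = ∫ y in D.domain n, h y := by
  have hsm := D.measurableSet_domain (F := F) n
  obtain rfl : s = g ⁻¹' D.domain n := Set.ext hs
  have hr := hg.restrict_preimage hsm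
  have hm := hg.measurable hsm
  constructor
  · rw [integrableOn_congr_fun hf hm]
    exact (hr.integrable_comp hi.1).2 hi
  · rw [setIntegral_congr_fun hm hf, ← hr.map_eq, integral_map hr.measurable.aemeasurable]
    rw [hr.map_eq]
    exact hi.1

end LogPivot

end

section

/-! ### The logarithm of the determinant of the real matrix -/

open Matrix

theorem posDef_diagonal_const {κ : Type*} [Fintype κ] [DecidableEq κ] {r : ℝ} (hr : 0 < r) :
    (diagonal fun _ : κ => r).PosDef := PosDef.diagonal fun _ => hr

namespace CoordAlgebra

section

variable {K κ F : Type*} [Ring K] [StarRing K] [Algebra ℝ K] [Fintype κ] [DecidableEq κ]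
  [AddCommGroup F] [Module ℝ F] (D : CoordAlgebra K κ F)

theorem det_lmul_ofReIm_pos {r : ℝ} (hr : 0 < r) (s : F) :
    0 < (D.lmul (D.ofReIm (r, s))).det := by
  refine det_pos_of_posDef_add_transpose ?_
  have h : D.ofReIm (r, s) + star (D.ofReIm (r, s)) = algebraMap ℝ K (r + r) := by
    rw [ofReIm, star_add, D.star_algebraMap, D.star_ofIm, map_add]
    abel
  rw [← D.lmul_star, ← map_add, h, AlgHom.commutes, algebraMap_eq_diagonal]
  exact posDef_diagonal_const (add_pos hr hr)

theorem det_lmul_ofReIm_smul (c r : ℝ) (s : F) :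
    (D.lmul (D.ofReIm (c * r, c • s))).det =
      c ^ Fintype.card κ * (D.lmul (D.ofReIm (r, s))).det := by
  have h : D.ofReIm (c * r, c • s) = c • D.ofReIm (r, s) := by
    rw [ofReIm, ofReIm, map_mul, map_smul, smul_add, Algebra.smul_def c (algebraMap ℝ K r)]
  rw [h, map_smul, det_smul]

/-- In real coordinates the quadratic form of the real matrix of T is the real part of w*Tw;
surjectivity of the coordinates ensures that every w over K is tested. -/
theorem mem_domain_iff (hs : Function.Surjective D.coord) {n : ℕ} (x : Coords κ F n) :
    x ∈ D.domain n ↔ ∀ w : Fin n → K, w ≠ 0 → 0 < D.re (star w ⬝ᵥ D.herm x *ᵥ w) := by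
  have h0 : ∀ v : Fin n × κ → ℝ, D.ofCoords v = 0 ↔ v = 0 := fun v => by
    constructor
    · intro h
      have h1 := D.re_star_ofCoords_dotProduct v v
      rw [h, dotProduct_zero, map_zero] at h1
      exact dotProduct_self_eq_zero.1 h1.symm
    · rintro rfl
      exact funext fun _ => map_zero D.coord
  have hq : ∀ v : Fin n × κ → ℝ,
      D.re (star (D.ofCoords v) ⬝ᵥ D.herm x *ᵥ D.ofCoords v) = v ⬝ᵥ D.realT x *ᵥ v := fun v => by
    rw [D.mulVec_ofCoords, D.re_star_ofCoords_dotProduct, realT]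
  constructor
  · intro h w hw
    choose f hf using hs
    have hv : D.ofCoords (fun p => f (w p.1) p.2) = w := funext fun i => hf (w i)
    have := h.dotProduct_mulVec_pos (x := fun p => f (w p.1) p.2)
      fun h1 => hw (hv.symm.trans ((h0 _).2 h1))
    rw [← hv, hq]
    simpa using this
  · intro h
    refine PosDef.of_dotProduct_mulVec_pos ?_ fun v hv => ?_
    · rw [IsHermitian, conjTranspose_eq_transpose_of_trivial, D.realT_transpose]
    · have := h (D.ofCoords v) fun h1 => hv ((h0 _).1 h1)
      rw [hq] at this
      simpa using this

end

variable {K κ F : Type*} [Ring K] [StarRing K] [Algebra ℝ K] [Fintype κ] [DecidableEq κ]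
  [NormedAddCommGroup F] [NormedSpace ℝ F] [FiniteDimensional ℝ F] [MeasurableSpace F]
  [BorelSpace F] (D : CoordAlgebra K κ F)

/-- The logarithm of the determinant of the real matrix. -/
def realLogPivot [Nonempty κ] : LogPivot D where
  -- Division by |κ| normalises the logarithm so that a real pivot p contributes log p rather than
  -- |κ| log p.
  logDet R := logDet ((D.realify R).map Complex.ofReal) / Fintype.card κ
  logDet_reindex {ι ι'} _ _ _ _ e R := by
    have h : (D.realify (reindex e e R)).map Complex.ofReal =
      reindex (e.prodCongr (Equiv.refl κ)) (e.prodCongr (Equiv.refl κ))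
        ((D.realify R).map Complex.ofReal) := rfl
    rw [h, DissipativeWedge.logDet_reindex]
  logDet_zero R := by
    rw [logDet_map_ofReal (posDef_of_isEmpty _), det_isEmpty]
    simp
  log q := ((Real.log (D.absDet q) / Fintype.card κ : ℝ) : ℂ)
  measurable_log := Complex.measurable_ofReal.comp
    ((Real.measurable_log.comp D.measurable_absDet).div_const _)
  log_smul c hc r hr s := by
    have h := D.det_lmul_ofReIm_pos hr s
    have hd : (Fintype.card κ : ℝ) ≠ 0 := by exact_mod_cast Fintype.card_ne_zero
    rw [absDet, absDet, Real.log_abs, Real.log_abs, D.det_lmul_ofReIm_smul,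
      Real.log_mul (pow_ne_zero _ hc.ne') h.ne', Real.log_pow, ← Complex.ofReal_add]
    congr 1
    field_simp
  absDet_eq r hr s := by
    have h := D.det_lmul_ofReIm_pos hr s
    have hd : (Fintype.card κ : ℝ) ≠ 0 := by exact_mod_cast Fintype.card_ne_zero
    rw [Complex.ofReal_re, mul_div_cancel₀ _ hd, absDet, Real.exp_log (abs_pos.2 h.ne')]
  logDet_herm {n x} hx := by
    obtain ⟨hx', hp⟩ := D.mem_domain_succ.1 hx
    have hd : (Fintype.card κ : ℂ) ≠ 0 := by exact_mod_cast Fintype.card_ne_zero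
    have h : ∀ {n : ℕ} {x : Coords κ F n}, x ∈ D.domain n →
        logDet ((D.realify (D.herm x)).map Complex.ofReal) = Real.log (D.realT x).det :=
      fun {n x} hx => logDet_map_ofReal (M := D.realT x) (by
        rw [D.realT_transpose]
        exact hx.add hx)
    rw [h hx, h hx', D.det_realT_succ hx', Real.log_mul hx'.det_pos.ne' (pow_ne_zero _ hp.ne'),
      Real.log_pow]
    push_cast
    field_simp
  logDet_one_add {n x} hx := by
    obtain ⟨hx', hp⟩ := D.mem_domain_succ.1 hx
    have h : ∀ {n : ℕ} {x : Coords κ F n}, x ∈ D.domain n →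
        logDet ((D.realify (1 + D.herm x + D.skew x)).map Complex.ofReal) =
          Real.log (D.realQ x).det :=
      fun {n x} hx => logDet_map_ofReal (D.posDef_realQ_add_transpose hx)
    have h0 := (D.det_realQ_pos hx').ne'
    have h1 := D.det_realQ_succ hx'
    have h2 := (D.det_realQ_pos hx).ne'
    rw [h1] at h2
    rw [h hx, h hx', h1, Real.log_mul h0 (right_ne_zero_of_mul h2), absDet, Real.log_abs]
    push_cast
    ring

end CoordAlgebra

end

section

/-! ### The algebras `ℝ`, `ℂ` and `ℍ` -/

open Matrix

/-- Real coordinates on `ℝ`. -/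
def realAlgebra : CoordAlgebra ℝ Unit (Fin 0 → ℝ) where
  coord := LinearMap.proj ()
  lmul := Algebra.ofId ℝ (Matrix Unit Unit ℝ)
  coord_lmul x v := by simp [Algebra.ofId_apply, algebraMap_eq_diagonal, mulVec_diagonal]
  lmul_star x := by simp [Algebra.ofId_apply, algebraMap_eq_diagonal]
  re := LinearMap.id
  im := 0
  ofIm := 0
  re_star_mul v w := by simp [dotProduct]
  re_add_im x := by simp
  im_ofIm s := Subsingleton.elim _ _
  star_algebraMap r := rfl
  star_ofIm s := by simp

/-- Real coordinates on `ℂ`. -/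
def complexAlgebra : CoordAlgebra ℂ (Fin 2) ℝ where
  coord :=
    { toFun := fun v => ⟨v 0, v 1⟩
      map_add' := fun _ _ => rfl
      map_smul' := fun r v => by apply Complex.ext <;> simp }
  lmul := Algebra.leftMulMatrix Complex.basisOneI
  coord_lmul x v := by
    apply Complex.ext <;> simp [Algebra.leftMulMatrix_complex, dotProduct, Fin.sum_univ_two]
    · ring
    · ring
  lmul_star x := by
    ext i j
    fin_cases i <;> fin_cases j <;> simp [Algebra.leftMulMatrix_complex]
  re := Complex.reLm
  im := Complex.imLm
  ofIm := LinearMap.toSpanSingleton ℝ ℂ Complex.I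
  re_star_mul v w := by simp [dotProduct, Fin.sum_univ_two]
  re_add_im x := by simp
  im_ofIm s := by simp
  star_algebraMap r := by simp
  star_ofIm s := by simp

section QuatCoordinates

@[simp] theorem quatOf_re (v : Fin 4 → ℝ) : (quatOf v).re = v 0 := rfl
@[simp] theorem quatOf_imI (v : Fin 4 → ℝ) : (quatOf v).imI = v 1 := rfl
@[simp] theorem quatOf_imJ (v : Fin 4 → ℝ) : (quatOf v).imJ = v 2 := rfl
@[simp] theorem quatOf_imK (v : Fin 4 → ℝ) : (quatOf v).imK = v 3 := rfl
@[simp] theorem quatImOf_re (v : Fin 3 → ℝ) : (quatImOf v).re = 0 := rfl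
@[simp] theorem quatImOf_imI (v : Fin 3 → ℝ) : (quatImOf v).imI = v 0 := rfl
@[simp] theorem quatImOf_imJ (v : Fin 3 → ℝ) : (quatImOf v).imJ = v 1 := rfl
@[simp] theorem quatImOf_imK (v : Fin 3 → ℝ) : (quatImOf v).imK = v 2 := rfl

/-- The left multiplications as an algebra homomorphism. -/
def quatLeftMulHom : ℍ[ℝ] →ₐ[ℝ] Matrix (Fin 4) (Fin 4) ℝ := AlgHom.ofLinearMap
  { toFun := quatLeftMul
    map_add' := fun x y => by
      ext i j
      fin_cases i <;> fin_cases j <;> simp [quatLeftMul] <;> ring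
    map_smul' := fun r x => by
      ext i j
      fin_cases i <;> fin_cases j <;> simp [quatLeftMul] }
  (by
    ext i j
    fin_cases i <;> fin_cases j <;> simp [quatLeftMul])
  fun x y => by
    ext i j
    fin_cases i <;> fin_cases j <;>
      simp [quatLeftMul, mul_apply, Fin.sum_univ_four] <;> ring

theorem quatLeftMulHom_apply (x : ℍ[ℝ]) : quatLeftMulHom x = quatLeftMul x := rfl

theorem quatOf_quatLeftMul_mulVec (x : ℍ[ℝ]) (v : Fin 4 → ℝ) :
    quatOf (quatLeftMul x *ᵥ v) = x * quatOf v := by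
  ext <;> simp [quatLeftMul, vecHead, vecTail] <;> ring

/-- Real coordinates on `ℍ`. -/
def quatAlgebra : CoordAlgebra ℍ[ℝ] (Fin 4) (Fin 3 → ℝ) where
  coord :=
    { toFun := quatOf
      map_add' := fun _ _ => rfl
      map_smul' := fun r v => by ext <;> simp }
  lmul := quatLeftMulHom
  coord_lmul := quatOf_quatLeftMul_mulVec
  lmul_star x := by
    ext i j
    fin_cases i <;> fin_cases j <;> simp [quatLeftMulHom_apply, quatLeftMul]
  re :=
    { toFun := fun x => x.re
      map_add' := fun _ _ => rfl
      map_smul' := fun _ _ => rfl }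
  im :=
    { toFun := fun x => ![x.imI, x.imJ, x.imK]
      map_add' := fun x y => by simp
      map_smul' := fun r x => by simp }
  ofIm :=
    { toFun := quatImOf
      map_add' := fun x y => by ext <;> simp
      map_smul' := fun r x => by ext <;> simp }
  re_star_mul v w := by
    change (star (quatOf v) * quatOf w).re = v ⬝ᵥ w
    simp [dotProduct, Fin.sum_univ_four]
  re_add_im x := by
    change (x.re : ℍ[ℝ]) + quatImOf ![x.imI, x.imJ, x.imK] = x
    ext <;> simp
  im_ofIm s := by
    funext i
    fin_cases i <;> rfl
  star_algebraMap r := by ext <;> simp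
  star_ofIm s := by
    change star (quatImOf s) = -quatImOf s
    ext <;> simp

end QuatCoordinates

theorem surjective_coord_realAlgebra : Function.Surjective realAlgebra.coord :=
  fun x => ⟨fun _ => x, rfl⟩

theorem surjective_coord_complexAlgebra : Function.Surjective complexAlgebra.coord :=
  fun x => ⟨![x.re, x.im], rfl⟩

theorem surjective_coord_quatAlgebra : Function.Surjective quatAlgebra.coord :=
  fun x => ⟨![x.re, x.imI, x.imJ, x.imK], rfl⟩

/-! ### Coordinates -/

/-- The coordinates for `ℝ`. -/
def realCoords {n : ℕ} (x : RealCoords n) : Coords Unit (Fin 0 → ℝ) n :=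
  ((x.1.1, fun p _ => x.1.2 p), (fun _ => 0, fun p _ => x.2 p))

/-- The coordinates for `ℂ`. -/
def complexCoords {n : ℕ} (x : ComplexCoords n) : Coords (Fin 2) ℝ n :=
  ((x.1.1, fun p => ![(x.1.2 p).re, (x.1.2 p).im]),
    (x.2.1, fun p => ![(x.2.2 p).re, (x.2.2 p).im]))

/-- Over ℝ there are no imaginary directions: the diagonal of S lives in a one-point space of mass
1, so adjoining it does not change the measure. -/
theorem measurePreserving_realCoords (n : ℕ) : MeasurePreserving (realCoords (n := n)) := by
  have h1 : MeasurePreserving fun (a : OffDiag n → ℝ) p (_ : Unit) => a p :=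
    volume_preserving_pi fun _ => (volume_preserving_funUnique Unit ℝ).symm
  have h2 : (volume : Measure (Fin n → Fin 0 → ℝ)) = Measure.dirac fun _ => 0 := by
    have : IsProbabilityMeasure (volume : Measure (Fin 0 → ℝ)) :=
      ⟨by rw [Measure.volume_pi_eq_dirac]; simp⟩
    have h3 : IsProbabilityMeasure (volume : Measure (Fin n → Fin 0 → ℝ)) := by
      rw [volume_pi]; infer_instance
    ext s _
    rcases s.eq_empty_or_nonempty with rfl | ⟨y, hy⟩
    · simp
    · have : s = Set.univ := Set.eq_univ_of_forall fun z => by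
        convert hy
      rw [this, measure_univ, measure_univ]
  have h4 : MeasurePreserving fun b : OffDiag n → ℝ =>
      ((fun _ => 0, fun p _ => b p) : (Fin n → Fin 0 → ℝ) × (OffDiag n → Unit → ℝ)) := by
    refine ⟨by fun_prop, ?_⟩
    rw [Measure.volume_eq_prod, h2, Measure.dirac_prod, ← h1.map_eq, Measure.map_map
      (by fun_prop) h1.measurable]
    rfl
  exact ((MeasurePreserving.id volume).prod h1).prod h4

theorem measurePreserving_complexCoords (n : ℕ) :
    MeasurePreserving (complexCoords (n := n)) := by
  have h1 : MeasurePreserving fun (a : OffDiag n → ℂ) p => ![(a p).re, (a p).im] :=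
    volume_preserving_pi fun _ => Complex.volume_preserving_equiv_pi
  exact ((MeasurePreserving.id volume).prod h1).prod ((MeasurePreserving.id volume).prod h1)

theorem herm_realCoords {n : ℕ} (x : RealCoords n) :
    realAlgebra.herm (realCoords x) = realT x := rfl

theorem skew_realCoords {n : ℕ} (x : RealCoords n) :
    realAlgebra.skew (realCoords x) = realS x := rfl

theorem herm_complexCoords {n : ℕ} (x : ComplexCoords n) :
    complexAlgebra.herm (complexCoords x) = complexT x := rfl

theorem skew_complexCoords {n : ℕ} (x : ComplexCoords n) :
    complexAlgebra.skew (complexCoords x) = complexS x := by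
  have h : ∀ i, complexAlgebra.ofIm ((complexCoords x).2.1 i) = (x.2.1 i : ℂ) * Complex.I :=
    fun i => LinearMap.toSpanSingleton_apply ..
  simp only [CoordAlgebra.skew, complexS, h]
  rfl

theorem herm_quat {n : ℕ} (x : QuatCoords n) : quatAlgebra.herm x = quatT x := rfl

theorem skew_quat {n : ℕ} (x : QuatCoords n) : quatAlgebra.skew x = quatS x := rfl

/-! ### The wedges -/

namespace CoordAlgebra

variable {K κ F : Type*} [Ring K] [StarRing K] [Algebra ℝ K] [Fintype κ] [DecidableEq κ]
  [AddCommGroup F] [Module ℝ F] (D : CoordAlgebra K κ F) {n : ℕ}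

theorem add_conjTranspose_eq (x : Coords κ F n) :
    D.herm x + D.skew x + (D.herm x + D.skew x)ᴴ = D.herm x + D.herm x := by
  rw [conjTranspose_add, herm_conjTranspose, skew_conjTranspose]
  abel

theorem re_herm_add_herm_pos (x : Coords κ F n) (w : Fin n → K) :
    0 < D.re (star w ⬝ᵥ (D.herm x + D.herm x) *ᵥ w) ↔ 0 < D.re (star w ⬝ᵥ D.herm x *ᵥ w) := by
  rw [add_mulVec, dotProduct_add, map_add]
  exact ⟨fun h => by linarith, fun h => by linarith⟩

end CoordAlgebra

theorem mem_realDomain_iff {n : ℕ} (x : RealCoords n) :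
    x ∈ realDomain n ↔ realCoords x ∈ realAlgebra.domain n := by
  rw [realAlgebra.mem_domain_iff surjective_coord_realAlgebra, realDomain, Set.mem_ofPred_eq,
    realWedge, Set.mem_ofPred_eq, ← herm_realCoords, ← skew_realCoords,
    realAlgebra.add_conjTranspose_eq, posDef_iff_dotProduct_mulVec]
  simp only [← realAlgebra.re_herm_add_herm_pos]
  refine ⟨fun h w hw => h.2 hw, fun h => ⟨?_, fun w hw => h w hw⟩⟩
  rw [IsHermitian, conjTranspose_add, realAlgebra.herm_conjTranspose]

open scoped ComplexOrder in
theorem mem_complexDomain_iff {n : ℕ} (x : ComplexCoords n) :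
    x ∈ complexDomain n ↔ complexCoords x ∈ complexAlgebra.domain n := by
  have hh : (complexAlgebra.herm (complexCoords x) +
      complexAlgebra.herm (complexCoords x)).IsHermitian := by
    rw [IsHermitian, conjTranspose_add, complexAlgebra.herm_conjTranspose]
  rw [complexAlgebra.mem_domain_iff surjective_coord_complexAlgebra, complexDomain,
    Set.mem_ofPred_eq, complexWedge, Set.mem_ofPred_eq, ← herm_complexCoords, ← skew_complexCoords,
    complexAlgebra.add_conjTranspose_eq, posDef_iff_dotProduct_mulVec]
  simp only [← complexAlgebra.re_herm_add_herm_pos]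
  refine ⟨fun h w hw => (Complex.pos_iff.1 (h.2 hw)).1, fun h => ⟨hh, fun w hw => ?_⟩⟩
  exact Complex.pos_iff.2 ⟨h w hw, (hh.im_star_dotProduct_mulVec_self w).symm⟩

theorem mem_quatDomain_iff {n : ℕ} (x : QuatCoords n) :
    x ∈ quatDomain n ↔ x ∈ quatAlgebra.domain n := by
  have hh : (quatAlgebra.herm x + quatAlgebra.herm x).IsHermitian := by
    rw [IsHermitian, conjTranspose_add, quatAlgebra.herm_conjTranspose]
  rw [quatAlgebra.mem_domain_iff surjective_coord_quatAlgebra, quatDomain,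
    Set.mem_ofPred_eq, quatWedge, Set.mem_ofPred_eq, ← herm_quat, ← skew_quat,
    quatAlgebra.add_conjTranspose_eq, QuatPosDef]
  simp only [← quatAlgebra.re_herm_add_herm_pos]
  refine ⟨fun h w hw => ?_, fun h => ⟨hh, fun q hq => ?_⟩⟩
  -- Positivity over ℍ is stated with rows, q A q*; the column w corresponds to the row q = w*.
  · have := h.2 (star w) (by simpa using hw)
    rwa [star_star] at this
  · have := h (star q) (by simpa using hq)
    rwa [star_star] at this

end

section

/-! ### The logarithm of the determinant over `ℂ` -/

open Matrix

/-- The last index as a block of size one. -/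
def lastEquiv (n : ℕ) : Fin n ⊕ Unit ≃ Fin (n + 1) :=
  (Equiv.sumCongr (Equiv.prodPUnit (Fin n)).symm (Equiv.refl Unit)).trans
    ((CoordAlgebra.blockEquiv n Unit).trans (Equiv.prodPUnit _))

theorem submatrix_lastEquiv {n : ℕ} (M : Matrix (Fin (n + 1)) (Fin (n + 1)) ℂ) :
    M.submatrix (lastEquiv n) (lastEquiv n) =
      bordered (CoordAlgebra.initBlock M) (fun i => M i.castSucc (Fin.last n))
        (fun j => M (Fin.last n) j.castSucc) (M (Fin.last n) (Fin.last n)) := by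
  ext (i | i) (j | j) <;> rfl

theorem IsDissipative.submatrix {ι κ : Type*} [Fintype ι] [Fintype κ] {M : Matrix κ κ ℂ}
    (hM : IsDissipative M) (e : ι ≃ κ) : IsDissipative (M.submatrix e e) := by
  intro v hv
  have h := hM (v ∘ e.symm) fun h0 => hv (by
    funext i
    simpa using congrFun h0 (e i))
  rw [submatrix_mulVec_equiv, ← comp_equiv_symm_dotProduct]
  exact h

/-- The complex pivot is kept with its argument, since the exponents σ and τ act separately on q and
on its conjugate. -/
theorem logDet_succ {n : ℕ} {M : Matrix (Fin (n + 1)) (Fin (n + 1)) ℂ} (hM : IsDissipative M)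
    {w : Fin n → ℂ}
    (hw : CoordAlgebra.initBlock M *ᵥ w = fun i => M i.castSucc (Fin.last n)) :
    logDet M = logDet (CoordAlgebra.initBlock M) +
      Complex.log (M (Fin.last n) (Fin.last n) - (fun j => M (Fin.last n) j.castSucc) ⬝ᵥ w) := by
  have h := hM.submatrix (lastEquiv n)
  rw [submatrix_lastEquiv] at h
  have h1 := logDet_bordered h
  rw [← submatrix_lastEquiv, ← hw, mulVec_mulVec,
    nonsing_inv_mul _ h.of_bordered.det_ne_zero.isUnit, one_mulVec] at h1
  rw [← h1]
  exact (logDet_reindex (lastEquiv n).symm M).symm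

theorem re_skew_eq_zero {ι : Type*} [Fintype ι] {S : Matrix ι ι ℂ} (hS : Sᴴ = -S) (v : ι → ℂ) :
    (star v ⬝ᵥ S *ᵥ v).re = 0 := by
  have h : star (star v ⬝ᵥ S *ᵥ v) = -(star v ⬝ᵥ S *ᵥ v) := by
    rw [← star_dotProduct_star, star_star, star_mulVec, hS, vecMul_neg, neg_dotProduct,
      ← dotProduct_mulVec]
  have h1 := congrArg Complex.re h
  simp only [RCLike.star_def, Complex.conj_re, Complex.neg_re] at h1
  linarith

theorem isDissipative_herm {n : ℕ} {x : Coords (Fin 2) ℝ n} (hx : x ∈ complexAlgebra.domain n) :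
    IsDissipative (complexAlgebra.herm x) :=
  (complexAlgebra.mem_domain_iff surjective_coord_complexAlgebra x).1 hx

theorem isDissipative_one_add {n : ℕ} {x : Coords (Fin 2) ℝ n}
    (hx : x ∈ complexAlgebra.domain n) :
    IsDissipative (1 + complexAlgebra.herm x + complexAlgebra.skew x) := by
  intro v hv
  have h1 := re_star_dotProduct_self_pos hv
  have h2 := isDissipative_herm hx v hv
  have h3 := re_skew_eq_zero (complexAlgebra.skew_conjTranspose x) v
  simp only [add_mulVec, one_mulVec, dotProduct_add, Complex.add_re]
  linarith

theorem absDet_complexAlgebra (q : ℝ × ℝ) :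
    complexAlgebra.absDet q = ‖complexAlgebra.ofReIm q‖ ^ 2 := by
  have h : (complexAlgebra.lmul (complexAlgebra.ofReIm q)).det =
      Complex.normSq (complexAlgebra.ofReIm q) := by
    change (Algebra.leftMulMatrix Complex.basisOneI (complexAlgebra.ofReIm q)).det = _
    rw [Algebra.leftMulMatrix_complex, det_fin_two_of, Complex.normSq_apply]
    ring
  rw [CoordAlgebra.absDet, h, abs_of_nonneg (Complex.normSq_nonneg _), Complex.sq_norm]

theorem ofReIm_complexAlgebra (r s : ℝ) :
    complexAlgebra.ofReIm (r, s) = r + s * Complex.I := by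
  simp [CoordAlgebra.ofReIm, complexAlgebra]

/-- The logarithm of the determinant over `ℂ`. -/
def complexLogPivot : LogPivot complexAlgebra where
  logDet R := logDet R
  logDet_reindex e R := logDet_reindex e R
  logDet_zero R := by
    have h := logDet_map_ofReal (posDef_of_isEmpty ((0 : Matrix (Fin 0) (Fin 0) ℝ) + 0ᵀ))
    rw [det_isEmpty, Real.log_one] at h
    rw [← Complex.ofReal_zero, ← h]
    congr 1
    exact ext fun i => i.elim0
  log q := Complex.log (complexAlgebra.ofReIm q)
  measurable_log := by
    have h : complexAlgebra.ofReIm = fun q : ℝ × ℝ => (q.1 + q.2 * Complex.I : ℂ) :=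
      funext fun q => ofReIm_complexAlgebra q.1 q.2
    refine Complex.measurable_log.comp ?_
    rw [h]
    fun_prop
  log_smul c hc r hr s := by
    have h : complexAlgebra.ofReIm (c * r, c • s) = c * complexAlgebra.ofReIm (r, s) := by
      rw [ofReIm_complexAlgebra, ofReIm_complexAlgebra, smul_eq_mul]
      push_cast
      ring
    have h0 : complexAlgebra.ofReIm (r, s) ≠ 0 := fun h0 => by
      rw [ofReIm_complexAlgebra] at h0
      have := congrArg Complex.re h0
      simp at this
      exact hr.ne' this
    rw [h, Complex.log_ofReal_mul hc h0]
  absDet_eq r hr s := by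
    have h0 : complexAlgebra.ofReIm (r, s) ≠ 0 := fun h0 => by
      rw [ofReIm_complexAlgebra] at h0
      have := congrArg Complex.re h0
      simp at this
      exact hr.ne' this
    rw [absDet_complexAlgebra, Complex.log_re, Fintype.card_fin, Real.exp_nat_mul,
      Real.exp_log (norm_pos_iff.2 h0)]
  logDet_herm {n x} hx := by
    obtain ⟨hx', hp⟩ := complexAlgebra.mem_domain_succ.1 hx
    have h := logDet_succ (isDissipative_herm hx)
      (w := complexAlgebra.ofCoords ((complexAlgebra.realT (splitLast x).1)⁻¹ *ᵥ
        (splitLast x).2.1.1)) (complexAlgebra.initBlock_herm_mulVec hx')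
    rw [h, complexAlgebra.schur_herm hx', complexAlgebra.initBlock_herm, Complex.coe_algebraMap,
      Complex.ofReal_log hp.le]
  logDet_one_add {n x} hx := by
    obtain ⟨hx', hp⟩ := complexAlgebra.mem_domain_succ.1 hx
    have h := logDet_succ (isDissipative_one_add hx)
      (w := complexAlgebra.ofCoords ((complexAlgebra.realQ (splitLast x).1)⁻¹ *ᵥ
        ((splitLast x).2.1.1 + (splitLast x).2.1.2)))
      (complexAlgebra.initBlock_one_add_mulVec hx')
    rw [h, complexAlgebra.schur_one_add, complexAlgebra.initBlock_one_add]

/-! ### The integrands -/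

theorem logDet_realLogPivot_realAlgebra {ι : Type} [Fintype ι] [DecidableEq ι]
    (R : Matrix ι ι ℝ) :
    realAlgebra.realLogPivot.logDet R = logDet (R.map Complex.ofReal) := by
  have h : (realAlgebra.realify R).map Complex.ofReal =
      reindex (Equiv.prodPUnit ι).symm (Equiv.prodPUnit ι).symm (R.map Complex.ofReal) := by
    ext ⟨i, _⟩ ⟨j, _⟩
    simp [CoordAlgebra.realify, realAlgebra, Algebra.ofId_apply, algebraMap_eq_diagonal]
  simp only [CoordAlgebra.realLogPivot]
  rw [h, logDet_reindex]
  simp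

theorem realDetPow_eq_exp {ι : Type} [Fintype ι] [DecidableEq ι] (R : Matrix ι ι ℝ) (τ : ℂ) :
    realDetPow R τ = Complex.exp (τ * realAlgebra.realLogPivot.logDet R) := by
  rw [logDet_realLogPivot_realAlgebra]
  rfl

theorem quatDetPow_eq_exp {ι : Type} [Fintype ι] [DecidableEq ι] (R : Matrix ι ι ℍ[ℝ]) (τ : ℂ) :
    quatDetPow R τ = Complex.exp (τ * quatAlgebra.realLogPivot.logDet R) := by
  have h : quatAlgebra.realLogPivot.logDet R =
      logDet ((realification R).map Complex.ofReal) / 4 := by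
    simp only [CoordAlgebra.realLogPivot, Fintype.card_fin]
    rfl
  rw [h, quatDetPow, realDetPow, complexDetPow]
  congr 1
  ring

theorem realIntegrand_eq {n : ℕ} {lam sig : ℕ → ℂ} (hlam : lam (n + 1) = 0)
    (hsig : sig (n + 1) = 0) {x : RealCoords n} (hx : x ∈ realDomain n) :
    realIntegrand n lam sig x = realAlgebra.pivotProd n (fun k => lam (k + 1) - n)
      (fun k => realAlgebra.realLogPivot.pivotPow (sig (k + 1)) 0) (realCoords x) := by
  have h := realAlgebra.realLogPivot.prod_leadingBlock_eq_pivotProd (-(n : ℂ)) lam sig 0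
    ((mem_realDomain_iff x).1 hx)
  simp only [hlam, hsig, Pi.zero_apply, sub_zero, zero_mul, Complex.exp_zero, mul_one, div_one,
    zero_sub, ← realDetPow_eq_exp, ← sub_eq_add_neg, herm_realCoords, skew_realCoords] at h
  exact h

theorem complexIntegrand_eq {n : ℕ} {lam sig tau : ℕ → ℂ} (hlam : lam (n + 1) = 0)
    (hsig : sig (n + 1) = 0) (htau : tau (n + 1) = 0) {x : ComplexCoords n}
    (hx : x ∈ complexDomain n) :
    complexIntegrand n lam sig tau x = complexAlgebra.pivotProd n (fun k => lam (k + 1) - 2 * n)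
      (fun k => complexLogPivot.pivotPow (sig (k + 1)) (tau (k + 1))) (complexCoords x) := by
  have h := complexLogPivot.prod_leadingBlock_eq_pivotProd (-(2 * n : ℂ)) lam sig tau
    ((mem_complexDomain_iff x).1 hx)
  simp only [hlam, hsig, htau, zero_mul, Complex.exp_zero, mul_one, div_one,
    zero_sub, ← sub_eq_add_neg, herm_complexCoords, skew_complexCoords] at h
  exact h

theorem quatIntegrand_eq {n : ℕ} {lam sig : ℕ → ℂ} (hlam : lam (n + 1) = 0)
    (hsig : sig (n + 1) = 0) {x : QuatCoords n} (hx : x ∈ quatDomain n) :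
    quatIntegrand n lam sig x = quatAlgebra.pivotProd n (fun k => lam (k + 1) - 4 * n)
      (fun k => quatAlgebra.realLogPivot.pivotPow (sig (k + 1)) 0) x := by
  have h := quatAlgebra.realLogPivot.prod_leadingBlock_eq_pivotProd (-(4 * n : ℂ)) lam sig 0
    ((mem_quatDomain_iff x).1 hx)
  simp only [hlam, hsig, Pi.zero_apply, sub_zero, zero_mul, Complex.exp_zero, mul_one, div_one,
    zero_sub, ← quatDetPow_eq_exp, ← sub_eq_add_neg, herm_quat, skew_quat] at h
  exact h

/-! ### Integrals over the imaginary part -/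

theorem integral_pivotPow_real (σ τ : ℂ) :
    Integrable (fun s => realAlgebra.realLogPivot.pivotPow σ τ (1, s)) ∧
    ∫ s, realAlgebra.realLogPivot.pivotPow σ τ (1, s) = 1 := by
  have h : ∀ s, realAlgebra.realLogPivot.pivotPow σ τ (1, s) = 1 := fun s => by
    have : realAlgebra.absDet (1, s) = 1 := by
      simp [CoordAlgebra.absDet, CoordAlgebra.ofReIm, realAlgebra]
    simp [LogPivot.pivotPow, CoordAlgebra.realLogPivot, this]
  have : IsProbabilityMeasure (volume : Measure (Fin 0 → ℝ)) :=
    ⟨by rw [Measure.volume_pi_eq_dirac]; simp⟩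
  simp only [h]
  exact ⟨integrable_const _, by simp⟩

/-- The conjugate of log(1 + is) is log(1 - is), because 1 + is lies off the branch cut. -/
theorem pivotPow_complex (σ τ : ℂ) (s : ℝ) :
    complexLogPivot.pivotPow σ τ (1, s) = cauchyKernel σ τ s := by
  have h1 := one_add_mul_I_mem_slitPlane s
  have h2 := one_sub_mul_I_mem_slitPlane s
  have h3 : star (1 + s * Complex.I) = 1 - s * Complex.I := by
    simp [sub_eq_add_neg]
  rw [LogPivot.pivotPow, cauchyKernel, Complex.cpow_def_of_ne_zero (Complex.slitPlane_ne_zero h1),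
    Complex.cpow_def_of_ne_zero (Complex.slitPlane_ne_zero h2), ← h3, RCLike.star_def,
    Complex.log_conj _ (Complex.slitPlane_arg_ne_pi h1)]
  simp only [complexLogPivot, ofReIm_complexAlgebra, Complex.ofReal_one]
  rw [mul_comm (-σ), mul_comm (-τ)]

theorem det_quatLeftMul (q : ℍ[ℝ]) :
    (quatLeftMul q).det = (q.re ^ 2 + q.imI ^ 2 + q.imJ ^ 2 + q.imK ^ 2) ^ 2 := by
  simp [quatLeftMul, det_succ_row_zero, Fin.sum_univ_succ, Fin.succAbove]
  ring

/-- Left multiplication by q has determinant |q|⁴, so the normalised logarithm is half of log(1 +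
|s|²). It is real, and only σ + τ matters. -/
theorem pivotPow_quat (σ τ : ℂ) (s : Fin 3 → ℝ) :
    quatAlgebra.realLogPivot.pivotPow σ τ (1, s) =
      ((1 + s ⬝ᵥ s : ℝ) : ℂ) ^ (-((σ + τ) / 2)) := by
  have h0 : 0 ≤ s ⬝ᵥ s := by simpa using dotProduct_star_self_nonneg s
  have h1 : 0 < 1 + s ⬝ᵥ s := by linarith
  have h : quatAlgebra.absDet (1, s) = (1 + s ⬝ᵥ s) ^ 2 := by
    have h2 : quatAlgebra.lmul (quatAlgebra.ofReIm (1, s)) = quatLeftMul (1 + quatImOf s) := by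
      change quatLeftMul (algebraMap ℝ ℍ[ℝ] 1 + quatImOf s) = _
      rw [map_one]
    rw [CoordAlgebra.absDet, h2, det_quatLeftMul, abs_of_nonneg (sq_nonneg _)]
    congr 1
    simp [dotProduct, Fin.sum_univ_three]
    ring
  rw [Complex.cpow_def_of_ne_zero (Complex.ofReal_ne_zero.2 h1.ne'), ← Complex.ofReal_log h1.le]
  simp only [LogPivot.pivotPow, CoordAlgebra.realLogPivot, h, Real.log_pow, RCLike.star_def,
    Complex.conj_ofReal]
  rw [← Complex.exp_add]
  congr 1
  push_cast [Fintype.card_fin]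
  ring

end

section

/-! ### The three integrals -/

theorem prod_Icc_one_eq_prod_range {M : Type*} [CommMonoid M] (f : ℕ → M) (n : ℕ) :
    ∏ k ∈ Finset.Icc 1 n, f k = ∏ k ∈ Finset.range n, f (k + 1) := by
  induction n with
  | zero => simp
  | succ n ih => rw [Finset.prod_Icc_succ_top (by omega), Finset.prod_range_succ, ih]

theorem natCast_sub_one_sub {n k : ℕ} (hk : k < n) :
    ((n - 1 - k : ℕ) : ℂ) = n - ((k + 1 : ℕ) : ℂ) := by
  rw [Nat.sub_sub, Nat.cast_sub (by omega), add_comm]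

theorem mem_Icc_succ {n k : ℕ} (hk : k < n) : k + 1 ∈ Finset.Icc 1 n :=
  Finset.mem_Icc.2 ⟨by omega, hk⟩

theorem integral_realIntegrand {n : ℕ} {lam sig : ℕ → ℂ} (hlam : lam (n + 1) = 0)
    (hsig : sig (n + 1) = 0) (h : ∀ k ∈ Finset.Icc 1 n,
      0 < (lam k - (n + k) / 2 + 1).re ∧ 0 < (sig k - lam k - (n - k) / 2).re) :
    IntegrableOn (realIntegrand n lam sig) (realDomain n) ∧
    ∫ x in realDomain n, realIntegrand n lam sig x =
      ∏ k ∈ Finset.Icc 1 n, (Real.pi : ℂ) ^ (k - 1) *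
        (Complex.Gamma (lam k - (n + k) / 2 + 1) * Complex.Gamma (sig k - lam k - (n - k) / 2)) /
        Complex.Gamma (sig k - n + k) := by
  -- The recursion counts rows from 0 and the formula from 1; these identities match the arguments
  -- of the Gamma functions. The shift (n - 1 - k)/2 combines with the exponent -n of det T.
  have e1 : ∀ k < n, lam (k + 1) - n + ((n - 1 - k : ℕ) : ℂ) * ((Fintype.card Unit : ℂ) / 2) + 1 =
      lam (k + 1) - (n + (k + 1 : ℕ)) / 2 + 1 := fun k hk => by
    rw [natCast_sub_one_sub hk, Fintype.card_unit]
    push_cast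
    ring
  have e2 : ∀ k < n, sig (k + 1) + 0 - ((n - 1 - k : ℕ) : ℂ) * (Fintype.card Unit : ℂ) -
      Module.finrank ℝ (Fin 0 → ℝ) = sig (k + 1) - n + (k + 1 : ℕ) := fun k hk => by
    rw [natCast_sub_one_sub hk, Fintype.card_unit, Module.finrank_fin_fun]
    push_cast
    ring
  have e3 : ∀ k < n, sig (k + 1) - n + (k + 1 : ℕ) -
      (lam (k + 1) - (n + (k + 1 : ℕ)) / 2 + 1 + k * (Fintype.card Unit : ℂ)) =
      sig (k + 1) - lam (k + 1) - (n - (k + 1 : ℕ)) / 2 := fun k hk => by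
    rw [Fintype.card_unit]
    push_cast
    ring
  obtain ⟨hi, hv⟩ := realAlgebra.realLogPivot.integral_pivotProd n (fun k => lam (k + 1) - n)
    (fun k => sig (k + 1)) (fun _ => 0)
    (fun k hk => by
      rw [e1 k hk]
      exact (h _ (mem_Icc_succ hk)).1)
    (fun k hk => by
      rw [e1 k hk, e2 k hk, e3 k hk]
      exact (h _ (mem_Icc_succ hk)).2)
    (fun k _ => (integral_pivotPow_real _ _).1)
  obtain ⟨hi', hv'⟩ := LogPivot.integral_comp (measurePreserving_realCoords n)
    mem_realDomain_iff (fun x hx => realIntegrand_eq hlam hsig hx) hi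
  refine ⟨hi', hv'.trans (hv.trans ?_)⟩
  rw [prod_Icc_one_eq_prod_range]
  refine Finset.prod_congr rfl fun k hk => ?_
  have hk' := Finset.mem_range.1 hk
  rw [e1 k hk', e2 k hk', e3 k hk', (integral_pivotPow_real _ _).2, Fintype.card_unit, mul_one,
    Nat.add_sub_cancel]
  ring

theorem integral_complexIntegrand {n : ℕ} {lam sig tau : ℕ → ℂ} (hlam : lam (n + 1) = 0)
    (hsig : sig (n + 1) = 0) (htau : tau (n + 1) = 0) (h : ∀ k ∈ Finset.Icc 1 n,
      0 < (lam k - n - k + 1).re ∧ 0 < (sig k + tau k - lam k - n + k).re) :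
    IntegrableOn (complexIntegrand n lam sig tau) (complexDomain n) ∧
    ∫ x in complexDomain n, complexIntegrand n lam sig tau x =
      ∏ k ∈ Finset.Icc 1 n,
        (2 : ℂ) ^ (2 * (n - k + 1) - sig k - tau k) * (Real.pi : ℂ) ^ (2 * k - 1) *
          (Complex.Gamma (lam k - n - k + 1) *
            Complex.Gamma (sig k + tau k - lam k - n + k)) /
          (Complex.Gamma (sig k - n + k) * Complex.Gamma (tau k - n + k)) := by
  have e1 : ∀ k < n, lam (k + 1) - 2 * n +
      ((n - 1 - k : ℕ) : ℂ) * ((Fintype.card (Fin 2) : ℂ) / 2) + 1 =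
      lam (k + 1) - n - (k + 1 : ℕ) + 1 := fun k hk => by
    rw [natCast_sub_one_sub hk, Fintype.card_fin]
    push_cast
    ring
  have e2 : ∀ k < n, sig (k + 1) + tau (k + 1) -
      ((n - 1 - k : ℕ) : ℂ) * (Fintype.card (Fin 2) : ℂ) - Module.finrank ℝ ℝ =
      (sig (k + 1) - n + (k + 1 : ℕ)) + (tau (k + 1) - n + (k + 1 : ℕ)) - 1 := fun k hk => by
    rw [natCast_sub_one_sub hk, Fintype.card_fin, Module.finrank_self]
    push_cast
    ring
  have e3 : ∀ k < n, (sig (k + 1) - n + (k + 1 : ℕ)) + (tau (k + 1) - n + (k + 1 : ℕ)) - 1 -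
      (lam (k + 1) - n - (k + 1 : ℕ) + 1 + k * (Fintype.card (Fin 2) : ℂ)) =
      sig (k + 1) + tau (k + 1) - lam (k + 1) - n + (k + 1 : ℕ) := fun k hk => by
    rw [Fintype.card_fin]
    push_cast
    ring
  have e4 : ∀ k < n, ∀ σ : ℂ, σ - ((n - 1 - k : ℕ) : ℂ) * ((Fintype.card (Fin 2) : ℂ) / 2) =
      σ - n + (k + 1 : ℕ) := fun k hk σ => by
    rw [natCast_sub_one_sub hk, Fintype.card_fin]
    push_cast
    ring
  -- Adding the two hypotheses gives Re(σ + τ) > 2n - 1 for the row with index K = k + 1. Hence the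
  -- sum of the shifted parameters has real part above 2K - 1 ≥ 1.
  have hpos : ∀ k < n,
      1 < ((sig (k + 1) - n + (k + 1 : ℕ)) + (tau (k + 1) - n + (k + 1 : ℕ))).re := fun k hk => by
    obtain ⟨h1, h2⟩ := h _ (mem_Icc_succ hk)
    simp only [Complex.add_re, Complex.sub_re, Complex.natCast_re, Complex.one_re] at h1 h2 ⊢
    push_cast at h1 h2 ⊢
    have : (0 : ℝ) ≤ k := k.cast_nonneg
    linarith
  obtain ⟨hi, hv⟩ := complexLogPivot.integral_pivotProd n (fun k => lam (k + 1) - 2 * n)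
    (fun k => sig (k + 1)) (fun k => tau (k + 1))
    (fun k hk => by
      rw [e1 k hk]
      exact (h _ (mem_Icc_succ hk)).1)
    (fun k hk => by
      rw [e1 k hk, e2 k hk, e3 k hk]
      exact (h _ (mem_Icc_succ hk)).2)
    (fun k hk => by
      simp only [pivotPow_complex]
      rw [e4 k hk, e4 k hk]
      exact integrable_cauchyKernel (hpos k hk))
  obtain ⟨hi', hv'⟩ := LogPivot.integral_comp (measurePreserving_complexCoords n)
    mem_complexDomain_iff (fun x hx => complexIntegrand_eq hlam hsig htau hx) hi
  refine ⟨hi', hv'.trans (hv.trans ?_)⟩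
  rw [prod_Icc_one_eq_prod_range]
  refine Finset.prod_congr rfl fun k hk => ?_
  have hk' := Finset.mem_range.1 hk
  simp only [pivotPow_complex]
  rw [e1 k hk', e2 k hk', e3 k hk', e4 k hk', e4 k hk', integral_cauchyKernel (hpos k hk')]
  -- This Gamma factor, the numerator of Cauchy's beta integral, cancels against the denominator of
  -- the fibre integral.
  have hG : Complex.Gamma ((sig (k + 1) - n + (k + 1 : ℕ)) + (tau (k + 1) - n + (k + 1 : ℕ)) - 1) ≠
      0 := Complex.Gamma_ne_zero_of_re_pos (by
    rw [Complex.sub_re, Complex.one_re]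
    linarith [hpos k hk'])
  have h2 : (2 : ℂ) ^ (2 * ((n : ℂ) - (k + 1 : ℕ) + 1) - sig (k + 1) - tau (k + 1)) =
      2 * 2 ^ (1 - (sig (k + 1) - n + (k + 1 : ℕ)) - (tau (k + 1) - n + (k + 1 : ℕ))) := by
    rw [show 2 * ((n : ℂ) - (k + 1 : ℕ) + 1) - sig (k + 1) - tau (k + 1) =
      1 + (1 - (sig (k + 1) - n + (k + 1 : ℕ)) - (tau (k + 1) - n + (k + 1 : ℕ))) by ring,
      Complex.cpow_add _ _ two_ne_zero, Complex.cpow_one]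
  have h3 : 2 * (k + 1) - 1 = k * 2 + 1 := by omega
  rw [h2, h3, pow_succ, Fintype.card_fin]
  field_simp

theorem integral_quatIntegrand {n : ℕ} {lam sig : ℕ → ℂ} (hlam : lam (n + 1) = 0)
    (hsig : sig (n + 1) = 0) (h : ∀ k ∈ Finset.Icc 1 n,
      0 < (lam k - 2 * (n + k) + 1).re ∧ 0 < (sig k - lam k - 2 * (n - k)).re) :
    IntegrableOn (quatIntegrand n lam sig) (quatDomain n) ∧
    ∫ x in quatDomain n, quatIntegrand n lam sig x =
      ∏ k ∈ Finset.Icc 1 n,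
        (2 : ℂ) ^ (4 * (n - k + 1) - sig k) * (Real.pi : ℂ) ^ (4 * k - 2) *
          (Complex.Gamma (lam k - 2 * (n + k) + 1) *
            Complex.Gamma (sig k - lam k - 2 * (n - k))) /
          (Complex.Gamma (sig k / 2 - 2 * (n - k)) *
            Complex.Gamma (sig k / 2 - 2 * (n - k) - 1)) := by
  have e1 : ∀ k < n, lam (k + 1) - 4 * n +
      ((n - 1 - k : ℕ) : ℂ) * ((Fintype.card (Fin 4) : ℂ) / 2) + 1 =
      lam (k + 1) - 2 * (n + (k + 1 : ℕ)) + 1 := fun k hk => by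
    rw [natCast_sub_one_sub hk, Fintype.card_fin]
    push_cast
    ring
  have e2 : ∀ k < n, sig (k + 1) + 0 - ((n - 1 - k : ℕ) : ℂ) * (Fintype.card (Fin 4) : ℂ) -
      Module.finrank ℝ (Fin 3 → ℝ) = 2 * (sig (k + 1) / 2 - 2 * (n - (k + 1 : ℕ)) - 3 / 2) :=
    fun k hk => by
      rw [natCast_sub_one_sub hk, Fintype.card_fin, Module.finrank_fin_fun]
      push_cast
      ring
  have e3 : ∀ k < n, 2 * (sig (k + 1) / 2 - 2 * (n - (k + 1 : ℕ)) - 3 / 2) -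
      (lam (k + 1) - 2 * (n + (k + 1 : ℕ)) + 1 + k * (Fintype.card (Fin 4) : ℂ)) =
      sig (k + 1) - lam (k + 1) - 2 * (n - (k + 1 : ℕ)) := fun k hk => by
    rw [Fintype.card_fin]
    push_cast
    ring
  have e4 : ∀ k < n, (sig (k + 1) - ((n - 1 - k : ℕ) : ℂ) * ((Fintype.card (Fin 4) : ℂ) / 2) +
      (0 - ((n - 1 - k : ℕ) : ℂ) * ((Fintype.card (Fin 4) : ℂ) / 2))) / 2 =
      sig (k + 1) / 2 - 2 * (n - (k + 1 : ℕ)) := fun k hk => by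
    rw [natCast_sub_one_sub hk, Fintype.card_fin]
    push_cast
    ring
  -- Twice this quantity is the sum of the two Gamma arguments assumed positive, plus 4k.
  have hpos : ∀ k < n, 0 < (sig (k + 1) / 2 - 2 * (n - (k + 1 : ℕ)) - 3 / 2).re := fun k hk => by
    obtain ⟨h1, h2⟩ := h _ (mem_Icc_succ hk)
    have h3 := congrArg Complex.re (e3 k hk)
    have h4 : (2 * (sig (k + 1) / 2 - 2 * (n - (k + 1 : ℕ)) - 3 / 2)).re =
        2 * (sig (k + 1) / 2 - 2 * (n - (k + 1 : ℕ)) - 3 / 2).re := by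
      simp
    have h5 : ((k : ℂ) * (Fintype.card (Fin 4) : ℂ)).re = k * 4 := by
      rw [← Nat.cast_mul, Complex.natCast_re, Fintype.card_fin]
      push_cast
      ring
    rw [Complex.sub_re, h4, Complex.add_re _ ((k : ℂ) * _), h5] at h3
    have : (0 : ℝ) ≤ k := k.cast_nonneg
    linarith
  have hint := fun k (hk : k < n) => integral_add_dotProduct_self_cpow (ι := Fin 3)
    (ρ := sig (k + 1) / 2 - 2 * (n - (k + 1 : ℕ))) one_pos
    (by rw [Fintype.card_fin]; exact_mod_cast hpos k hk)
  obtain ⟨hi, hv⟩ := quatAlgebra.realLogPivot.integral_pivotProd n (fun k => lam (k + 1) - 4 * n)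
    (fun k => sig (k + 1)) (fun _ => 0)
    (fun k hk => by
      rw [e1 k hk]
      exact (h _ (mem_Icc_succ hk)).1)
    (fun k hk => by
      rw [e1 k hk, e2 k hk, e3 k hk]
      exact (h _ (mem_Icc_succ hk)).2)
    (fun k hk => by
      simp only [pivotPow_quat]
      rw [e4 k hk]
      exact (hint k hk).1)
  obtain ⟨hi', hv'⟩ := LogPivot.integral_comp (MeasurePreserving.id volume)
    mem_quatDomain_iff (fun x hx => quatIntegrand_eq hlam hsig hx) hi
  refine ⟨hi', hv'.trans (hv.trans ?_)⟩
  rw [prod_Icc_one_eq_prod_range]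
  refine Finset.prod_congr rfl fun k hk => ?_
  have hk' := Finset.mem_range.1 hk
  have hk'' := hpos k hk'
  simp only [pivotPow_quat]
  rw [e1 k hk', e2 k hk', e3 k hk', e4 k hk', (hint k hk').2, Complex.ofReal_one,
    Complex.one_cpow, mul_one]
  have e5 : (2 : ℂ) ^ (4 * ((n : ℂ) - (k + 1 : ℕ) + 1) - sig (k + 1)) =
      2 ^ (1 - 2 * (sig (k + 1) / 2 - 2 * ((n : ℂ) - (k + 1 : ℕ)) - 3 / 2)) := by
    congr 1
    ring
  have e6 : ((Fintype.card (Fin 3) : ℕ) : ℂ) / 2 = 3 / 2 := by simp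
  rw [e5, e6]
  set z := sig (k + 1) / 2 - 2 * ((n : ℂ) - (k + 1 : ℕ)) with hz
  -- The duplication formula at z - 3/2 rewrites the quotient of Γ(z - 3/2), from the
  -- three-dimensional integral, by Γ(2z - 3), from the fibre integral, as a power of 2 times √π /
  -- Γ(z - 1).
  have hd := Complex.Gamma_mul_Gamma_add_half (z - 3 / 2)
  rw [show z - 3 / 2 + 1 / 2 = z - 1 by ring] at hd
  have hG1 : Complex.Gamma (2 * (z - 3 / 2)) ≠ 0 := Complex.Gamma_ne_zero_of_re_pos (by
    have := Complex.re_ofReal_mul 2 (z - 3 / 2)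
    push_cast at this
    rw [this]
    linarith)
  have hG2 : Complex.Gamma (z - 1) ≠ 0 := Complex.Gamma_ne_zero_of_re_pos (by
    rw [show z - 1 = z - 3 / 2 + ((1 / 2 : ℝ) : ℂ) by push_cast; ring, Complex.add_re,
      Complex.ofReal_re]
    linarith)
  -- The factor π^(4k) comes from the Gaussians, π^(3/2) from the imaginary directions, and √π from
  -- duplication.
  have hpi : (Real.pi : ℂ) ^ (4 * (k + 1) - 2) =
      (Real.pi : ℂ) ^ (k * Fintype.card (Fin 4)) * ((Real.pi : ℂ) ^ (3 / 2 : ℂ) * (√Real.pi : ℝ)) := by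
    have h1 : ((√Real.pi : ℝ) : ℂ) = (Real.pi : ℂ) ^ (1 / 2 : ℂ) := by
      rw [Real.sqrt_eq_rpow, Complex.ofReal_cpow Real.pi_pos.le]
      push_cast
      rfl
    rw [h1, ← Complex.cpow_add _ _ (Complex.ofReal_ne_zero.2 Real.pi_ne_zero),
      show (3 / 2 + 1 / 2 : ℂ) = ((2 : ℕ) : ℂ) by norm_num, Complex.cpow_natCast, ← pow_add,
      Fintype.card_fin]
    congr 1
    omega
  rw [hpi]
  have hd' : Complex.Gamma (z - 3 / 2) / Complex.Gamma (2 * (z - 3 / 2)) =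
      2 ^ (1 - 2 * (z - 3 / 2)) * (√Real.pi : ℝ) / Complex.Gamma (z - 1) := by
    rw [div_eq_div_iff hG1 hG2, hd]
    ring
  calc _ = (Real.pi : ℂ) ^ (3 / 2 : ℂ) * (Real.pi : ℂ) ^ (k * Fintype.card (Fin 4)) *
        (Complex.Gamma (lam (k + 1) - 2 * (n + (k + 1 : ℕ)) + 1) *
          Complex.Gamma (sig (k + 1) - lam (k + 1) - 2 * (n - (k + 1 : ℕ)))) / Complex.Gamma z *
        (Complex.Gamma (z - 3 / 2) / Complex.Gamma (2 * (z - 3 / 2))) := by ring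
    _ = _ := by
      rw [hd']
      ring

end

end DissipativeWedge

end

theorem mainTheorem3 (n : ℕ) (lam sig tau : ℕ → ℂ)
    (hlam : lam (n + 1) = 0) (hsig : sig (n + 1) = 0) (htau : tau (n + 1) = 0) :
    -- the wedge over the reals
    ((∀ k ∈ Finset.Icc 1 n,
        0 < (lam k - (n + k) / 2 + 1).re ∧ 0 < (sig k - lam k - (n - k) / 2).re) →
      IntegrableOn (DissipativeWedge.realIntegrand n lam sig) (DissipativeWedge.realDomain n) ∧
      ∫ x in DissipativeWedge.realDomain n, DissipativeWedge.realIntegrand n lam sig x =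
        ∏ k ∈ Finset.Icc 1 n,
          (Real.pi : ℂ) ^ (k - 1) *
            (Complex.Gamma (lam k - (n + k) / 2 + 1) *
              Complex.Gamma (sig k - lam k - (n - k) / 2)) /
            Complex.Gamma (sig k - n + k)) ∧
    -- the wedge over the complex numbers
    ((∀ k ∈ Finset.Icc 1 n,
        0 < (lam k - n - k + 1).re ∧ 0 < (sig k + tau k - lam k - n + k).re) →
      IntegrableOn (DissipativeWedge.complexIntegrand n lam sig tau)
        (DissipativeWedge.complexDomain n) ∧
      ∫ x in DissipativeWedge.complexDomain n, DissipativeWedge.complexIntegrand n lam sig tau x =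
        ∏ k ∈ Finset.Icc 1 n,
          (2 : ℂ) ^ (2 * (n - k + 1) - sig k - tau k) * (Real.pi : ℂ) ^ (2 * k - 1) *
            (Complex.Gamma (lam k - n - k + 1) *
              Complex.Gamma (sig k + tau k - lam k - n + k)) /
            (Complex.Gamma (sig k - n + k) * Complex.Gamma (tau k - n + k))) ∧
    -- the wedge over the quaternions
    ((∀ k ∈ Finset.Icc 1 n,
        0 < (lam k - 2 * (n + k) + 1).re ∧ 0 < (sig k - lam k - 2 * (n - k)).re) →
      IntegrableOn (DissipativeWedge.quatIntegrand n lam sig) (DissipativeWedge.quatDomain n) ∧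
      ∫ x in DissipativeWedge.quatDomain n, DissipativeWedge.quatIntegrand n lam sig x =
        ∏ k ∈ Finset.Icc 1 n,
          (2 : ℂ) ^ (4 * (n - k + 1) - sig k) * (Real.pi : ℂ) ^ (4 * k - 2) *
            (Complex.Gamma (lam k - 2 * (n + k) + 1) *
              Complex.Gamma (sig k - lam k - 2 * (n - k))) /
            (Complex.Gamma (sig k / 2 - 2 * (n - k)) *
              Complex.Gamma (sig k / 2 - 2 * (n - k) - 1))) := by
  exact ⟨DissipativeWedge.integral_realIntegrand hlam hsig,
    DissipativeWedge.integral_complexIntegrand hlam hsig htau,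
    DissipativeWedge.integral_quatIntegrand hlam hsig⟩
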